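/- Let $M_1$ be a smooth manifold, let $M_2\subseteq\mathbb R^{n}$ be an open coordinate domain with coordinates $y=(y^1,\dots,y^n)$ and conjugate momenta $q=(q_1,\dots,q_n)$, and let $S_\hbar(x,q)=\sum_{m\ge 0,\alpha}\hbar^m S_{m,\alpha}(x)q^\alpha$ be a formal power series in $q$ and $\hbar$ with smooth (complex) coefficients on $M_1$, such that $S_0(x,q)=\sum_\alpha S_{0,\alpha}(x)q^\alpha$ is real and $\varphi(x)=\frac{\partial S_0}{\partial q}(x,0)\in M_2$ for all $x\in M_1$. The quantum pullback along the quantum thick morphism $\hat\Phi$ with generating function $S_\hbar$ is the oscillatory integral operator $$(\hat\Phi^*w)(x)=\frac1{(2\pi\hbar)^{n}}\int_{T^*M_2}e^{\frac i\hbar(S_\hbar(x,q)-y^iq_i)}\,w(y)\,Dy\,Dq .$$ Here the series $S_\hbar$ is represented by any function of $(\hbar,x,q)$, $\hbar>0$, that is continuous in $q$, has the series as its asymptotic expansion at $(\hbar,q)=(0,0)$ locally uniformly in $x$, and for which $|e^{\frac i\hbar S_\hbar(x,q)}|$ is bounded in $q$ for small $\hbar$, locally uniformly in $x$; the integral is taken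 first over $y$ and then over $q$. Let $g$ be a smooth real function on $M_2$. The nonlinear pullback of $g$ along the thick morphism $\Phi$ with generating function $S_0$ is the formal power series in $g$ obtained, with a formal parameter $t$ that counts the degree in $g$, as $$\Phi^*[tg](x)=t\,g(y)+S_0(x,q)-y^iq_i\in\mathbb R[[t]],\qquad q_j=t\,\frac{\partial g}{\partial y^j}(y),\quad y^j=\frac{\partial S_0}{\partial q_j}(x,q),$$ where $y=\varphi(x)+O(t)$ and $q=O(t)$ are formal power series in $t$. Then $f=\Phi^*[tg]=\sum_j f_jt^j$ is well defined, with smooth coefficients $f_j$ on $M_1$, and on the phases of oscillatory wave functions $\hat\Phi^*$ induces $\Phi^*$ in the limit $\hbar\to0$, in the following sense. There are continuous functions $a_j:M_1\to\mathbb C$, $j\ge 0$, depending only on $g$ and on the series $S_\hbar$, such that for every function representing $S_\hbar$ and every cutoff $\chi\in C_c^\infty(M_2)$ there are phases $\psi_\hbar(x,t)$ with the following properties near each point $x_0$ such that $\chi=1$ near $\varphi(x_0)$. For all sufficiently small $\hbar>0$ and all $x$ sufficiently near $x_0$, the integrals defining $\hat\Phi^*\bigl(\chi e^{\frac i\hbar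 tg}\bigr)(x)$ converge for every real $t$, $\psi_\hbar(x,t)$ is analytic in $t$ at $t=0$, and $$\hat\Phi^*\bigl(\chi e^{\frac i\hbar tg}\bigr)(x)=e^{\frac i\hbar\psi_\hbar(x,t)}\quad\text{for } t \text{ near } 0.$$ The Taylor coefficients at $t=0$, $\psi_\hbar(x,t)=\sum_j\psi_{\hbar,j}(x)t^j$, satisfy for every $j$ $$\psi_{\hbar,j}(x)=f_j(x)+\hbar\,a_j(x)+o(\hbar)\qquad(\hbar\to0^+),\ \text{uniformly in } x \text{ near } x_0.$$ That is, order by order in $g$, the result is asymptotically $e^{\frac i\hbar f}$ up to an amplitude $e^{i\sum_j a_jt^j}$ that does not oscillate as $\hbar\to0$. -/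

import Mathlib

open Filter Topology MeasureTheory
open scoped ContDiff Manifold

noncomputable section

namespace Microformal

/-- `ℝⁿ`, in which local coordinates `y` on the target and momenta `q` take their values. -/
abbrev Coord (n : ℕ) : Type := EuclideanSpace ℝ (Fin n)

/-- The pairing `yⁱ qᵢ`. -/
def pairing {n : ℕ} (y q : Coord n) : ℝ := ∑ i, y i * q i

/-- The generating function `S_ħ(x, q) = ∑ ħᵐ S_{m,α}(x) q^α` of a quantum thick morphism from the
manifold `M₁` to the coordinate domain `M₂ ⊆ ℝⁿ²`: a formal power series in `q` and `ħ` whose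
coefficients are smooth functions on `M₁`.  The classical part `S₀` is real, and the coefficients of
its linear part are the coordinates of a point of `M₂` (the underlying map `φ : M₁ → M₂`). -/
structure QuantumGeneratingFunction (n₁ : ℕ) (M₁ : Type*) [TopologicalSpace M₁]
    [ChartedSpace (EuclideanSpace ℝ (Fin n₁)) M₁] {n₂ : ℕ} (M₂ : Set (Coord n₂)) where
  /-- `coeff m α x` is the coefficient of `ħᵐ q^α` at `x`. -/
  coeff : ℕ → (Fin n₂ →₀ ℕ) → M₁ → ℂ
  contMDiff_coeff : ∀ m α, ContMDiff (𝓡 n₁) 𝓘(ℝ, ℂ) ∞ (coeff m α)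
  classical_real : ∀ α x, (coeff 0 α x).im = 0
  base_mem : ∀ x, WithLp.toLp 2 (fun i => (coeff 0 (Finsupp.single i 1) x).re) ∈ M₂

namespace QuantumGeneratingFunction

variable {n₁ : ℕ} {M₁ : Type*} [TopologicalSpace M₁]
  [ChartedSpace (EuclideanSpace ℝ (Fin n₁)) M₁] {n₂ : ℕ} {M₂ : Set (Coord n₂)}

/-- `S₀(x, ·)`, a real formal power series in `q`. -/
def classical (S : QuantumGeneratingFunction n₁ M₁ M₂) (x : M₁) : MvPowerSeries (Fin n₂) ℝ :=
  fun α => (S.coeff 0 α x).re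

/-- The underlying map `φ : M₁ → M₂`, `φⁱ(x) = ∂S₀/∂qᵢ (x, 0)`. -/
def base (S : QuantumGeneratingFunction n₁ M₁ M₂) (x : M₁) : Coord n₂ :=
  WithLp.toLp 2 (fun i => (S.coeff 0 (Finsupp.single i 1) x).re)

/-- The sum of the terms of `S_ħ(x, q)` of total degree `m + |α| < N` in `(ħ, q)`. -/
def partialSum (S : QuantumGeneratingFunction n₁ M₁ M₂) (N : ℕ) (ħ : ℝ) (x : M₁) (q : Coord n₂) : ℂ :=
  ∑ m ∈ Finset.range N, ∑ k ∈ Finset.range (N - m),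
    ∑ α ∈ Finset.finsuppAntidiag (Finset.univ : Finset (Fin n₂)) k,
      S.coeff m α x * (ħ : ℂ) ^ m * ((∏ i, q i ^ α i : ℝ) : ℂ)

/-- The function `F : (ħ, x, q) ↦ F ħ x q`, `ħ > 0`, represents the formal power series `S`: it has
`S` as its asymptotic expansion at `ħ = 0`, `q = 0`, locally uniformly in `x`.  It is continuous in
`q`, and `exp (i F / ħ)` is bounded for small `ħ` locally uniformly in `x`; the bound is automatic
if `F` is real. -/
structure IsRepresentedBy (S : QuantumGeneratingFunction n₁ M₁ M₂)
    (F : ℝ → M₁ → Coord n₂ → ℂ) : Prop where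
  continuous : ∀ ħ > 0, ∀ x, Continuous (F ħ x)
  expansion : ∀ (x₀ : M₁) (N : ℕ),
    (fun p : ℝ × M₁ × Coord n₂ => F p.1 p.2.1 p.2.2 - S.partialSum N p.1 p.2.1 p.2.2)
      =O[𝓝[>] 0 ×ˢ 𝓝 x₀ ×ˢ 𝓝 0] (fun p => (p.1 + ‖p.2.2‖) ^ N)
  bounded : ∀ x₀ : M₁, ∃ C : ℝ, ∀ᶠ p : ℝ × M₁ in 𝓝[>] 0 ×ˢ 𝓝 x₀, ∀ q,
    ‖Complex.exp (Complex.I / (p.1 : ℂ) * F p.1 p.2 q)‖ ≤ C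

end QuantumGeneratingFunction

/-! ### The quantum pullback -/

/-- The inner integral `∫_{M₂} e^{(i/ħ)(F_ħ(x,q) - yⁱqᵢ)} w(y) Dy`. -/
def fibreIntegral {X : Type*} {n : ℕ} (M₂ : Set (Coord n)) (F : ℝ → X → Coord n → ℂ) (ħ : ℝ)
    (w : Coord n → ℂ) (x : X) (q : Coord n) : ℂ :=
  ∫ y in M₂, Complex.exp (Complex.I / (ħ : ℂ) * (F ħ x q - (pairing y q : ℂ))) * w y

/-- The quantum pullback
`(Φ̂^* w)(x) = (2πħ)^{-n₂} ∫∫_{T^*M₂} e^{(i/ħ)(F_ħ(x,q) - yⁱqᵢ)} w(y) Dy Dq`, an oscillatory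
integral over `T^*M₂ = M₂ × ℝⁿ²`, integrated first over `y` and then over `q`. -/
def quantumPullback {X : Type*} {n : ℕ} (M₂ : Set (Coord n)) (F : ℝ → X → Coord n → ℂ) (ħ : ℝ)
    (w : Coord n → ℂ) (x : X) : ℂ :=
  (1 / ((2 * Real.pi * ħ) ^ n : ℝ) : ℂ) * ∫ q, fibreIntegral M₂ F ħ w x q

/-- Both integrals in the definition of the quantum pullback converge absolutely. -/
def QuantumPullbackConverges {X : Type*} {n : ℕ} (M₂ : Set (Coord n)) (F : ℝ → X → Coord n → ℂ)
    (ħ : ℝ) (w : Coord n → ℂ) (x : X) : Prop :=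
  (∀ q, IntegrableOn
    (fun y => Complex.exp (Complex.I / (ħ : ℂ) * (F ħ x q - (pairing y q : ℂ))) * w y) M₂) ∧
  Integrable (fibreIntegral M₂ F ħ w x)

/-- The oscillatory wave function `χ(y) e^{(i/ħ) t g(y)}`. -/
def waveFunction {n : ℕ} (χ g : Coord n → ℝ) (ħ t : ℝ) (y : Coord n) : ℂ :=
  (χ y : ℂ) * Complex.exp (Complex.I / (ħ : ℂ) * ((t * g y : ℝ) : ℂ))

/-! ### The nonlinear pullback -/

/-- The partial derivative `∂g/∂yⁱ`. -/
def partialDeriv {n : ℕ} (i : Fin n) (g : Coord n → ℝ) (y : Coord n) : ℝ :=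
  fderiv ℝ g y (EuclideanSpace.single i 1)

/-- The mixed partial derivative `∂^α g`. -/
def mixedDeriv {n : ℕ} (α : Fin n →₀ ℕ) (g : Coord n → ℝ) : Coord n → ℝ :=
  (List.finRange n).foldr (fun i h => (partialDeriv i)^[α i] h) g

/-- The Taylor series `∑ ∂^α g(b) / α! · h^α` of `g` at `b`. -/
def taylorSeries {n : ℕ} (g : Coord n → ℝ) (b : Coord n) : MvPowerSeries (Fin n) ℝ :=
  fun α => mixedDeriv α g b / ((∏ i, (α i).factorial : ℕ) : ℝ)

/-- The formal power series `g(y)` in `t`, for a formal curve `y = b + O(t)`: the Taylor series of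
`g` at `b` is evaluated at `y - b`. -/
def compFormal {n : ℕ} (g : Coord n → ℝ) (b : Coord n) (y : Fin n → PowerSeries ℝ) :
    PowerSeries ℝ :=
  MvPowerSeries.subst (fun i => y i - PowerSeries.C (b i)) (taylorSeries g b)

/-- The formal power series `S₀(q)` in `t`, for a formal curve `q = O(t)`. -/
def substFormal {n : ℕ} (S₀ : MvPowerSeries (Fin n) ℝ) (q : Fin n → PowerSeries ℝ) :
    PowerSeries ℝ :=
  MvPowerSeries.subst q S₀

/-- The formal curves `y = b + O(t)` and `q = O(t)` solve
`qᵢ = t ∂g/∂yⁱ (y)`, `yⁱ = ∂S₀/∂qᵢ (q)`. -/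
structure IsCritical {n : ℕ} (S₀ : MvPowerSeries (Fin n) ℝ) (b : Coord n) (g : Coord n → ℝ)
    (y q : Fin n → PowerSeries ℝ) : Prop where
  constantCoeff_y : ∀ i, PowerSeries.constantCoeff (y i) = b i
  constantCoeff_q : ∀ i, PowerSeries.constantCoeff (q i) = 0
  momentum : ∀ i, q i = PowerSeries.X * compFormal (partialDeriv i g) b y
  position : ∀ i, y i = substFormal (MvPowerSeries.pderiv ℝ i S₀) q

/-- `f ∈ ℝ⟦t⟧` is the value of the nonlinear pullback `Φ^*[t g]` at a point at which the generating
function is `S₀` and the underlying map takes the value `b`: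
`f = t g(y) + S₀(q) - yⁱ qᵢ` with `qᵢ = t ∂g/∂yⁱ (y)` and `yⁱ = ∂S₀/∂qᵢ (q)`.  The coefficient of
`tʲ` is the part of `Φ^*[g]` that is homogeneous of degree `j` in `g`. -/
def IsNonlinearPullback {n : ℕ} (S₀ : MvPowerSeries (Fin n) ℝ) (b : Coord n) (g : Coord n → ℝ)
    (f : PowerSeries ℝ) : Prop :=
  ∃ y q : Fin n → PowerSeries ℝ, IsCritical S₀ b g y q ∧
    f = PowerSeries.X * compFormal g b y + substFormal S₀ q - ∑ i, y i * q i

end Microformal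

end

/-! With the substitution q = ħξ the quantum pullback becomes a Fourier multiplier. The kernel
contributes exp((i/ħ) S_ħ(x, ħξ)), in which the monomial ħᵐ q^α carries ħ^{m+|α|-1}. The terms of
total degree 0 and 1 in (ħ, q) are a scalar factor and the exponential exp(i φ(x)·ξ), which
evaluates at φ(x). The remaining terms have positive powers of ħ. Hence, up to the scalar, the
pullback of w is asymptotically the value at φ(x) of E(ħ)w, where E(ħ) = exp(∑ i (-i)^{|α|} S_{m,α}
ħ^{m+|α|-1} ∂^α) over m + |α| ≥ 2. This is proved with remainder O(ħ^{R+1}), locally uniformly in x,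
in `exists_symbol_bound` and `exists_reducedPullback_expansion`.

The wave function depends on t through τ = t/ħ. For fixed ħ the pullback is a convergent power
series in τ whose coefficients are the pullbacks of χ (ig)ᵏ/k! (`hasSum_reducedPullback`). Near
φ(x₀) the cutoff is 1 and differential operators are local, so the expansion of each coefficient is
a polynomial in the jets of g and the coefficients of S. Together they form the formal series W =
E(ħ) exp(τG), studied over a ring of universal jets where G and its derivatives are independent
variables.

A power ħˡτʲ equals ħ^{l-j}tʲ, so a priori log W has arbitrarily negative powers of ħ when written
in t. The formal core is that only 1/ħ occurs. Let N, κₖ and P be the logarithmic derivatives of W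
along ħ∂/∂ħ, ∂ₖ and ∂/∂τ. The differential equation of W expresses N through κ, and commutation of
derivations gives ħ∂κₖ/∂ħ = ∂ₖN and ħ∂P/∂ħ = ∂N/∂τ. Induction on the power of ħ bounds the τ-degree
(`filtered_logDeriv`). In the leading terms a derivative of W acts as multiplication by κ, so the
leading part of N is (∑qᵢ∂/∂qᵢ - 1)H evaluated on the leading part of κ, where H is the part of S₀
of degree at least two.

The nonlinear pullback obeys the same recursion. Since it is a critical value, only explicit
dependence survives differentiation: its derivative along ∂ₖ is qₖ, and t∂/∂t - 1 turns it into
((∑qᵢ∂/∂qᵢ - 1)H)(q). As H starts in degree two, the recursion determines every coefficient from the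
first, so the two sides agree (`bicoeff_logDeriv_eq_coeff_formalPullback`). The next coefficient of
P in ħ gives the amplitude; being a universal polynomial evaluated at S and g, it depends on neither
the representing function nor the cutoff. `hasExpansion_logDeriv` transfers this from formal series
to the actual logarithm, and `tendsto_quantumPhase_zero` and `tendsto_quantumPhase_succ` read off
the limits. -/

noncomputable section

namespace Microformal

/-! ### Iterated operators -/

/-- The composite `d₀^{α₀} ∘ ⋯ ∘ d_{n-1}^{α_{n-1}}`. -/
def multiDeriv {n : ℕ} {M : Type*} (d : Fin n → M → M) (α : Fin n →₀ ℕ) (u : M) : M :=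
  (List.finRange n).foldr (fun i h => (d i)^[α i] h) u

/-- The one induction by which facts about ∂^α pass between two models of differentiation, such as
Schwartz functions and jets. The predicate may depend on the multi-index applied so far, which the
filtration and symbol statements need. -/
theorem multiDeriv_rel {n : ℕ} {M M' : Type*} {d : Fin n → M → M} {d' : Fin n → M' → M'}
    {C : (Fin n →₀ ℕ) → M → M' → Prop} {u : M} {u' : M'} (h0 : C 0 u u')
    (hs : ∀ i β v v', C β v v' → C (β + Finsupp.single i 1) (d i v) (d' i v'))
    (α : Fin n →₀ ℕ) : C α (multiDeriv d α u) (multiDeriv d' α u') := by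
  have key : ∀ l : List (Fin n), C (l.map fun i => Finsupp.single i (α i)).sum
      (l.foldr (fun i h => (d i)^[α i] h) u) (l.foldr (fun i h => (d' i)^[α i] h) u') := by
    intro l
    induction l with
    | nil => simpa using h0
    | cons i l ih =>
      simp only [List.map_cons, List.sum_cons, List.foldr_cons]
      generalize α i = k
      induction k with
      | zero => simpa using ih
      | succ k ihk =>
        rw [Function.iterate_succ_apply', Function.iterate_succ_apply']
        convert hs i _ _ _ ihk using 1
        rw [Finsupp.single_add]; abel
  have h := key (List.finRange n)
  rwa [← List.ofFn_eq_map, List.sum_ofFn, Finsupp.univ_sum_single α] at h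

theorem multiDeriv_induction {n : ℕ} {M : Type*} {d : Fin n → M → M}
    {C : (Fin n →₀ ℕ) → M → Prop} {u : M} (h0 : C 0 u)
    (hs : ∀ i β v, C β v → C (β + Finsupp.single i 1) (d i v)) (α : Fin n →₀ ℕ) :
    C α (multiDeriv d α u) :=
  multiDeriv_rel (C := fun β v (_ : M) => C β v) (d' := d) (u' := u) h0
    (fun i β v _ h => hs i β v h) α

/-! ### The formal flow -/

section Flow

variable {ι M M' : Type*} [AddCommGroup M] [Module ℂ M] [AddCommGroup M'] [Module ℂ M']

/-- The coefficients of the formal solution `E(z) = ∑ zˡ Eₗ`, `E₀ = u`, of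
`z E'(z) = ∑ r z^r A E(z)`. -/
def flow (Λ : Finset ι) (r : ι → ℕ) (A : ι → M → M) (u : M) : ℕ → M
  | 0 => u
  | l + 1 => ((l : ℂ) + 1)⁻¹ • ∑ i ∈ Λ,
      if _h : 1 ≤ r i ∧ r i ≤ l + 1 then (r i : ℂ) • A i (flow Λ r A u (l + 1 - r i)) else 0

theorem flow_zero (Λ : Finset ι) (r : ι → ℕ) (A : ι → M → M) (u : M) : flow Λ r A u 0 = u := by
  rw [flow]

/-- The lower bound on `r i` inside `flow` only ensures termination. For positive weights it drops
out, and what remains is the differential equation read coefficientwise. -/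
theorem flow_eq {Λ : Finset ι} {r : ι → ℕ} (hr : ∀ i ∈ Λ, 1 ≤ r i) (A : ι → M → M) (u : M)
    (l : ℕ) : (l : ℂ) • flow Λ r A u l =
      ∑ i ∈ Λ, if r i ≤ l then (r i : ℂ) • A i (flow Λ r A u (l - r i)) else 0 := by
  cases l with
  | zero =>
    rw [Nat.cast_zero, zero_smul]
    refine (Finset.sum_eq_zero fun i hi => ?_).symm
    rw [if_neg (by have := hr i hi; omega)]
  | succ l =>
    rw [flow, Nat.cast_succ, smul_inv_smul₀ (Nat.cast_add_one_ne_zero l)]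
    refine Finset.sum_congr rfl fun i hi => ?_
    by_cases h : r i ≤ l + 1
    · rw [dif_pos ⟨hr i hi, h⟩, if_pos h]
    · rw [dif_neg (fun h' => h h'.2), if_neg h]

/-- Used twice for the flow on Schwartz functions: once against multiplication on the Fourier side
at a fixed frequency, once against the flow on universal jets. -/
theorem flow_rel {Λ : Finset ι} {r : ι → ℕ} {A : ι → M → M} {A' : ι → M' → M'}
    {C : M → M' → Prop} (h0 : C 0 0) (hadd : ∀ u v u' v', C u u' → C v v' → C (u + v) (u' + v'))
    (hsmul : ∀ (c : ℂ) u u', C u u' → C (c • u) (c • u'))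
    (hA : ∀ i ∈ Λ, ∀ u u', C u u' → C (A i u) (A' i u')) {u : M} {u' : M'} (hu : C u u') (l : ℕ) :
    C (flow Λ r A u l) (flow Λ r A' u' l) := by
  induction l using Nat.strong_induction_on with
  | _ l ih =>
    cases l with
    | zero => simpa only [flow_zero] using hu
    | succ l =>
      rw [flow, flow]
      refine hsmul _ _ _ ?_
      have : ∀ s : Finset ι, s ⊆ Λ → C
          (∑ i ∈ s, if h : 1 ≤ r i ∧ r i ≤ l + 1 then
            (r i : ℂ) • A i (flow Λ r A u (l + 1 - r i)) else 0)
          (∑ i ∈ s, if h : 1 ≤ r i ∧ r i ≤ l + 1 then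
            (r i : ℂ) • A' i (flow Λ r A' u' (l + 1 - r i)) else 0) := by
        classical
        intro s
        induction s using Finset.induction_on with
        | empty => intro _; simpa using h0
        | insert i s hi ihs =>
          intro hs
          rw [Finset.sum_insert hi, Finset.sum_insert hi]
          refine hadd _ _ _ _ ?_ (ihs fun j hj => hs (Finset.mem_insert_of_mem hj))
          by_cases h : 1 ≤ r i ∧ r i ≤ l + 1
          · rw [dif_pos h, dif_pos h]
            exact hsmul _ _ _ (hA i (hs (Finset.mem_insert_self _ _)) _ _ (ih _ (by omega)))
          · rw [dif_neg h, dif_neg h]; exact h0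
      exact this Λ subset_rfl

end Flow

/-! ### Derivations of power series rings -/

section Derivations

variable {J : Type*} [CommRing J] [Algebra ℂ J]

/-- The coefficientwise extension of a derivation to power series. -/
def mapDeriv (δ : Derivation ℂ J J) : Derivation ℂ (PowerSeries J) (PowerSeries J) :=
  Derivation.mk'
    { toFun := fun f => PowerSeries.mk fun k => δ (PowerSeries.coeff k f)
      map_add' := fun f g => by ext k; simp
      map_smul' := fun c f => by ext k; simp }
    (fun f g => by
      ext k
      simp only [LinearMap.coe_mk, AddHom.coe_mk, PowerSeries.coeff_mk, map_add, smul_eq_mul,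
        PowerSeries.coeff_mul, map_sum, Derivation.leibniz, Finset.sum_add_distrib]
      congr 1
      rw [← Finset.Nat.sum_antidiagonal_swap]
      rfl)

@[simp] theorem coeff_mapDeriv (δ : Derivation ℂ J J) (f : PowerSeries J) (k : ℕ) :
    PowerSeries.coeff k (mapDeriv δ f) = δ (PowerSeries.coeff k f) := by
  simp [mapDeriv]

/-- `d/dX`, as a derivation over `ℂ`. -/
def ddX (J : Type*) [CommRing J] [Algebra ℂ J] : Derivation ℂ (PowerSeries J) (PowerSeries J) :=
  (PowerSeries.derivative J).restrictScalars ℂ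

@[simp] theorem coeff_ddX (f : PowerSeries J) (k : ℕ) :
    PowerSeries.coeff k (ddX J f) = PowerSeries.coeff (k + 1) f * ((k : J) + 1) :=
  PowerSeries.coeff_derivative f k

/-- The Euler derivation `X d/dX`. -/
def euler (J : Type*) [CommRing J] [Algebra ℂ J] : Derivation ℂ (PowerSeries J) (PowerSeries J) :=
  (PowerSeries.X : PowerSeries J) • ddX J

@[simp] theorem coeff_euler (f : PowerSeries J) (k : ℕ) :
    PowerSeries.coeff k (euler J f) = (k : J) * PowerSeries.coeff k f := by
  cases k with
  | zero => simp [euler]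
  | succ k => simp [euler, PowerSeries.coeff_succ_X_mul, mul_comm]

theorem mapDeriv_C (δ : Derivation ℂ J J) (a : J) :
    mapDeriv δ (PowerSeries.C a) = PowerSeries.C (δ a) := by
  ext k
  rw [coeff_mapDeriv, PowerSeries.coeff_C, PowerSeries.coeff_C]
  split_ifs <;> simp

/-- Symmetry of the second derivatives of log W, stated without a logarithm: `V * D W` plays the
role of D log W. -/
theorem derivation_inv_comm {A : Type*} [CommRing A] [Algebra ℂ A] (D₁ D₂ : Derivation ℂ A A)
    {V W : A} (hV : V * W = 1) (h : D₁ (D₂ W) = D₂ (D₁ W)) : D₁ (V * D₂ W) = D₂ (V * D₁ W) := by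
  have key : ∀ D : Derivation ℂ A A, D V = -(V * V * D W) := by
    intro D
    have h1 : D (V * W) = 0 := by rw [hV]; exact D.map_one_eq_zero
    rw [D.leibniz, smul_eq_mul, smul_eq_mul] at h1
    linear_combination V * h1 - (D V) * hV
  rw [D₁.leibniz, D₂.leibniz, smul_eq_mul, smul_eq_mul, smul_eq_mul, smul_eq_mul, key D₁, key D₂, h]
  ring

end Derivations

/-! ### Formal series in `ħ` and `τ = t / ħ` -/

section Formal

variable {J : Type*} [CommRing J]

/-- `J⟦ħ⟧⟦τ⟧`. -/
abbrev BiSeries (J : Type*) [CommRing J] : Type _ := PowerSeries (PowerSeries J)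

/-- The coefficient of `ħˡ τʲ`. -/
def bicoeff (l j : ℕ) (u : BiSeries J) : J := PowerSeries.coeff l (PowerSeries.coeff j u)

@[simp] theorem bicoeff_add (l j : ℕ) (u v : BiSeries J) :
    bicoeff l j (u + v) = bicoeff l j u + bicoeff l j v := by simp [bicoeff]

theorem bicoeff_ext {u v : BiSeries J} (h : ∀ l j, bicoeff l j u = bicoeff l j v) : u = v := by
  ext j l; exact h l j

theorem bicoeff_mul (l j : ℕ) (u v : BiSeries J) : bicoeff l j (u * v) =
    ∑ p ∈ Finset.HasAntidiagonal.antidiagonal j, ∑ s ∈ Finset.HasAntidiagonal.antidiagonal l,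
      bicoeff s.1 p.1 u * bicoeff s.2 p.2 v := by
  simp [bicoeff, PowerSeries.coeff_mul]

/-- The formal variable `ħ`. -/
def hbar (J : Type*) [CommRing J] : BiSeries J := PowerSeries.C PowerSeries.X

theorem bicoeff_hbar_pow_mul (l j r : ℕ) (u : BiSeries J) :
    bicoeff l j (hbar J ^ r * u) = if r ≤ l then bicoeff (l - r) j u else 0 := by
  rw [bicoeff, hbar, ← map_pow, PowerSeries.coeff_C_mul, PowerSeries.coeff_X_pow_mul']
  rfl

/-- Constants. -/
def biC (a : J) : BiSeries J := PowerSeries.C (PowerSeries.C a)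

theorem bicoeff_biC_mul (l j : ℕ) (a : J) (u : BiSeries J) :
    bicoeff l j (biC a * u) = a * bicoeff l j u := by
  rw [bicoeff, biC, PowerSeries.coeff_C_mul, PowerSeries.coeff_C_mul]; rfl

theorem bicoeff_smul [Algebra ℂ J] (l j : ℕ) (c : ℂ) (u : BiSeries J) :
    bicoeff l j (c • u) = c • bicoeff l j u := by simp [bicoeff]

/-- The coefficientwise extension of a derivation to `J⟦ħ⟧⟦τ⟧`. -/
abbrev biDeriv [Algebra ℂ J] (δ : Derivation ℂ J J) : Derivation ℂ (BiSeries J) (BiSeries J) :=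
  mapDeriv (mapDeriv δ)

@[simp] theorem bicoeff_biDeriv [Algebra ℂ J] (l j : ℕ) (δ : Derivation ℂ J J) (u : BiSeries J) :
    bicoeff l j (biDeriv δ u) = δ (bicoeff l j u) := by simp [bicoeff]

/-- `ħ ∂/∂ħ`. -/
abbrev hbarEuler (J : Type*) [CommRing J] [Algebra ℂ J] :
    Derivation ℂ (BiSeries J) (BiSeries J) := mapDeriv (euler J)

@[simp] theorem bicoeff_hbarEuler [Algebra ℂ J] (l j : ℕ) (u : BiSeries J) :
    bicoeff l j (hbarEuler J u) = (l : J) * bicoeff l j u := by simp [bicoeff]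

@[simp] theorem bicoeff_ddX [Algebra ℂ J] (l j : ℕ) (u : BiSeries J) :
    bicoeff l j (ddX (PowerSeries J) u) = bicoeff l (j + 1) u * ((j : J) + 1) := by
  have : ((j : PowerSeries J) + 1) = PowerSeries.C ((j : J) + 1) := by simp
  rw [bicoeff, coeff_ddX, this, PowerSeries.coeff_mul_C]; rfl

/-- `u` contains only monomials `ħˡ τʲ` with `l + d ≥ j`, up to order `L` in `ħ`. -/
def Filtered (L d : ℕ) (u : BiSeries J) : Prop := ∀ l < L, ∀ j, l + d < j → bicoeff l j u = 0

theorem Filtered.add {L d : ℕ} {u v : BiSeries J} (hu : Filtered L d u) (hv : Filtered L d v) :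
    Filtered L d (u + v) := fun l hl j hj => by
  rw [bicoeff_add, hu l hl j hj, hv l hl j hj, add_zero]

theorem Filtered.mul {L d e : ℕ} {u v : BiSeries J} (hu : Filtered L d u) (hv : Filtered L e v) :
    Filtered L (d + e) (u * v) := fun l hl j hj => by
  rw [bicoeff_mul]
  refine Finset.sum_eq_zero fun p hp => Finset.sum_eq_zero fun s hs => ?_
  rw [Finset.HasAntidiagonal.mem_antidiagonal] at hp hs
  by_cases h : s.1 + d < p.1
  · rw [hu _ (by omega) _ h, zero_mul]
  · rw [hv _ (by omega) _ (by omega), mul_zero]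

theorem Filtered.mono {L d e : ℕ} {u : BiSeries J} (hu : Filtered L d u) (h : d ≤ e) :
    Filtered L e u := fun l hl j hj => hu l hl j (by omega)

theorem Filtered.biDeriv [Algebra ℂ J] {L d : ℕ} {u : BiSeries J} (hu : Filtered L d u) (δ : Derivation ℂ J J) :
    Filtered L d (biDeriv δ u) := fun l hl j hj => by
  rw [bicoeff_biDeriv, hu l hl j hj, map_zero]

theorem filtered_one (L : ℕ) : Filtered L 0 (1 : BiSeries J) := fun l _ j hj => by
  rw [bicoeff, PowerSeries.coeff_one, if_neg (by omega), map_zero]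

/-- `ħᵈ u` is a series in `ħ` and `t = ħ τ`, whose value at `ħ = 0` is `v`. -/
def HasSymbol (d : ℕ) (u : BiSeries J) (v : PowerSeries J) : Prop :=
  ∃ w : BiSeries J, hbar J ^ d * u = PowerSeries.rescale PowerSeries.X w ∧
    PowerSeries.map PowerSeries.constantCoeff w = v

theorem bicoeff_rescale (l j : ℕ) (w : BiSeries J) :
    bicoeff l j (PowerSeries.rescale PowerSeries.X w) =
      if j ≤ l then bicoeff (l - j) j w else 0 := by
  rw [bicoeff, PowerSeries.coeff_rescale, PowerSeries.coeff_X_pow_mul']; rfl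

theorem HasSymbol.one : HasSymbol 0 (1 : BiSeries J) 1 := ⟨1, by simp, by simp⟩

theorem HasSymbol.add {d : ℕ} {u v : BiSeries J} {u' v' : PowerSeries J} (hu : HasSymbol d u u')
    (hv : HasSymbol d v v') : HasSymbol d (u + v) (u' + v') := by
  obtain ⟨w, hw, hw'⟩ := hu
  obtain ⟨z, hz, hz'⟩ := hv
  exact ⟨w + z, by rw [mul_add, hw, hz, map_add], by rw [map_add, hw', hz']⟩

theorem HasSymbol.sum {ι : Type*} {d : ℕ} {u : ι → BiSeries J} {v : ι → PowerSeries J}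
    (s : Finset ι) (h : ∀ i ∈ s, HasSymbol d (u i) (v i)) :
    HasSymbol d (∑ i ∈ s, u i) (∑ i ∈ s, v i) := by
  classical
  induction s using Finset.induction_on with
  | empty => exact ⟨0, by simp, by simp⟩
  | insert i s hi ih =>
    rw [Finset.sum_insert hi, Finset.sum_insert hi]
    exact (h i (Finset.mem_insert_self _ _)).add (ih fun j hj => h j (Finset.mem_insert_of_mem hj))

theorem HasSymbol.mul {d e : ℕ} {u v : BiSeries J} {u' v' : PowerSeries J} (hu : HasSymbol d u u')
    (hv : HasSymbol e v v') : HasSymbol (d + e) (u * v) (u' * v') := by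
  obtain ⟨w, hw, hw'⟩ := hu
  obtain ⟨z, hz, hz'⟩ := hv
  refine ⟨w * z, ?_, by rw [map_mul, hw', hz']⟩
  rw [map_mul, ← hw, ← hz]; ring

theorem HasSymbol.biC_mul {d : ℕ} {u : BiSeries J} {v : PowerSeries J} (hu : HasSymbol d u v)
    (a : J) : HasSymbol d (biC a * u) (PowerSeries.C a * v) := by
  obtain ⟨w, hw, hw'⟩ := hu
  refine ⟨biC a * w, ?_, ?_⟩
  · have : PowerSeries.rescale PowerSeries.X (biC a) = biC a := by
      refine bicoeff_ext fun l j => ?_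
      rw [bicoeff_rescale]
      rcases j with _ | j
      · simp
      · simp [bicoeff, biC]
    rw [map_mul, this, ← hw]; ring
  · rw [map_mul, hw', biC, PowerSeries.map_C, PowerSeries.constantCoeff_C]

theorem HasSymbol.biDeriv [Algebra ℂ J] {d : ℕ} {u : BiSeries J} {v : PowerSeries J} (hu : HasSymbol d u v)
    (δ : Derivation ℂ J J) : HasSymbol d (biDeriv δ u) (mapDeriv δ v) := by
  obtain ⟨w, hw, hw'⟩ := hu
  refine ⟨Microformal.biDeriv δ w, bicoeff_ext fun l j => ?_, ?_⟩
  · have h := congrArg (fun z => δ (bicoeff l j z)) hw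
    simp only [bicoeff_rescale, bicoeff_hbar_pow_mul, apply_ite δ, map_zero] at h
    rw [bicoeff_rescale, bicoeff_hbar_pow_mul, bicoeff_biDeriv, bicoeff_biDeriv]
    exact h
  · ext j
    rw [← hw', PowerSeries.coeff_map, coeff_mapDeriv, coeff_mapDeriv, PowerSeries.coeff_map,
      ← PowerSeries.coeff_zero_eq_constantCoeff_apply, coeff_mapDeriv,
      ← PowerSeries.coeff_zero_eq_constantCoeff_apply]

/-- The number `m` is the surplus of powers of ħ over those needed for order `e`; any surplus kills
the classical limit. For the monomial ħᵐ q^α, with r = m + |α| - 1 and e = 1, it is the power of ħ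
in S itself, so only S₀ survives. -/
theorem HasSymbol.hbar_pow_mul {d r e m : ℕ} {u : BiSeries J} {v : PowerSeries J}
    (hu : HasSymbol d u v) (h : r + e = m + d) :
    HasSymbol e (hbar J ^ r * u) (if m = 0 then v else 0) := by
  obtain ⟨w, hw, hw'⟩ := hu
  refine ⟨hbar J ^ m * w, ?_, ?_⟩
  · have : PowerSeries.rescale PowerSeries.X (hbar J) = hbar J := by
      refine bicoeff_ext fun l j => ?_
      rw [bicoeff_rescale]
      rcases j with _ | j
      · simp
      · simp [bicoeff, hbar]
    rw [map_mul, map_pow, this, ← hw, ← mul_assoc, ← mul_assoc, ← pow_add, ← pow_add, ← h, add_comm]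
  · rw [map_mul, hw', map_pow, hbar, PowerSeries.map_C, PowerSeries.constantCoeff_X, map_zero]
    split_ifs with h0
    · rw [h0, pow_zero, one_mul]
    · rw [zero_pow h0, zero_mul]

/-- This removes the terms in which a derivative hits an already computed factor: they are one order
lower than the product terms. -/
theorem HasSymbol.congr_zero {d : ℕ} {u : BiSeries J} {v : PowerSeries J} (hu : HasSymbol d u v) :
    HasSymbol (d + 1) u 0 := by
  obtain ⟨w, hw, hw'⟩ := hu
  have := HasSymbol.hbar_pow_mul (r := 0) (e := d + 1) (m := 1) ⟨w, hw, hw'⟩ (by omega)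
  simpa using this

theorem HasSymbol.coeff_of_lt {d j : ℕ} {u : BiSeries J} {v : PowerSeries J} (hu : HasSymbol d u v)
    (hj : j < d) : PowerSeries.coeff j v = 0 := by
  obtain ⟨w, hw, hw'⟩ := hu
  have h := congrArg (bicoeff j j) hw
  rw [bicoeff_rescale, bicoeff_hbar_pow_mul, if_pos le_rfl, if_neg (by omega), Nat.sub_self] at h
  rw [← hw', PowerSeries.coeff_map, ← PowerSeries.coeff_zero_eq_constantCoeff_apply]
  exact h.symm

theorem HasSymbol.coeff_eq {d l : ℕ} {u : BiSeries J} {v : PowerSeries J} (hu : HasSymbol d u v) :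
    PowerSeries.coeff (l + d) v = bicoeff l (l + d) u := by
  obtain ⟨w, hw, hw'⟩ := hu
  have h := congrArg (bicoeff (l + d) (l + d)) hw
  rw [bicoeff_rescale, bicoeff_hbar_pow_mul, if_pos le_rfl, if_pos (by omega), Nat.sub_self,
    Nat.add_sub_cancel] at h
  rw [← hw', PowerSeries.coeff_map, ← PowerSeries.coeff_zero_eq_constantCoeff_apply]
  exact h.symm

/-- In ħᵈu every monomial has at least as many factors ħ as τ, so each τ can be absorbed into ħτ. -/
theorem hasSymbol_of_filtered {d : ℕ} {u : BiSeries J} (hu : ∀ L, Filtered L d u) :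
    ∃ v, HasSymbol d u v := by
  refine ⟨_, PowerSeries.mk fun j => PowerSeries.mk fun l => bicoeff (l + j) j (hbar J ^ d * u),
    bicoeff_ext fun l j => ?_, rfl⟩
  rw [bicoeff_rescale]
  split_ifs with h
  · rw [bicoeff, bicoeff, PowerSeries.coeff_mk, PowerSeries.coeff_mk, Nat.sub_add_cancel h]; rfl
  · rw [bicoeff_hbar_pow_mul]
    split_ifs with h'
    · exact hu (l - d + 1) _ (by omega) _ (by omega)
    · rfl

end Formal

/-! ### The logarithmic derivatives of a formal wave function -/

section WaveSeries

variable {J : Type*} [CommRing J] {n : ℕ}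

/-- The indices `(m, α)` of the monomials `ħᵐ q^α`. -/
abbrev HIndex (n : ℕ) : Type := ℕ × (Fin n →₀ ℕ)

/-- The power of `ħ` that goes with the symbol `ħᵐ (ħ ξ)^α / ħ`. -/
def weight (i : HIndex n) : ℕ := i.1 + i.2.degree - 1

/-- The differential operator `c ∂^α`. -/
def diffOp {K M : Type*} [SMul K M] (D : Fin n → M → M) (c : HIndex n → K) (i : HIndex n) (u : M) :
    M := c i • multiDeriv D i.2 u

theorem bicoeff_sum {κ : Type*} (l j : ℕ) (s : Finset κ) (u : κ → BiSeries J) :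
    bicoeff l j (∑ i ∈ s, u i) = ∑ i ∈ s, bicoeff l j (u i) := by simp [bicoeff]

theorem bicoeff_zero_left (j : ℕ) (u : BiSeries J) :
    bicoeff 0 j u = PowerSeries.coeff j (PowerSeries.map PowerSeries.constantCoeff u) := by
  rw [PowerSeries.coeff_map, ← PowerSeries.coeff_zero_eq_constantCoeff_apply]; rfl

variable [Algebra ℂ J]

/-- The formal series `E(ħ) exp(τ G)`, where `E(ħ) = exp(∑ T_{m,α} ħ^{m+|α|-1} ∂^α)`. -/
def waveSeries (D : Fin n → Derivation ℂ J J) (Λ : Finset (HIndex n)) (T : HIndex n → J) (G : J) :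
    BiSeries J :=
  PowerSeries.mk fun k => PowerSeries.mk
    (flow Λ weight (diffOp (fun i => D i) T) (((k.factorial : ℂ))⁻¹ • G ^ k))

variable {D : Fin n → Derivation ℂ J J} {Λ : Finset (HIndex n)} {T : HIndex n → J} {G : J}

theorem bicoeff_waveSeries (l k : ℕ) : bicoeff l k (waveSeries D Λ T G) =
    flow Λ weight (diffOp (fun i => D i) T) (((k.factorial : ℂ))⁻¹ • G ^ k) l := by
  simp [bicoeff, waveSeries]

theorem bicoeff_multiDeriv (l j : ℕ) (α : Fin n →₀ ℕ) (u : BiSeries J) :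
    bicoeff l j (multiDeriv (fun i => biDeriv (D i)) α u) =
      multiDeriv (fun i => D i) α (bicoeff l j u) :=
  multiDeriv_rel (C := fun _ v v' => bicoeff l j v = v') rfl
    (fun i β v v' h => by rw [bicoeff_biDeriv, h]) α

theorem hbarEuler_waveSeries (hΛ : ∀ i ∈ Λ, 2 ≤ i.1 + i.2.degree) :
    hbarEuler J (waveSeries D Λ T G) = ∑ i ∈ Λ, (weight i : ℂ) • (hbar J ^ weight i *
      (biC (T i) * multiDeriv (fun i => biDeriv (D i)) i.2 (waveSeries D Λ T G))) := by
  refine bicoeff_ext fun l j => ?_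
  have hr : ∀ i ∈ Λ, 1 ≤ weight i := fun i hi => by have := hΛ i hi; unfold weight; omega
  have h := flow_eq hr (diffOp (fun i => D i) T) (((j.factorial : ℂ))⁻¹ • G ^ j) l
  rw [bicoeff_hbarEuler, bicoeff_waveSeries, bicoeff_sum]
  rw [Nat.cast_smul_eq_nsmul, nsmul_eq_mul] at h
  rw [h]
  refine Finset.sum_congr rfl fun i _ => ?_
  rw [bicoeff_smul, bicoeff_hbar_pow_mul]
  split_ifs
  · rw [bicoeff_biC_mul, bicoeff_multiDeriv, bicoeff_waveSeries, diffOp, smul_eq_mul]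
  · rw [smul_zero]

theorem constantCoeff_waveSeries : PowerSeries.map PowerSeries.constantCoeff (waveSeries D Λ T G) =
    PowerSeries.mk fun k => ((k.factorial : ℂ))⁻¹ • G ^ k := by
  ext k
  rw [PowerSeries.coeff_map, ← PowerSeries.coeff_zero_eq_constantCoeff_apply, PowerSeries.coeff_mk]
  exact (bicoeff_waveSeries 0 k).trans (flow_zero _ _ _ _)

theorem exists_waveSeries_inverse : ∃ V, V * waveSeries D Λ T G = 1 := by
  have h : IsUnit (waveSeries D Λ T G) := by
    rw [PowerSeries.isUnit_iff_constantCoeff, PowerSeries.isUnit_iff_constantCoeff]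
    have := congrArg PowerSeries.constantCoeff (constantCoeff_waveSeries (D := D) (Λ := Λ)
      (T := T) (G := G))
    rw [← PowerSeries.coeff_zero_eq_constantCoeff_apply, PowerSeries.coeff_map,
      PowerSeries.coeff_zero_eq_constantCoeff_apply,
      ← PowerSeries.coeff_zero_eq_constantCoeff_apply (PowerSeries.mk _), PowerSeries.coeff_mk,
      pow_zero, Nat.factorial_zero, Nat.cast_one, inv_one, one_smul] at this
    rw [this]; exact isUnit_one
  obtain ⟨V, hV⟩ := h.exists_left_inv
  exact ⟨V, hV⟩

theorem smul_pow_succ_eq (G : J) (k : ℕ) : ((((k + 1).factorial : ℕ) : ℂ))⁻¹ • G ^ (k + 1) *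
    ((k : J) + 1) = ((k.factorial : ℂ))⁻¹ • G ^ k * G := by
  have : ((k : J) + 1) = ((k : ℂ) + 1) • (1 : J) := by
    rw [add_smul, one_smul, Nat.cast_smul_eq_nsmul, nsmul_eq_mul, mul_one]
  rw [this, mul_smul_comm, mul_one, smul_smul, Nat.factorial_succ, Nat.cast_mul, mul_inv,
    ← mul_assoc, Nat.cast_succ, mul_inv_cancel₀ (Nat.cast_add_one_ne_zero k), one_mul, pow_succ,
    smul_mul_assoc]

/-- At ħ = 0 the wave series is exp(τG). This is the initial value of the recursion in powers of ħ.
-/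
theorem constantCoeff_logDeriv {V : BiSeries J} (hV : V * waveSeries D Λ T G = 1) (i : Fin n) :
    PowerSeries.map PowerSeries.constantCoeff (V * biDeriv (D i) (waveSeries D Λ T G)) =
      PowerSeries.X * PowerSeries.C (D i G) := by
  have h : PowerSeries.map PowerSeries.constantCoeff (biDeriv (D i) (waveSeries D Λ T G)) =
      PowerSeries.map PowerSeries.constantCoeff (waveSeries D Λ T G) *
        (PowerSeries.X * PowerSeries.C (D i G)) := by
    ext k
    rw [PowerSeries.coeff_map, coeff_mapDeriv, ← PowerSeries.coeff_zero_eq_constantCoeff_apply,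
      coeff_mapDeriv, constantCoeff_waveSeries]
    have : PowerSeries.coeff 0 (PowerSeries.coeff k (waveSeries D Λ T G)) =
      ((k.factorial : ℂ))⁻¹ • G ^ k := (bicoeff_waveSeries 0 k).trans (flow_zero _ _ _ _)
    rw [this, mul_comm PowerSeries.X, ← mul_assoc, mul_comm _ PowerSeries.X]
    cases k with
    | zero => simp
    | succ k =>
      rw [PowerSeries.coeff_succ_X_mul, PowerSeries.coeff_mul_C, PowerSeries.coeff_mk, Derivation.map_smul,
        Derivation.leibniz_pow, Nat.add_sub_cancel, Nat.factorial_succ, Nat.cast_mul, mul_inv,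
        ← Nat.cast_smul_eq_nsmul ℂ, smul_smul, mul_comm, ← mul_assoc,
        mul_inv_cancel₀ (Nat.cast_ne_zero.2 (Nat.succ_ne_zero k)), one_mul, smul_eq_mul,
        smul_mul_assoc]
  rw [map_mul, h, ← mul_assoc, ← map_mul, hV, map_one, one_mul]

theorem constantCoeff_logDeriv_tau {V : BiSeries J} (hV : V * waveSeries D Λ T G = 1) :
    PowerSeries.map PowerSeries.constantCoeff (V * ddX (PowerSeries J) (waveSeries D Λ T G)) =
      PowerSeries.C G := by
  have h : PowerSeries.map PowerSeries.constantCoeff (ddX (PowerSeries J) (waveSeries D Λ T G)) =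
      PowerSeries.map PowerSeries.constantCoeff (waveSeries D Λ T G) * PowerSeries.C G := by
    ext k
    rw [PowerSeries.coeff_map, ← PowerSeries.coeff_zero_eq_constantCoeff_apply,
      constantCoeff_waveSeries, PowerSeries.coeff_mul_C, PowerSeries.coeff_mk]
    refine (bicoeff_ddX 0 k _).trans ?_
    rw [bicoeff_waveSeries, flow_zero, smul_pow_succ_eq]
  rw [map_mul, h, ← mul_assoc, ← map_mul, hV, map_one, one_mul]

/-- Conjugation by W: the operator e^{-φ} δ e^{φ} equals δ + δφ, with φ = log W. -/
theorem mul_deriv_eq {A : Type*} [CommRing A] [Algebra ℂ A] (δ : Derivation ℂ A A) {V W : A}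
    (hV : V * W = 1) (u : A) : V * δ u = δ (V * u) + V * δ W * (V * u) := by
  have h1 : δ (V * W) = 0 := by rw [hV]; exact δ.map_one_eq_zero
  rw [δ.leibniz, smul_eq_mul, smul_eq_mul] at h1
  rw [δ.leibniz, smul_eq_mul, smul_eq_mul]
  linear_combination (-(V * u)) * h1 + (u * δ V) * hV

/-- By `mul_deriv_eq` every further derivative either acts coefficientwise, which keeps the
filtration, or multiplies by a logarithmic derivative, which raises it by one. -/
theorem filtered_mul_multiDeriv {V W : BiSeries J} (hV : V * W = 1) {L : ℕ}
    (h : ∀ i, Filtered L 1 (V * biDeriv (D i) W)) (α : Fin n →₀ ℕ) :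
    Filtered L α.degree (V * multiDeriv (fun i => biDeriv (D i)) α W) := by
  refine multiDeriv_induction (C := fun β v => Filtered L β.degree (V * v)) ?_ ?_ α
  · rw [hV, map_zero]; exact filtered_one L
  · intro i β v hv
    rw [map_add, Finsupp.degree_single, mul_deriv_eq _ hV]
    refine ((hv.biDeriv _).mono (Nat.le_succ _)).add ?_
    rw [Nat.succ_eq_add_one, add_comm]
    exact (h i).mul hv

/-- The eikonal rule. Of the two terms of `mul_deriv_eq`, the coefficientwise one has too low an
order to contribute, so each ∂ₖ becomes multiplication by κₖ. -/
theorem hasSymbol_mul_multiDeriv {V W : BiSeries J} (hV : V * W = 1) {κ : Fin n → PowerSeries J}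
    (h : ∀ i, HasSymbol 1 (V * biDeriv (D i) W) (κ i)) (α : Fin n →₀ ℕ) :
    HasSymbol α.degree (V * multiDeriv (fun i => biDeriv (D i)) α W) (∏ i, κ i ^ α i) := by
  refine multiDeriv_induction (C := fun β v => HasSymbol β.degree (V * v) (∏ i, κ i ^ β i)) ?_ ?_ α
  · rw [hV]; simpa using HasSymbol.one
  · intro i β v hv
    have hp : ∏ j, κ j ^ ((β + Finsupp.single i 1 : Fin n →₀ ℕ) j) = 0 + κ i * ∏ j, κ j ^ β j := by
      simp only [Finsupp.add_apply, pow_add, Finset.prod_mul_distrib, zero_add, mul_comm (κ i)]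
      congr 1
      rw [Finset.prod_eq_single i] <;> simp +contextual [eq_comm]
    rw [map_add, Finsupp.degree_single, mul_deriv_eq _ hV, hp]
    refine (hv.biDeriv _).congr_zero.add ?_
    rw [add_comm]
    exact (h i).mul hv

theorem eq_zero_of_natCast_succ_mul {l : ℕ} {a : J} (h : ((l + 1 : ℕ) : J) * a = 0) : a = 0 := by
  rw [← nsmul_eq_mul, ← Nat.cast_smul_eq_nsmul ℂ] at h
  exact (smul_eq_zero_iff_right (Nat.cast_ne_zero.2 (Nat.succ_ne_zero l))).1 h

theorem hbar_logDeriv_eq (hΛ : ∀ i ∈ Λ, 2 ≤ i.1 + i.2.degree) (V : BiSeries J) :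
    V * hbarEuler J (waveSeries D Λ T G) = ∑ i ∈ Λ, (weight i : ℂ) • (hbar J ^ weight i *
      (biC (T i) * (V * multiDeriv (fun i => biDeriv (D i)) i.2 (waveSeries D Λ T G)))) := by
  rw [hbarEuler_waveSeries hΛ, Finset.mul_sum]
  refine Finset.sum_congr rfl fun i _ => ?_
  rw [mul_smul_comm]
  congr 1
  ring

/-- The mixed derivatives of log W along ħ∂/∂ħ and `D i` commute. Combined with `hbar_logDeriv_eq`
this closes a recursion for the spatial logarithmic derivatives. -/
theorem natCast_mul_bicoeff_logDeriv {V : BiSeries J} (hV : V * waveSeries D Λ T G = 1) (i : Fin n)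
    (l j : ℕ) : (l : J) * bicoeff l j (V * biDeriv (D i) (waveSeries D Λ T G)) =
      D i (bicoeff l j (V * hbarEuler J (waveSeries D Λ T G))) := by
  rw [← bicoeff_hbarEuler, ← bicoeff_biDeriv]
  congr 1
  refine derivation_inv_comm _ _ hV (bicoeff_ext fun l j => ?_)
  rw [bicoeff_hbarEuler, bicoeff_biDeriv, bicoeff_biDeriv, bicoeff_hbarEuler, Derivation.leibniz,
    Derivation.map_natCast, smul_zero, add_zero, smul_eq_mul]

theorem natCast_mul_bicoeff_logDeriv_tau {V : BiSeries J} (hV : V * waveSeries D Λ T G = 1)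
    (l j : ℕ) : (l : J) * bicoeff l j (V * ddX (PowerSeries J) (waveSeries D Λ T G)) =
      bicoeff l (j + 1) (V * hbarEuler J (waveSeries D Λ T G)) * ((j : J) + 1) := by
  rw [← bicoeff_hbarEuler, ← bicoeff_ddX]
  congr 1
  refine derivation_inv_comm _ _ hV (bicoeff_ext fun l j => ?_)
  rw [bicoeff_hbarEuler, bicoeff_ddX, bicoeff_ddX, bicoeff_hbarEuler, mul_assoc]

/-- Induction on the power of ħ. The coefficient of ħˡ is obtained from terms with an explicit
factor ħ^{m+|α|-1}, a positive power, so only lower orders enter. Their τ-degree is at most l -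
(m+|α|-1) + |α| = l + 1 - m, which stays within the bound. -/
theorem filtered_logDeriv (hΛ : ∀ i ∈ Λ, 2 ≤ i.1 + i.2.degree) {V : BiSeries J}
    (hV : V * waveSeries D Λ T G = 1) (L : ℕ) (k : Fin n) :
    Filtered L 1 (V * biDeriv (D k) (waveSeries D Λ T G)) := by
  induction L generalizing k with
  | zero => intro l hl; omega
  | succ L ih =>
    intro l hl j hj
    by_cases h : l < L
    · exact ih k l h j hj
    obtain rfl : l = L := by omega
    cases l with
    | zero =>
      rw [bicoeff_zero_left, constantCoeff_logDeriv hV, PowerSeries.coeff_mul_C,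
        PowerSeries.coeff_X, if_neg (by omega), zero_mul]
    | succ l =>
      refine eq_zero_of_natCast_succ_mul (l := l) ?_
      rw [natCast_mul_bicoeff_logDeriv hV, hbar_logDeriv_eq hΛ, bicoeff_sum, Finset.sum_eq_zero,
        map_zero]
      intro i hi
      have h2 := hΛ i hi
      rw [bicoeff_smul, bicoeff_hbar_pow_mul]
      split_ifs with hw
      · rw [bicoeff_biC_mul, filtered_mul_multiDeriv hV ih i.2, mul_zero, smul_zero]
        · unfold weight; omega
        · unfold weight at hw ⊢; omega
      · rw [smul_zero]

/-- The logarithmic derivatives `κ = W⁻¹ ∂W` and `P = W⁻¹ ∂W/∂τ` of a formal wave function have a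
classical limit, which satisfies the derivatives of the Hamilton-Jacobi equation. -/
theorem exists_symbol_logDeriv (hΛ : ∀ i ∈ Λ, 2 ≤ i.1 + i.2.degree) {V : BiSeries J}
    (hV : V * waveSeries D Λ T G = 1) : ∃ (κ : Fin n → PowerSeries J) (ν : PowerSeries J),
      ν = ∑ i ∈ Λ, (weight i : ℂ) •
        (if i.1 = 0 then PowerSeries.C (T i) * ∏ k, κ k ^ i.2 k else 0) ∧
      (∀ k, PowerSeries.coeff 0 (κ k) = 0) ∧ (∀ k, PowerSeries.coeff 1 (κ k) = D k G) ∧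
      (∀ (k : Fin n) (l : ℕ), (l : J) * PowerSeries.coeff (l + 1) (κ k) = D k (PowerSeries.coeff (l + 1) ν)) ∧
      (∀ l j : ℕ, l < j → bicoeff l j (V * ddX (PowerSeries J) (waveSeries D Λ T G)) = 0) ∧
      bicoeff 0 0 (V * ddX (PowerSeries J) (waveSeries D Λ T G)) = G ∧
      ∀ j : ℕ, (j : J) * bicoeff j j (V * ddX (PowerSeries J) (waveSeries D Λ T G)) =
        PowerSeries.coeff (j + 1) ν * ((j : J) + 1) := by
  choose κ hκ using fun k => hasSymbol_of_filtered fun L => filtered_logDeriv hΛ hV L k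
  have hN : HasSymbol 1 (V * hbarEuler J (waveSeries D Λ T G)) (∑ i ∈ Λ, (weight i : ℂ) •
        (if i.1 = 0 then PowerSeries.C (T i) * ∏ k, κ k ^ i.2 k else 0)) := by
    rw [hbar_logDeriv_eq hΛ]
    refine HasSymbol.sum _ fun i hi => ?_
    -- The surplus is `i.1`, because weight + 1 = m + |α|. The terms with m > 0 therefore disappear
    -- from the symbol.
    have h1 := ((hasSymbol_mul_multiDeriv hV hκ i.2).biC_mul (T i)).hbar_pow_mul
      (r := weight i) (e := 1) (m := i.1) (by have := hΛ i hi; unfold weight; omega)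
    have h2 := h1.biC_mul (algebraMap ℂ J (weight i))
    have e1 : ∀ u : BiSeries J, biC (algebraMap ℂ J (weight i)) * u = (weight i : ℂ) • u :=
      fun u => bicoeff_ext fun l j => by rw [bicoeff_biC_mul, bicoeff_smul, Algebra.smul_def]
    have e2 : ∀ u : PowerSeries J, PowerSeries.C (algebraMap ℂ J (weight i)) * u =
        (weight i : ℂ) • u := fun u => by
      ext k
      rw [PowerSeries.coeff_C_mul, PowerSeries.coeff_smul, Algebra.smul_def]
    rwa [e1, e2] at h2
  have hP : ∀ l j, l < j → bicoeff l j (V * ddX (PowerSeries J) (waveSeries D Λ T G)) = 0 := by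
    intro l j hlj
    cases l with
    | zero =>
      rw [bicoeff_zero_left, constantCoeff_logDeriv_tau hV, PowerSeries.coeff_C,
        if_neg (by omega)]
    | succ l =>
      refine eq_zero_of_natCast_succ_mul (l := l) ?_
      -- ħN is a series in ħ and ħτ, so its coefficient at ħ^{l+2}τ^{j+1} vanishes for j > l + 1.
      -- The shift in the first index is the extra factor ħ, and the one in the second is the
      -- derivative in τ.
      obtain ⟨w, hw, -⟩ := hN
      have h := congrArg (bicoeff (l + 2) (j + 1)) hw
      rw [bicoeff_hbar_pow_mul, if_pos (by omega), bicoeff_rescale, if_neg (by omega)] at h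
      rw [natCast_mul_bicoeff_logDeriv_tau hV, show l + 1 = l + 2 - 1 by omega, h, zero_mul]
  refine ⟨κ, _, rfl, fun k => (hκ k).coeff_of_lt Nat.zero_lt_one, fun k => ?_, fun k l => ?_, hP, ?_,
    fun j => ?_⟩
  · have := (hκ k).coeff_eq (l := 0)
    rw [zero_add] at this
    rw [this, bicoeff_zero_left, constantCoeff_logDeriv hV, PowerSeries.coeff_mul_C,
      PowerSeries.coeff_one_X, one_mul]
  · rw [(hκ k).coeff_eq, hN.coeff_eq, natCast_mul_bicoeff_logDeriv hV]
  · rw [bicoeff_zero_left, constantCoeff_logDeriv_tau hV, PowerSeries.coeff_zero_C]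
  · rw [hN.coeff_eq, natCast_mul_bicoeff_logDeriv_tau hV]

end WaveSeries

/-! ### Substitution of formal curves -/

section Subst

variable {R : Type*} [CommRing R] {n : ℕ} {q q' : Fin n → PowerSeries R}

theorem hasSubst_of_X_dvd (hq : ∀ i, PowerSeries.X ∣ q i) : MvPowerSeries.HasSubst q :=
  MvPowerSeries.hasSubst_of_constantCoeff_zero fun i => PowerSeries.X_dvd_iff.1 (hq i)

theorem prod_X_mul_pow (u : Fin n → PowerSeries R) (α : Fin n →₀ ℕ) :
    ∏ i, (PowerSeries.X * u i) ^ α i = PowerSeries.X ^ α.degree * ∏ i, u i ^ α i := by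
  simp only [mul_pow, Finset.prod_mul_distrib]
  rw [Finset.prod_pow_eq_pow_sum, Finsupp.degree_eq_sum]

theorem X_pow_degree_dvd_prod (hq : ∀ i, PowerSeries.X ∣ q i) (α : Fin n →₀ ℕ) :
    PowerSeries.X ^ α.degree ∣ ∏ i, q i ^ α i := by
  choose u hu using hq
  simp only [hu, prod_X_mul_pow]
  exact dvd_mul_right _ _

theorem dvd_prod_pow_sub_prod_pow {d : PowerSeries R} (h : ∀ i, d ∣ q i - q' i) (α : Fin n →₀ ℕ) :
    d ∣ ∏ i, q i ^ α i - ∏ i, q' i ^ α i := by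
  rw [← Ideal.mem_span_singleton, ← Ideal.Quotient.eq]
  simp only [map_prod, map_pow]
  refine Finset.prod_congr rfl fun i _ => ?_
  rw [Ideal.Quotient.eq.2 (Ideal.mem_span_singleton.2 (h i))]

/-- Since q and q' are both divisible by X, |α| factors X come out of the two products, and the
quotients still agree modulo Xᵏ. A monomial of degree at least two thus gains an order of agreement,
which makes the later recursion triangular. -/
theorem X_pow_dvd_prod_pow_sub_prod_pow {k : ℕ} (hq : ∀ i, PowerSeries.X ∣ q i)
    (h : ∀ i, PowerSeries.X ^ (k + 1) ∣ q i - q' i) (α : Fin n →₀ ℕ) :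
    PowerSeries.X ^ (α.degree + k) ∣ ∏ i, q i ^ α i - ∏ i, q' i ^ α i := by
  choose u hu using hq
  choose w hw using h
  have hq' : ∀ i, q' i = PowerSeries.X * (u i - PowerSeries.X ^ k * w i) := fun i => by
    linear_combination hu i - hw i
  simp only [hu, hq', prod_X_mul_pow]
  rw [← mul_sub, pow_add]
  refine mul_dvd_mul_left _ (dvd_prod_pow_sub_prod_pow (fun i => ?_) α)
  exact ⟨w i, by ring⟩

/-- Only monomials of degree at most j reach the coefficient of Xʲ. The finite set is left free so
that sums over different index sets can be compared. -/
theorem coeff_subst_eq_sum (hq : ∀ i, PowerSeries.X ∣ q i) (P : MvPowerSeries (Fin n) R) (j : ℕ)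
    {s : Finset (Fin n →₀ ℕ)} (hs : ∀ α : Fin n →₀ ℕ, α.degree ≤ j → α ∈ s) :
    PowerSeries.coeff j (MvPowerSeries.subst q P : PowerSeries R) =
      ∑ α ∈ s, MvPowerSeries.coeff α P * PowerSeries.coeff j (∏ i, q i ^ α i) := by
  have e : ∀ α : Fin n →₀ ℕ, (α.prod fun i e => q i ^ e) = ∏ i, q i ^ α i := fun α =>
    Finsupp.prod_fintype _ _ fun i => pow_zero _
  rw [PowerSeries.coeff, MvPowerSeries.coeff_subst (hasSubst_of_X_dvd hq), finsum_eq_sum_of_support_subset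
    (s := s)]
  · refine Finset.sum_congr rfl fun α _ => ?_
    rw [e, smul_eq_mul]
  · intro α hα
    by_contra hα'
    refine hα ?_
    have h : j < α.degree := not_le.1 fun h => hα' (hs α h)
    have h' := PowerSeries.X_pow_dvd_iff.1 (X_pow_degree_dvd_prod hq α) j h
    simp only [e, smul_eq_mul]
    exact (congrArg _ h').trans (mul_zero _)

/-- The multi-indices of degree at most `j`. -/
def degreeLE (n j : ℕ) : Finset (Fin n →₀ ℕ) := (Finsupp.finite_of_degree_le j).toFinset

@[simp] theorem mem_degreeLE {j : ℕ} {α : Fin n →₀ ℕ} : α ∈ degreeLE n j ↔ α.degree ≤ j := by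
  simp [degreeLE]

theorem X_pow_dvd_subst (hq : ∀ i, PowerSeries.X ∣ q i) {P : MvPowerSeries (Fin n) R} {k : ℕ}
    (hP : ∀ α : Fin n →₀ ℕ, α.degree < k → MvPowerSeries.coeff α P = 0) :
    PowerSeries.X ^ k ∣ (MvPowerSeries.subst q P : PowerSeries R) := by
  rw [PowerSeries.X_pow_dvd_iff]
  intro j hj
  rw [coeff_subst_eq_sum hq P j (s := degreeLE n j) (fun α h => mem_degreeLE.2 h)]
  refine Finset.sum_eq_zero fun α hα => ?_
  rw [hP α (lt_of_le_of_lt (mem_degreeLE.1 hα) hj), zero_mul]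

theorem X_pow_dvd_subst_sub_subst (hq : ∀ i, PowerSeries.X ∣ q i) (hq' : ∀ i, PowerSeries.X ∣ q' i)
    (P : MvPowerSeries (Fin n) R) {k : ℕ} (h : ∀ i, PowerSeries.X ^ k ∣ q i - q' i) :
    PowerSeries.X ^ k ∣ (MvPowerSeries.subst q P - MvPowerSeries.subst q' P : PowerSeries R) := by
  rw [PowerSeries.X_pow_dvd_iff]
  intro j hj
  rw [map_sub, coeff_subst_eq_sum hq P j (s := degreeLE n j) (fun α h => mem_degreeLE.2 h),
    coeff_subst_eq_sum hq' P j (s := degreeLE n j) (fun α h => mem_degreeLE.2 h),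
    ← Finset.sum_sub_distrib]
  refine Finset.sum_eq_zero fun α _ => ?_
  rw [← mul_sub, ← map_sub, PowerSeries.X_pow_dvd_iff.1 (dvd_prod_pow_sub_prod_pow h α) j hj,
    mul_zero]

theorem X_dvd_subst (hq : ∀ i, PowerSeries.X ∣ q i) {P : MvPowerSeries (Fin n) R}
    (hP : MvPowerSeries.constantCoeff P = 0) :
    PowerSeries.X ∣ (MvPowerSeries.subst q P : PowerSeries R) := by
  rw [← pow_one PowerSeries.X]
  refine X_pow_dvd_subst hq fun α hα => ?_
  rw [(Finsupp.degree_eq_zero_iff α).1 (by omega)]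
  exact hP

theorem constantCoeff_subst_eq (hq : ∀ i, PowerSeries.X ∣ q i) (P : MvPowerSeries (Fin n) R) :
    PowerSeries.coeff 0 (MvPowerSeries.subst q P : PowerSeries R) = MvPowerSeries.coeff 0 P := by
  rw [coeff_subst_eq_sum hq P 0 (s := {0}) fun α h => by
    rw [Finset.mem_singleton]; exact (Finsupp.degree_eq_zero_iff α).1 (by omega)]
  simp

/-! ### Formal fixed points -/

theorem eq_zero_of_forall_X_pow_dvd {f : PowerSeries R} (h : ∀ k : ℕ, PowerSeries.X ^ k ∣ f) :
    f = 0 := by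
  ext k
  exact PowerSeries.X_pow_dvd_iff.1 (h (k + 1)) k (Nat.lt_succ_self k)

/-- Contraction principle in the X-adic topology: each application of Φ gains one order of
agreement. -/
theorem existsUnique_fixedPoint {Φ : (Fin n → PowerSeries R) → Fin n → PowerSeries R}
    (h : ∀ (k : ℕ) u v, (∀ i, PowerSeries.X ^ k ∣ u i - v i) →
      ∀ i, PowerSeries.X ^ (k + 1) ∣ Φ u i - Φ v i) : ∃! u, Φ u = u := by
  have huniq : ∀ u v, Φ u = u → Φ v = v → u = v := by
    intro u v hu hv
    have : ∀ (k : ℕ) i, PowerSeries.X ^ k ∣ u i - v i := by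
      intro k
      induction k with
      | zero => intro i; rw [pow_zero]; exact one_dvd _
      | succ k ih => intro i; have := h k u v ih i; rwa [hu, hv] at this
    funext i
    exact sub_eq_zero.1 (eq_zero_of_forall_X_pow_dvd fun k => this k i)
  have hit : ∀ (k m : ℕ) i, PowerSeries.X ^ k ∣ Φ^[k + m] 0 i - Φ^[k] 0 i := by
    intro k m
    induction k with
    | zero => intro i; rw [pow_zero]; exact one_dvd _
    | succ k ih =>
      intro i
      rw [show k + 1 + m = (k + m) + 1 by ring, Function.iterate_succ_apply',
        Function.iterate_succ_apply']
      exact h k _ _ ih i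
  -- The coefficient of Xᵏ is frozen from the iterate k + 1 on, so the limit can be read off there.
  set u : Fin n → PowerSeries R := fun i => PowerSeries.mk fun k =>
    PowerSeries.coeff k (Φ^[k + 1] 0 i) with hu
  have hlim : ∀ (k : ℕ) i, PowerSeries.X ^ k ∣ u i - Φ^[k] 0 i := by
    intro k i
    rw [PowerSeries.X_pow_dvd_iff]
    intro j hj
    have := PowerSeries.X_pow_dvd_iff.1 (hit (j + 1) (k - (j + 1)) i) j (Nat.lt_succ_self j)
    rw [show j + 1 + (k - (j + 1)) = k by omega, map_sub, sub_eq_zero] at this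
    rw [map_sub, hu, PowerSeries.coeff_mk, this, sub_self]
  refine ⟨u, ?_, fun v hv => huniq v u hv ?_⟩ <;>
  · funext i
    refine sub_eq_zero.1 (eq_zero_of_forall_X_pow_dvd fun k => ?_)
    have h1 := h k u _ (hlim k) i
    rw [← Function.iterate_succ_apply' Φ] at h1
    have h2 := dvd_sub h1 (hlim (k + 1) i)
    rw [show Φ u i - Φ^[k + 1] 0 i - (u i - Φ^[k + 1] 0 i) = Φ u i - u i by ring] at h2
    exact (pow_dvd_pow _ (Nat.le_succ k)).trans h2

/-- The formal curves `q, η = O(t)` solve `qᵢ = t Γᵢ(η)`, `ηᵢ = Bᵢ(q)`. -/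
structure IsFormalSolution (Γ B : Fin n → MvPowerSeries (Fin n) R) (q η : Fin n → PowerSeries R) :
    Prop where
  dvd_left : ∀ i, PowerSeries.X ∣ q i
  dvd_right : ∀ i, PowerSeries.X ∣ η i
  left_eq : ∀ i, q i = PowerSeries.X * (MvPowerSeries.subst η (Γ i) : PowerSeries R)
  right_eq : ∀ i, η i = MvPowerSeries.subst q (B i)

/-- Put q = X u. Then u is a fixed point of u ↦ Γ(B(Xu)), and the factor X makes this map
contracting. The condition B(0) = 0 makes the displacement divisible by X, so that it can be
substituted into Γ. -/
theorem existsUnique_isFormalSolution (Γ : Fin n → MvPowerSeries (Fin n) R)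
    {B : Fin n → MvPowerSeries (Fin n) R} (hB : ∀ i, MvPowerSeries.constantCoeff (B i) = 0) :
    (∃ q η, IsFormalSolution Γ B q η) ∧ ∀ q η q' η', IsFormalSolution Γ B q η →
      IsFormalSolution Γ B q' η' → q = q' ∧ η = η' := by
  set E : (Fin n → PowerSeries R) → Fin n → PowerSeries R := fun u j =>
    MvPowerSeries.subst (fun k => PowerSeries.X * u k) (B j) with hE
  have hX : ∀ (u : Fin n → PowerSeries R) i, PowerSeries.X ∣ PowerSeries.X * u i := fun u i =>
    dvd_mul_right _ _
  have hEX : ∀ u i, PowerSeries.X ∣ E u i := fun u i => X_dvd_subst (hX u) (hB i)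
  obtain ⟨u, hu, huniq⟩ := existsUnique_fixedPoint
    (Φ := fun u i => MvPowerSeries.subst (E u) (Γ i)) (by
      intro k u v h i
      refine X_pow_dvd_subst_sub_subst (hEX u) (hEX v) _ fun j => ?_
      refine X_pow_dvd_subst_sub_subst (hX u) (hX v) _ fun l => ?_
      rw [← mul_sub, pow_succ']
      exact mul_dvd_mul_left _ (h l))
  refine ⟨⟨fun i => PowerSeries.X * u i, E u, hX u, hEX u, fun i => ?_, fun i => rfl⟩, ?_⟩
  · exact congrArg (PowerSeries.X * ·) (congrFun hu i).symm
  · have key : ∀ q η, IsFormalSolution Γ B q η → q = (fun i => PowerSeries.X * u i) := by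
      intro q η h
      have e : (fun i => (MvPowerSeries.subst η (Γ i) : PowerSeries R)) = u := by
        refine huniq _ (funext fun i => ?_)
        have : E (fun i => MvPowerSeries.subst η (Γ i)) = η := by
          funext j
          simp only [hE]
          rw [h.right_eq j]
          congr 1
          funext k
          exact (h.left_eq k).symm
        simp only [this]
      funext i
      rw [h.left_eq, ← e]
    intro q η q' η' h h'
    have hq : q = q' := (key q η h).trans (key q' η' h').symm
    refine ⟨hq, funext fun i => ?_⟩
    rw [h.right_eq, h'.right_eq, hq]

theorem IsFormalSolution.map {R' : Type*} [CommRing R'] (ρ : R →+* R')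
    {Γ B : Fin n → MvPowerSeries (Fin n) R} {q η : Fin n → PowerSeries R}
    (h : IsFormalSolution Γ B q η) :
    IsFormalSolution (fun i => MvPowerSeries.map ρ (Γ i)) (fun i => MvPowerSeries.map ρ (B i))
      (fun i => PowerSeries.map ρ (q i)) (fun i => PowerSeries.map ρ (η i)) where
  dvd_left i := by simpa using map_dvd (PowerSeries.map ρ) (h.dvd_left i)
  dvd_right i := by simpa using map_dvd (PowerSeries.map ρ) (h.dvd_right i)
  left_eq i := by
    rw [h.left_eq, map_mul, PowerSeries.map_X]
    congr 1
    exact MvPowerSeries.map_subst (hasSubst_of_X_dvd h.dvd_right) (Γ i)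
  right_eq i := by
    rw [h.right_eq]
    exact MvPowerSeries.map_subst (hasSubst_of_X_dvd h.dvd_left) (B i)

end Subst

/-! ### The chain rule -/

section ChainRule

variable {J : Type*} [CommRing J] [Algebra ℂ J] {n : ℕ} {q : Fin n → PowerSeries J}

/-- The coefficientwise action of a derivation on multivariate power series. -/
def coeffDeriv (δ : Derivation ℂ J J) (P : MvPowerSeries (Fin n) J) : MvPowerSeries (Fin n) J :=
  fun α => δ (MvPowerSeries.coeff α P)

theorem coeff_coeffDeriv (δ : Derivation ℂ J J) (P : MvPowerSeries (Fin n) J) (α : Fin n →₀ ℕ) :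
    MvPowerSeries.coeff α (coeffDeriv δ P) = δ (MvPowerSeries.coeff α P) := rfl

theorem coeffDeriv_add (δ : Derivation ℂ J J) (P Q : MvPowerSeries (Fin n) J) :
    coeffDeriv δ (P + Q) = coeffDeriv δ P + coeffDeriv δ Q := by
  ext α; simp [coeff_coeffDeriv]

theorem coeffDeriv_mul (δ : Derivation ℂ J J) (P Q : MvPowerSeries (Fin n) J) :
    coeffDeriv δ (P * Q) = coeffDeriv δ P * Q + P * coeffDeriv δ Q := by
  classical
  ext α
  rw [map_add, coeff_coeffDeriv, MvPowerSeries.coeff_mul, MvPowerSeries.coeff_mul,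
    MvPowerSeries.coeff_mul, map_sum, ← Finset.sum_add_distrib]
  refine Finset.sum_congr rfl fun p _ => ?_
  rw [Derivation.leibniz, coeff_coeffDeriv, coeff_coeffDeriv, smul_eq_mul, smul_eq_mul]
  ring

theorem X_pow_dvd_derivation (Δ : Derivation ℂ (PowerSeries J) (PowerSeries J)) {k : ℕ}
    {f : PowerSeries J} (h : PowerSeries.X ^ (k + 1) ∣ f) : PowerSeries.X ^ k ∣ Δ f := by
  obtain ⟨g, rfl⟩ := h
  rw [Derivation.leibniz, Derivation.leibniz_pow, Nat.add_sub_cancel]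
  refine dvd_add ((pow_dvd_pow _ (Nat.le_succ k)).trans (dvd_mul_right _ _)) ?_
  simp only [smul_eq_mul, nsmul_eq_mul]
  exact ⟨g * (((k + 1 : ℕ) : PowerSeries J) * Δ PowerSeries.X), by ring⟩

/-- Both sides satisfy the Leibniz rule along the substitution, so on polynomials it is enough to
check constants and variables. Cutting off the terms of degree above k changes either side only by a
multiple of Xᵏ, and k is arbitrary. -/
theorem derivation_subst (hq : ∀ i, PowerSeries.X ∣ q i) {δ : Derivation ℂ J J}
    {Δ : Derivation ℂ (PowerSeries J) (PowerSeries J)}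
    (hΔ : ∀ a, Δ (PowerSeries.C a) = PowerSeries.C (δ a)) (P : MvPowerSeries (Fin n) J) :
    Δ (MvPowerSeries.subst q P : PowerSeries J) = (MvPowerSeries.subst q (coeffDeriv δ P) +
      ∑ i, MvPowerSeries.subst q (MvPowerSeries.pderiv J i P) * Δ (q i) : PowerSeries J) := by
  have hs := hasSubst_of_X_dvd hq
  set S : MvPowerSeries (Fin n) J → PowerSeries J := fun P => MvPowerSeries.subst q P with hS
  have hadd : ∀ P Q, S (P + Q) = S P + S Q := MvPowerSeries.subst_add hs
  have hmul : ∀ P Q, S (P * Q) = S P * S Q := MvPowerSeries.subst_mul hs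
  have hC : ∀ a, S (MvPowerSeries.C a) = PowerSeries.C a := fun a =>
    MvPowerSeries.subst_C a
  have hX : ∀ i, S (MvPowerSeries.X i) = q i := MvPowerSeries.subst_X hs
  set F : MvPowerSeries (Fin n) J → PowerSeries J := fun P =>
    S (coeffDeriv δ P) + ∑ i, S (MvPowerSeries.pderiv J i P) * Δ (q i) with hF
  change Δ (S P) = F P
  have hFadd : ∀ P Q, F (P + Q) = F P + F Q := fun P Q => by
    simp only [hF, coeffDeriv_add, map_add, hadd, add_mul, Finset.sum_add_distrib]
    ring
  have hFmul : ∀ P Q, F (P * Q) = F P * S Q + S P * F Q := fun P Q => by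
    simp only [hF, coeffDeriv_mul, Derivation.leibniz, smul_eq_mul, hadd, hmul, add_mul, mul_add,
      Finset.sum_add_distrib, Finset.mul_sum, Finset.sum_mul]
    rw [Finset.sum_congr rfl fun i _ => show
      S (MvPowerSeries.pderiv J i P) * Δ (q i) * S Q = S Q * S (MvPowerSeries.pderiv J i P) * Δ (q i)
        by ring]
    rw [Finset.sum_congr rfl fun i _ => show
      S P * (S (MvPowerSeries.pderiv J i Q) * Δ (q i)) = S P * S (MvPowerSeries.pderiv J i Q) * Δ (q i)
        by ring]
    ring
  have hpoly : ∀ p : MvPolynomial (Fin n) J, Δ (S p) = F p := by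
    intro p
    induction p using MvPolynomial.induction_on with
    | C a =>
      rw [MvPolynomial.coe_C, hC, hΔ]
      have : coeffDeriv δ (MvPowerSeries.C a : MvPowerSeries (Fin n) J) =
          MvPowerSeries.C (δ a) := by
        classical
        ext α
        rw [coeff_coeffDeriv, MvPowerSeries.coeff_C, MvPowerSeries.coeff_C]
        split_ifs <;> simp
      simp only [hF, this, hC, MvPowerSeries.pderiv_C]
      rw [Finset.sum_eq_zero, add_zero]
      intro i _
      have h0 : S 0 = 0 := by simpa using hC 0
      rw [h0, zero_mul]
    | add p r hp hr => rw [MvPolynomial.coe_add, hadd, map_add, hp, hr, hFadd]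
    | mul_X p i hp =>
      have hXi : Δ (S (MvPowerSeries.X i)) = F (MvPowerSeries.X i) := by
        classical
        have h0 : S 0 = 0 := by simpa using hC 0
        have h1 : S 1 = 1 := by simpa using hC 1
        have : coeffDeriv δ (MvPowerSeries.X i : MvPowerSeries (Fin n) J) = 0 := by
          ext α
          rw [coeff_coeffDeriv, MvPowerSeries.coeff_X]
          split_ifs <;> simp
        simp only [hF, this, h0, hX, MvPowerSeries.pderiv_X, zero_add]
        rw [Finset.sum_eq_single i]
        · simp [h1]
        · intro j _ hj
          rw [Pi.single_eq_of_ne hj.symm, h0, zero_mul]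
        · simp
      rw [MvPolynomial.coe_mul, MvPolynomial.coe_X, hmul, Derivation.leibniz, hp, hXi, hFmul]
      simp only [smul_eq_mul]
      ring
  refine sub_eq_zero.1 (eq_zero_of_forall_X_pow_dvd fun k => ?_)
  set p : MvPolynomial (Fin n) J := MvPowerSeries.truncTotal (k + 1) P
  have hsplit : P = (p : MvPowerSeries (Fin n) J) + (P - (p : MvPowerSeries (Fin n) J)) := by ring
  have hhigh : ∀ α : Fin n →₀ ℕ, α.degree < k + 1 → 
      MvPowerSeries.coeff α (P - (p : MvPowerSeries (Fin n) J)) = 0 := by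
    intro α hα
    rw [map_sub, MvPolynomial.coeff_coe, MvPowerSeries.coeff_truncTotal _ hα, sub_self]
  rw [hsplit, hadd, map_add Δ, hFadd, hpoly, add_sub_add_left_eq_sub]
  refine dvd_sub (X_pow_dvd_derivation _ (X_pow_dvd_subst hq hhigh)) (dvd_add ?_ ?_)
  · refine X_pow_dvd_subst hq fun α hα => ?_
    rw [coeff_coeffDeriv, hhigh α (by omega), map_zero]
  · refine Finset.dvd_sum fun i _ => dvd_mul_of_dvd_left (X_pow_dvd_subst hq fun α hα => ?_) _
    rw [MvPowerSeries.coeff_pderiv, hhigh (α + Finsupp.single i 1) (by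
      rw [map_add, Finsupp.degree_single]; omega),
      zero_mul]

end ChainRule

/-! ### The formal Hamilton-Jacobi equation -/

section HamiltonJacobi

variable {J : Type*} [CommRing J] {n : ℕ}

/-- `(∑ qᵢ ∂/∂qᵢ - 1) H`. -/
def legendre (H : MvPowerSeries (Fin n) J) : MvPowerSeries (Fin n) J :=
  fun α => ((α.degree : J) - 1) * MvPowerSeries.coeff α H

theorem coeff_legendre (H : MvPowerSeries (Fin n) J) (α : Fin n →₀ ℕ) :
    MvPowerSeries.coeff α (legendre H) = ((α.degree : J) - 1) * MvPowerSeries.coeff α H := rfl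

theorem coeff_X_mul_pderiv (H : MvPowerSeries (Fin n) J) (i : Fin n) (α : Fin n →₀ ℕ) :
    MvPowerSeries.coeff α (MvPowerSeries.X i * MvPowerSeries.pderiv J i H) =
      (α i : J) * MvPowerSeries.coeff α H := by
  classical
  rw [MvPowerSeries.X, MvPowerSeries.coeff_monomial_mul, one_mul]
  split_ifs with h
  · rw [MvPowerSeries.coeff_pderiv, tsub_add_cancel_of_le h, mul_comm, Finsupp.tsub_apply,
      Finsupp.single_eq_same]
    have h1 : 1 ≤ α i := by simpa using h i
    rw [← Nat.cast_succ, Nat.succ_eq_add_one, Nat.sub_add_cancel h1]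
  · have h0 : α i = 0 := by
      by_contra h0
      refine h (Finsupp.single_le_iff.2 (Nat.one_le_iff_ne_zero.2 h0))
    rw [h0, Nat.cast_zero, zero_mul]

/-- Euler's identity for homogeneous polynomials, monomial by monomial. -/
theorem subst_legendre {q : Fin n → PowerSeries J} (hq : ∀ i, PowerSeries.X ∣ q i)
    (H : MvPowerSeries (Fin n) J) : (MvPowerSeries.subst q (legendre H) : PowerSeries J) =
      (∑ i, q i * MvPowerSeries.subst q (MvPowerSeries.pderiv J i H) - MvPowerSeries.subst q H :
        PowerSeries J) := by
  have hs := hasSubst_of_X_dvd hq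
  have e : legendre H = ∑ i, MvPowerSeries.X i * MvPowerSeries.pderiv J i H - H := by
    ext α
    rw [coeff_legendre, map_sub, map_sum, Finset.sum_congr rfl fun i _ => coeff_X_mul_pderiv H i α,
      ← Finset.sum_mul, Finsupp.degree_eq_sum, Nat.cast_sum, sub_mul, one_mul]
  rw [e, MvPowerSeries.subst_sub hs, ← MvPowerSeries.coe_substAlgHom hs, map_sum]
  congr 1
  refine Finset.sum_congr rfl fun i _ => ?_
  rw [map_mul, MvPowerSeries.substAlgHom_X]

variable [Algebra ℂ J]

/-- The series `∑ G_β / β! · h^β`. -/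
def jetSeries (G : (Fin n →₀ ℕ) → J) : MvPowerSeries (Fin n) J :=
  fun β => (((∏ i, (β i).factorial : ℕ) : ℂ))⁻¹ • G β

theorem coeff_jetSeries (G : (Fin n →₀ ℕ) → J) (β : Fin n →₀ ℕ) :
    MvPowerSeries.coeff β (jetSeries G) = (((∏ i, (β i).factorial : ℕ) : ℂ))⁻¹ • G β := rfl

theorem prod_factorial_add_single (β : Fin n →₀ ℕ) (i : Fin n) :
    ∏ j, ((β + Finsupp.single i 1 : Fin n →₀ ℕ) j).factorial =
      (∏ j, (β j).factorial) * (β i + 1) := by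
  rw [← Finset.mul_prod_erase _ _ (Finset.mem_univ i), ← Finset.mul_prod_erase Finset.univ
    (fun j => (β j).factorial) (Finset.mem_univ i), Finsupp.add_apply, Finsupp.single_eq_same,
    Nat.factorial_succ]
  rw [Finset.prod_congr rfl fun j hj => by
    rw [Finsupp.add_apply, Finsupp.single_eq_of_ne (Finset.ne_of_mem_erase hj), add_zero]]
  ring

theorem pderiv_jetSeries (G : (Fin n →₀ ℕ) → J) (i : Fin n) :
    MvPowerSeries.pderiv J i (jetSeries G) = jetSeries fun β => G (β + Finsupp.single i 1) := by
  ext β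
  have e : ((β i : J) + 1) = algebraMap ℂ J ((β i : ℂ) + 1) := by simp
  rw [MvPowerSeries.coeff_pderiv, coeff_jetSeries, coeff_jetSeries, prod_factorial_add_single, e,
    mul_comm, ← Algebra.smul_def, smul_smul, Nat.cast_mul, mul_inv, mul_comm, Nat.cast_succ,
    mul_assoc, inv_mul_cancel₀ (Nat.cast_add_one_ne_zero _), mul_one]

theorem coeffDeriv_jetSeries {δ : Derivation ℂ J J} {G : (Fin n →₀ ℕ) → J} {i : Fin n}
    (hG : ∀ β, δ (G β) = G (β + Finsupp.single i 1)) :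
    coeffDeriv δ (jetSeries G) = jetSeries fun β => G (β + Finsupp.single i 1) := by
  ext β
  rw [coeff_coeffDeriv, coeff_jetSeries, coeff_jetSeries, Derivation.map_smul, hG]

theorem mapDeriv_X (δ : Derivation ℂ J J) : mapDeriv δ PowerSeries.X = 0 := by
  ext k
  rw [coeff_mapDeriv, PowerSeries.coeff_X]
  split_ifs <;> simp

theorem euler_X : euler J PowerSeries.X = PowerSeries.X := by
  ext k
  rw [coeff_euler, PowerSeries.coeff_X]
  split_ifs with h <;> simp [h]

theorem euler_C (a : J) : euler J (PowerSeries.C a) = PowerSeries.C ((0 : Derivation ℂ J J) a) := by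
  ext k
  rw [coeff_euler, PowerSeries.coeff_C, PowerSeries.coeff_C]
  split_ifs with h <;> simp [h]

variable {D : Fin n → Derivation ℂ J J} {G : (Fin n →₀ ℕ) → J} {H : MvPowerSeries (Fin n) J}
  {q η : Fin n → PowerSeries J}

/-- The formal pullback `t Γ(η) + H(q) - ∑ ηᵢ qᵢ`. -/
def formalPullback {R : Type*} [CommRing R] (Γ H : MvPowerSeries (Fin n) R)
    (q η : Fin n → PowerSeries R) : PowerSeries R :=
  PowerSeries.X * MvPowerSeries.subst η Γ + MvPowerSeries.subst q H - ∑ i, η i * q i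

/-- The envelope theorem: at a critical point the variations of q and η cancel, and only the
explicit dependence on X and on the coefficients of the jet series remains. It is applied with Δ =
∂ₖ and with Δ the Euler derivation. -/
theorem derivation_formalPullback
    (hsol : IsFormalSolution (fun i => MvPowerSeries.pderiv J i (jetSeries G))
      (fun i => MvPowerSeries.pderiv J i H) q η) {δ : Derivation ℂ J J}
    {Δ : Derivation ℂ (PowerSeries J) (PowerSeries J)}
    (hΔ : ∀ a, Δ (PowerSeries.C a) = PowerSeries.C (δ a)) (hH : coeffDeriv δ H = 0) :
    Δ (formalPullback (jetSeries G) H q η) = (Δ PowerSeries.X * MvPowerSeries.subst η (jetSeries G) +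
      PowerSeries.X * MvPowerSeries.subst η (coeffDeriv δ (jetSeries G)) : PowerSeries J) := by
  have hs := hasSubst_of_X_dvd hsol.dvd_left
  have h0 : (MvPowerSeries.subst q (0 : MvPowerSeries (Fin n) J) : PowerSeries J) = 0 := by
    rw [← MvPowerSeries.coe_substAlgHom hs, map_zero]
  rw [formalPullback, map_sub, map_add, Derivation.leibniz, derivation_subst hsol.dvd_right hΔ,
    derivation_subst hsol.dvd_left hΔ, hH, h0, map_sum]
  simp only [Derivation.leibniz, smul_eq_mul, Finset.sum_add_distrib, mul_add, Finset.mul_sum]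
  have e1 : ∑ i, PowerSeries.X * ((MvPowerSeries.subst η (MvPowerSeries.pderiv J i (jetSeries G)) :
      PowerSeries J) * Δ (η i)) = ∑ i, q i * Δ (η i) := by
    refine Finset.sum_congr rfl fun i _ => ?_
    rw [hsol.left_eq i]; ring
  have e2 : ∑ i, (MvPowerSeries.subst q (MvPowerSeries.pderiv J i H) : PowerSeries J) * Δ (q i) =
      ∑ i, η i * Δ (q i) := by
    refine Finset.sum_congr rfl fun i _ => ?_
    rw [hsol.right_eq i]
  rw [e1, e2]
  ring

/-- ∂ₖ shifts jets, so the surviving explicit term is X ∂ₖΓ(η), which is the equation for the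
momentum. -/
theorem mapDeriv_formalPullback
    (hsol : IsFormalSolution (fun i => MvPowerSeries.pderiv J i (jetSeries G))
      (fun i => MvPowerSeries.pderiv J i H) q η)
    (hG : ∀ k β, D k (G β) = G (β + Finsupp.single k 1))
    (hH : ∀ k α, D k (MvPowerSeries.coeff α H) = 0) (k : Fin n) :
    mapDeriv (D k) (formalPullback (jetSeries G) H q η) = q k := by
  rw [derivation_formalPullback hsol (mapDeriv_C (D k)) (by ext α; exact hH k α), mapDeriv_X,
    zero_mul, zero_add, hsol.left_eq, pderiv_jetSeries, coeffDeriv_jetSeries (hG k)]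

/-- The explicit dependence on X is the summand XΓ(η). Subtracting the whole pullback leaves ∑ηᵢqᵢ -
H(q), which is the Legendre expression because ηᵢ = ∂H/∂qᵢ. -/
theorem euler_formalPullback_sub
    (hsol : IsFormalSolution (fun i => MvPowerSeries.pderiv J i (jetSeries G))
      (fun i => MvPowerSeries.pderiv J i H) q η) :
    euler J (formalPullback (jetSeries G) H q η) - formalPullback (jetSeries G) H q η =
      MvPowerSeries.subst q (legendre H) := by
  have h0 : (MvPowerSeries.subst η (coeffDeriv 0 (jetSeries G)) : PowerSeries J) = 0 := by
    rw [show coeffDeriv (0 : Derivation ℂ J J) (jetSeries G) = 0 from rfl,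
      ← MvPowerSeries.coe_substAlgHom (hasSubst_of_X_dvd hsol.dvd_right), map_zero]
  rw [derivation_formalPullback hsol euler_C rfl, h0, euler_X, mul_zero, add_zero,
    subst_legendre hsol.dvd_left, formalPullback,
    Finset.sum_congr rfl fun i _ => show η i * q i = q i * _ by rw [hsol.right_eq i]; ring]
  ring

theorem coeff_succ_formalPullback
    (hsol : IsFormalSolution (fun i => MvPowerSeries.pderiv J i (jetSeries G))
      (fun i => MvPowerSeries.pderiv J i H) q η) (l : ℕ) :
    (l : J) * PowerSeries.coeff (l + 1) (formalPullback (jetSeries G) H q η) =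
      PowerSeries.coeff (l + 1) (MvPowerSeries.subst q (legendre H) : PowerSeries J) := by
  rw [← euler_formalPullback_sub hsol, map_sub, coeff_euler, Nat.cast_succ]
  ring

theorem coeff_one_formalPullback
    (hsol : IsFormalSolution (fun i => MvPowerSeries.pderiv J i (jetSeries G))
      (fun i => MvPowerSeries.pderiv J i H) q η)
    (hH : ∀ α : Fin n →₀ ℕ, α.degree < 2 → MvPowerSeries.coeff α H = 0) :
    PowerSeries.coeff 1 (formalPullback (jetSeries G) H q η) = G 0 := by
  have h1 : PowerSeries.coeff 1 (MvPowerSeries.subst q H : PowerSeries J) = 0 :=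
    PowerSeries.X_pow_dvd_iff.1 (X_pow_dvd_subst hsol.dvd_left hH) 1 one_lt_two
  have h2 : PowerSeries.coeff 1 (∑ i, η i * q i) = 0 := by
    refine (PowerSeries.X_pow_dvd_iff (n := 2)).1 (Finset.dvd_sum fun i _ => ?_) 1 one_lt_two
    rw [pow_two]
    exact mul_dvd_mul (hsol.dvd_right i) (hsol.dvd_left i)
  rw [formalPullback, map_sub, map_add, h1, h2, show (1 : ℕ) = 0 + 1 from rfl,
    PowerSeries.coeff_succ_X_mul, constantCoeff_subst_eq hsol.dvd_right, coeff_jetSeries]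
  simp

/-- The same recursion that κ obeys in `exists_symbol_logDeriv`; this is what allows the two momenta
to be identified. -/
theorem coeff_succ_momentum
    (hsol : IsFormalSolution (fun i => MvPowerSeries.pderiv J i (jetSeries G))
      (fun i => MvPowerSeries.pderiv J i H) q η)
    (hG : ∀ k β, D k (G β) = G (β + Finsupp.single k 1))
    (hH : ∀ k α, D k (MvPowerSeries.coeff α H) = 0) (k : Fin n) (l : ℕ) :
    (l : J) * PowerSeries.coeff (l + 1) (q k) =
      D k (PowerSeries.coeff (l + 1) (MvPowerSeries.subst q (legendre H) : PowerSeries J)) := by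
  rw [← coeff_succ_formalPullback hsol, ← mapDeriv_formalPullback hsol hG hH k, coeff_mapDeriv,
    Derivation.leibniz, Derivation.map_natCast, smul_zero, add_zero, smul_eq_mul]

/-- The classical limit of the logarithmic derivative of a formal wave function is the derivative of
the formal pullback. -/
theorem bicoeff_logDeriv_eq_coeff_formalPullback {Λ : Finset (HIndex n)} {T : HIndex n → J}
    (hΛ : ∀ i ∈ Λ, 2 ≤ i.1 + i.2.degree) {R : ℕ}
    (hΛR : ∀ α : Fin n →₀ ℕ, 2 ≤ α.degree → α.degree ≤ R + 1 → (0, α) ∈ Λ)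
    (hsol : IsFormalSolution (fun i => MvPowerSeries.pderiv J i (jetSeries G))
      (fun i => MvPowerSeries.pderiv J i H) q η)
    (hG : ∀ k β, D k (G β) = G (β + Finsupp.single k 1))
    (hH : ∀ k α, D k (MvPowerSeries.coeff α H) = 0)
    (hH2 : ∀ α : Fin n →₀ ℕ, α.degree < 2 → MvPowerSeries.coeff α H = 0)
    (hT : ∀ α, (0, α) ∈ Λ → T (0, α) = MvPowerSeries.coeff α H)
    {V : BiSeries J} (hV : V * waveSeries D Λ T (G 0) = 1) :
    (∀ l j : ℕ, l < j → bicoeff l j (V * ddX (PowerSeries J) (waveSeries D Λ T (G 0))) = 0) ∧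
    ∀ j ≤ R, bicoeff j j (V * ddX (PowerSeries J) (waveSeries D Λ T (G 0))) =
      ((j : J) + 1) * PowerSeries.coeff (j + 1) (formalPullback (jetSeries G) H q η) := by
  classical
  obtain ⟨κ, ν, hν, hκ0, hκ1, hκ, hP, hP0, hPs⟩ := exists_symbol_logDeriv hΛ hV
  have hq0 : ∀ k, PowerSeries.coeff 0 (q k) = 0 := fun k =>
    PowerSeries.X_pow_dvd_iff.1 (by rw [pow_one]; exact hsol.dvd_left k) 0 Nat.zero_lt_one
  -- Only monomials of degree at least two occur, so agreement of q and κ modulo X^{l+1} already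
  -- determines the coefficient of X^{l+1} of the Legendre expression.
  have hstep : ∀ l ≤ R, 1 ≤ l → (∀ k, PowerSeries.X ^ (l + 1) ∣ q k - κ k) →
      PowerSeries.coeff (l + 1) (MvPowerSeries.subst q (legendre H) : PowerSeries J) =
        PowerSeries.coeff (l + 1) ν := by
    intro l hl hl1 hqκ
    set s := (Λ.filter fun i => i.1 = 0).image Prod.snd
    have hs : ∀ α ∈ s, (0, α) ∈ Λ := by
      intro α hα
      simp only [s, Finset.mem_image, Finset.mem_filter] at hα
      obtain ⟨⟨m, β⟩, ⟨h1, h2⟩, rfl⟩ := hα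
      simp only at h2
      rwa [h2] at h1
    -- The multi-indices of degree at most one are added only to exhaust all degrees up to l + 1;
    -- their coefficients in H vanish.
    rw [coeff_subst_eq_sum hsol.dvd_left _ _ (s := s ∪ degreeLE n 1),
      ← Finset.sum_subset (Finset.subset_union_left (s₁ := s)), hν, map_sum, Finset.sum_image,
      Finset.sum_filter]
    · refine Finset.sum_congr rfl fun i hi => ?_
      obtain ⟨m, α⟩ := i
      rw [PowerSeries.coeff_smul]
      rcases eq_or_ne m 0 with rfl | hm
      · have h2 : 2 ≤ α.degree := by simpa using hΛ _ hi
        rw [if_pos rfl, if_pos rfl, coeff_legendre, PowerSeries.coeff_C_mul, hT α hi, weight]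
        have hd := X_pow_dvd_prod_pow_sub_prod_pow (k := l) hsol.dvd_left hqκ α
        rw [PowerSeries.X_pow_dvd_iff] at hd
        have hd := hd (l + 1) (by omega)
        rw [map_sub, sub_eq_zero] at hd
        rw [hd, zero_add, Nat.cast_smul_eq_nsmul, nsmul_eq_mul, Nat.cast_sub (show 1 ≤ α.degree by omega),
          Nat.cast_one, mul_assoc]
      · rw [if_neg hm, if_neg hm, map_zero, smul_zero]
    · rintro ⟨m, α⟩ h ⟨m', α'⟩ h' e
      simp only [Finset.coe_filter, Set.mem_ofPred_eq] at h h' e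
      rw [h.2, h'.2, e]
    · intro α _ hα
      rw [coeff_legendre, hH2 α, mul_zero, zero_mul]
      by_contra h2
      rename_i hmem
      rcases Finset.mem_union.1 hmem with h | h
      · exact hα h
      · have := mem_degreeLE.1 h; omega
    · intro α hα
      rw [Finset.mem_union, mem_degreeLE]
      by_cases h : α.degree ≤ 1
      · exact Or.inr h
      · refine Or.inl (Finset.mem_image.2 ⟨(0, α), Finset.mem_filter.2 ⟨?_, rfl⟩, rfl⟩)
        exact hΛR α (by omega) (by omega)
  -- The recursion carries a factor l and says nothing about the coefficient of X. That one is
  -- compared directly: it is `D k (G 0)` on both sides.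
  have hmatch : ∀ l ≤ R, ∀ k, PowerSeries.X ^ (l + 1) ∣ q k - κ k := by
    intro l
    induction l with
    | zero =>
      intro _ k
      rw [PowerSeries.X_pow_dvd_iff]
      intro m hm
      obtain rfl : m = 0 := by omega
      rw [map_sub, hq0, hκ0, sub_zero]
    | succ l ih =>
      intro hl k
      have ih := ih (by omega)
      rw [PowerSeries.X_pow_dvd_iff]
      intro m hm
      by_cases hm' : m < l + 1
      · exact PowerSeries.X_pow_dvd_iff.1 (ih k) m hm'
      obtain rfl : m = l + 1 := by omega
      rw [map_sub, sub_eq_zero]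
      cases l with
      | zero =>
        rw [hκ1, hsol.left_eq, PowerSeries.coeff_succ_X_mul, constantCoeff_subst_eq hsol.dvd_right,
          pderiv_jetSeries, coeff_jetSeries, hG]
        simp
      | succ l =>
        refine sub_eq_zero.1 (eq_zero_of_natCast_succ_mul (l := l) ?_)
        rw [mul_sub, coeff_succ_momentum hsol hG hH, hκ, hstep (l + 1) (by omega) (by omega) ih,
          sub_self]
  refine ⟨hP, fun j hj => ?_⟩
  cases j with
  | zero => rw [hP0, coeff_one_formalPullback hsol hH2, Nat.cast_zero, zero_add, one_mul]
  | succ j =>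
    refine sub_eq_zero.1 (eq_zero_of_natCast_succ_mul (l := j) ?_)
    rw [mul_sub, hPs, ← hstep (j + 1) hj (by omega) (hmatch (j + 1) hj),
      ← coeff_succ_formalPullback hsol]
    ring

end HamiltonJacobi

/-! ### Mixed partial derivatives -/

section PartialDeriv

variable {n : ℕ} {M₂ : Set (Coord n)} {g h : Coord n → ℝ}

theorem contDiffOn_partialDeriv (hM₂ : IsOpen M₂) (hg : ContDiffOn ℝ ∞ g M₂) (i : Fin n) :
    ContDiffOn ℝ ∞ (partialDeriv i g) M₂ :=
  (hg.fderiv_of_isOpen hM₂ (m := ∞) le_rfl).clm_apply contDiffOn_const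

theorem eqOn_partialDeriv (hM₂ : IsOpen M₂) (hgh : Set.EqOn g h M₂) (i : Fin n) :
    Set.EqOn (partialDeriv i g) (partialDeriv i h) M₂ := fun y hy => by
  rw [partialDeriv, partialDeriv, (hgh.eventuallyEq_of_mem (hM₂.mem_nhds hy)).fderiv_eq]

theorem partialDeriv_comm (hM₂ : IsOpen M₂) (hg : ContDiffOn ℝ ∞ g M₂) (i j : Fin n) :
    Set.EqOn (partialDeriv i (partialDeriv j g)) (partialDeriv j (partialDeriv i g)) M₂ := by
  intro y hy
  have hgy : ContDiffAt ℝ ∞ g y := hg.contDiffAt (hM₂.mem_nhds hy)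
  have hs : IsSymmSndFDerivAt ℝ g y := hgy.isSymmSndFDerivAt (by
    rw [minSmoothness_of_isRCLikeNormedField]; exact WithTop.coe_le_coe.2 (le_top : (2 : ℕ∞) ≤ ⊤))
  have hd : DifferentiableAt ℝ (fderiv ℝ g) y :=
    (hgy.fderiv_right (m := ∞) le_rfl).differentiableAt (by simp)
  have key : ∀ i j : Fin n, partialDeriv i (partialDeriv j g) y =
      fderiv ℝ (fderiv ℝ g) y (EuclideanSpace.single i 1) (EuclideanSpace.single j 1) := by
    intro i j
    unfold partialDeriv
    rw [fderiv_clm_apply hd (differentiableAt_const _)]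
    simp
  rw [key, key, hs.eq]

theorem contDiffOn_mixedDeriv (hM₂ : IsOpen M₂) (hg : ContDiffOn ℝ ∞ g M₂) (α : Fin n →₀ ℕ) :
    ContDiffOn ℝ ∞ (mixedDeriv α g) M₂ :=
  multiDeriv_induction (d := fun i => partialDeriv i) (C := fun _ v => ContDiffOn ℝ ∞ v M₂) hg
    (fun i _ _ hv => contDiffOn_partialDeriv hM₂ hv i) α

theorem partialDeriv_mixedDeriv (hM₂ : IsOpen M₂) (hg : ContDiffOn ℝ ∞ g M₂) (k : Fin n)
    (α : Fin n →₀ ℕ) :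
    Set.EqOn (partialDeriv k (mixedDeriv α g)) (mixedDeriv α (partialDeriv k g)) M₂ :=
  (multiDeriv_rel (d := fun i => partialDeriv i) (d' := fun i => partialDeriv i)
    (C := fun _ v w => ContDiffOn ℝ ∞ v M₂ ∧ Set.EqOn (partialDeriv k v) w M₂)
    ⟨hg, fun _ _ => rfl⟩
    (fun i _ _ _ hv => ⟨contDiffOn_partialDeriv hM₂ hv.1 i,
      (partialDeriv_comm hM₂ hv.1 k i).trans (eqOn_partialDeriv hM₂ hv.2 i)⟩) α).2

/-- The iterates in `mixedDeriv` are ordered with the first variables outermost, so the additional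
∂ₖ has to be commuted outward past the derivatives in the variables before k. -/
theorem mixedDeriv_add_single (hM₂ : IsOpen M₂) (hg : ContDiffOn ℝ ∞ g M₂) (k : Fin n)
    (α : Fin n →₀ ℕ) : Set.EqOn (mixedDeriv (α + Finsupp.single k 1) g)
      (partialDeriv k (mixedDeriv α g)) M₂ := by
  set fold : List (Fin n) → (Fin n →₀ ℕ) → Coord n → ℝ := fun l β =>
    l.foldr (fun i h => (partialDeriv i)^[β i] h) g with hfold
  have hcons : ∀ i l β, fold (i :: l) β = (partialDeriv i)^[β i] (fold l β) := fun _ _ _ => rfl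
  have hsm : ∀ l β, ContDiffOn ℝ ∞ (fold l β) M₂ := by
    intro l β
    induction l with
    | nil => exact hg
    | cons i l ih =>
      rw [hcons]
      generalize β i = a
      induction a with
      | zero => exact ih
      | succ a iha =>
        rw [Function.iterate_succ_apply']
        exact contDiffOn_partialDeriv hM₂ iha i
  -- Invariant over sublists: the additional derivative is present exactly when k has been passed,
  -- and the absence of duplicates ensures that this happens once.
  have key : ∀ l : List (Fin n), l.Nodup → Set.EqOn (fold l (α + Finsupp.single k 1))
      (if k ∈ l then partialDeriv k (fold l α) else fold l α) M₂ := by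
    intro l
    induction l with
    | nil => intro _ y _; simp [hfold]
    | cons i l ih =>
      intro hl
      rw [List.nodup_cons] at hl
      have ih := ih hl.2
      have hiter : ∀ (a : ℕ) {u v : Coord n → ℝ}, Set.EqOn u v M₂ →
          Set.EqOn ((partialDeriv i)^[a] u) ((partialDeriv i)^[a] v) M₂ := by
        intro a u v huv
        induction a with
        | zero => exact huv
        | succ a iha =>
          rw [Function.iterate_succ_apply', Function.iterate_succ_apply']
          exact eqOn_partialDeriv hM₂ iha i
      rw [hcons, hcons, Finsupp.add_apply]
      by_cases hik : i = k
      · subst hik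
        rw [if_neg hl.1] at ih
        rw [if_pos List.mem_cons_self, Finsupp.single_eq_same,
          Function.iterate_succ_apply']
        exact eqOn_partialDeriv hM₂ (hiter _ ih) i
      · rw [Finsupp.single_eq_of_ne hik, add_zero]
        by_cases hkl : k ∈ l
        · rw [if_pos hkl] at ih
          rw [if_pos (List.mem_cons_of_mem _ hkl)]
          refine (hiter _ ih).trans ?_
          generalize α i = a
          have : ∀ a, ContDiffOn ℝ ∞ ((partialDeriv i)^[a] (fold l α)) M₂ ∧
              Set.EqOn ((partialDeriv i)^[a] (partialDeriv k (fold l α)))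
                (partialDeriv k ((partialDeriv i)^[a] (fold l α))) M₂ := by
            intro a
            induction a with
            | zero => exact ⟨hsm l α, fun _ _ => rfl⟩
            | succ a iha =>
              rw [Function.iterate_succ_apply', Function.iterate_succ_apply']
              exact ⟨contDiffOn_partialDeriv hM₂ iha.1 i,
                (eqOn_partialDeriv hM₂ iha.2 i).trans (partialDeriv_comm hM₂ iha.1 i k)⟩
          exact (this a).2
        · rw [if_neg hkl] at ih
          rw [if_neg (by rw [List.mem_cons]; rintro (h | h); exacts [hik h.symm, hkl h])]
          exact hiter _ ih
  have h := key (List.finRange n) (List.nodup_finRange n)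
  rwa [if_pos (List.mem_finRange k)] at h

end PartialDeriv

/-! ### Universal jets -/

section Universal

variable {n : ℕ}

/-- Polynomials in the symbols `∂^β g` and `S_{m,α}`. -/
abbrev JetRing (n : ℕ) : Type := MvPolynomial ((Fin n →₀ ℕ) ⊕ HIndex n) ℂ

/-- The symbol `∂^β g`. -/
def jetVar (β : Fin n →₀ ℕ) : JetRing n := MvPolynomial.X (Sum.inl β)

/-- The symbol of the coefficient of `ħᵐ ∂^α`. -/
def coeffVar (i : HIndex n) : JetRing n := MvPolynomial.X (Sum.inr i)

/-- The derivation `∂ₖ` of the ring of universal jets. -/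
def jetDeriv (k : Fin n) : Derivation ℂ (JetRing n) (JetRing n) :=
  MvPolynomial.mkDerivation ℂ (Sum.elim (fun β => jetVar (β + Finsupp.single k 1)) fun _ => 0)

theorem jetDeriv_jetVar (k : Fin n) (β : Fin n →₀ ℕ) :
    jetDeriv k (jetVar β) = jetVar (β + Finsupp.single k 1) := by
  simp [jetDeriv, jetVar, MvPolynomial.mkDerivation_X]

theorem jetDeriv_coeffVar (k : Fin n) (i : HIndex n) : jetDeriv k (coeffVar i) = 0 := by
  simp [jetDeriv, coeffVar, MvPolynomial.mkDerivation_X]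

/-- The universal classical generating function, without its terms of degree less than two. -/
def universalHamiltonian (n : ℕ) : MvPowerSeries (Fin n) (JetRing n) :=
  fun α => if 2 ≤ α.degree then coeffVar (0, α) else 0

theorem coeff_universalHamiltonian (α : Fin n →₀ ℕ) :
    MvPowerSeries.coeff α (universalHamiltonian n) =
      if 2 ≤ α.degree then coeffVar (0, α) else 0 := rfl

theorem exists_universal_isFormalSolution : ∃ q η : Fin n → PowerSeries (JetRing n),
    IsFormalSolution (fun i => MvPowerSeries.pderiv (JetRing n) i (jetSeries jetVar))
      (fun i => MvPowerSeries.pderiv (JetRing n) i (universalHamiltonian n)) q η :=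
  (existsUnique_isFormalSolution _ fun i => by
    rw [← MvPowerSeries.coeff_zero_eq_constantCoeff_apply, MvPowerSeries.coeff_pderiv, zero_add,
      coeff_universalHamiltonian, Finsupp.degree_single, if_neg (by norm_num), zero_mul]).1

/-- The universal momentum `q`. -/
def universalMomentum (n : ℕ) : Fin n → PowerSeries (JetRing n) :=
  exists_universal_isFormalSolution.choose

/-- The universal displacement `y - φ(x)`. -/
def universalDisplacement (n : ℕ) : Fin n → PowerSeries (JetRing n) :=
  exists_universal_isFormalSolution.choose_spec.choose

theorem universal_isFormalSolution :
    IsFormalSolution (fun i => MvPowerSeries.pderiv (JetRing n) i (jetSeries jetVar))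
      (fun i => MvPowerSeries.pderiv (JetRing n) i (universalHamiltonian n))
      (universalMomentum n) (universalDisplacement n) :=
  exists_universal_isFormalSolution.choose_spec.choose_spec

/-- The universal nonlinear pullback, without its constant term. -/
def universalPullback (n : ℕ) : PowerSeries (JetRing n) :=
  formalPullback (jetSeries jetVar) (universalHamiltonian n) (universalMomentum n)
    (universalDisplacement n)

/-- The indices of the monomials `ħᵐ q^α` with `m + |α| < N`. -/
def hIndexLT (n N : ℕ) : Finset (HIndex n) :=
  (Finset.range N ×ˢ degreeLE n N).filter fun i => i.1 + i.2.degree < N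

@[simp] theorem mem_hIndexLT {N : ℕ} {i : HIndex n} :
    i ∈ hIndexLT n N ↔ i.1 + i.2.degree < N := by
  simp only [hIndexLT, Finset.mem_filter, Finset.mem_product, Finset.mem_range, mem_degreeLE]
  omega

/-- The indices of the monomials `ħᵐ q^α` with `2 ≤ m + |α| ≤ R + 1`. -/
def higherIndex (n R : ℕ) : Finset (HIndex n) :=
  (hIndexLT n (R + 2)).filter fun i => 2 ≤ i.1 + i.2.degree

@[simp] theorem mem_higherIndex {R : ℕ} {i : HIndex n} :
    i ∈ higherIndex n R ↔ i.1 + i.2.degree < R + 2 ∧ 2 ≤ i.1 + i.2.degree := by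
  simp [higherIndex]

/-- The universal formal wave function. -/
def universalWave (n R : ℕ) : BiSeries (JetRing n) :=
  waveSeries jetDeriv (higherIndex n R) coeffVar (jetVar 0)

/-- The inverse of the universal formal wave function. -/
def universalWaveInv (n R : ℕ) : BiSeries (JetRing n) :=
  (exists_waveSeries_inverse (D := jetDeriv) (Λ := higherIndex n R) (T := coeffVar)
    (G := jetVar 0)).choose

theorem universalWaveInv_mul (n R : ℕ) : universalWaveInv n R * universalWave n R = 1 :=
  (exists_waveSeries_inverse (D := jetDeriv) (Λ := higherIndex n R) (T := coeffVar)
    (G := jetVar 0)).choose_spec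

/-- The logarithmic derivative in `τ` of the universal formal wave function. -/
def universalLogDeriv (n R : ℕ) : BiSeries (JetRing n) :=
  universalWaveInv n R * ddX (PowerSeries (JetRing n)) (universalWave n R)

theorem universalLogDeriv_spec (n R : ℕ) :
    (∀ l j : ℕ, l < j → bicoeff l j (universalLogDeriv n R) = 0) ∧
    ∀ j ≤ R, bicoeff j j (universalLogDeriv n R) =
      ((j : JetRing n) + 1) * PowerSeries.coeff (j + 1) (universalPullback n) := by
  refine bicoeff_logDeriv_eq_coeff_formalPullback (D := jetDeriv) (fun i hi => ?_)
    (fun α h2 hR => ?_) universal_isFormalSolution jetDeriv_jetVar (fun k α => ?_) (fun α hα => ?_)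
    (fun α hα => ?_) (universalWaveInv_mul n R)
  · exact (mem_higherIndex.1 hi).2
  · rw [mem_higherIndex]; simp only; omega
  · rw [coeff_universalHamiltonian]
    split_ifs
    · exact jetDeriv_coeffVar _ _
    · exact map_zero _
  · rw [coeff_universalHamiltonian, if_neg (by omega)]
  · have := (mem_higherIndex.1 hα).2
    rw [coeff_universalHamiltonian, if_pos (by simpa using this)]

end Universal

/-! ### Evaluation of universal jets -/

section Evaluation

variable {n₁ n : ℕ} {M₁ : Type*} [TopologicalSpace M₁]
  [ChartedSpace (EuclideanSpace ℝ (Fin n₁)) M₁] {M₂ : Set (Coord n)}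

/-- The value at `(x, y)` of a universal jet; the symbols of `∂^β g` and of the coefficient of
`ħᵐ ∂^α` stand for `i ∂^β g` and `i (-i)^{|α|} S_{m,α}`. -/
def jetEval (S : QuantumGeneratingFunction n₁ M₁ M₂) (g : Coord n → ℝ) (x : M₁) (y : Coord n) :
    JetRing n →ₐ[ℂ] ℂ :=
  MvPolynomial.aeval (Sum.elim (fun β => Complex.I * (mixedDeriv β g y : ℂ))
    fun i => Complex.I * (-Complex.I) ^ i.2.degree * S.coeff i.1 i.2 x)

variable (S : QuantumGeneratingFunction n₁ M₁ M₂) (g : Coord n → ℝ)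

theorem jetEval_jetVar (x : M₁) (y : Coord n) (β : Fin n →₀ ℕ) :
    jetEval S g x y (jetVar β) = Complex.I * (mixedDeriv β g y : ℂ) := by
  simp [jetEval, jetVar]

theorem jetEval_coeffVar (x : M₁) (y : Coord n) (i : HIndex n) :
    jetEval S g x y (coeffVar i) = Complex.I * (-Complex.I) ^ i.2.degree * S.coeff i.1 i.2 x := by
  simp [jetEval, coeffVar]

variable {g}

/-- Evaluation intertwines ∂ₖ in y with `jetDeriv k`. The point x is held fixed, so the symbols of
the coefficients of S are constants. It suffices to check generators and apply the Leibniz rule. -/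
theorem hasFDerivAt_jetEval (hM₂ : IsOpen M₂) (hg : ContDiffOn ℝ ∞ g M₂) (x : M₁) {y : Coord n}
    (hy : y ∈ M₂) (u : JetRing n) : DifferentiableAt ℝ (fun y => jetEval S g x y u) y ∧
      ∀ k, fderiv ℝ (fun y => jetEval S g x y u) y (EuclideanSpace.single k 1) =
        jetEval S g x y (jetDeriv k u) := by
  induction u using MvPolynomial.induction_on with
  | C a =>
    have : (fun y => jetEval S g x y (MvPolynomial.C a)) = fun _ => a := by
      funext y; exact MvPolynomial.aeval_C _ a
    rw [this]
    refine ⟨differentiableAt_const _, fun k => ?_⟩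
    simp
  | add p q hp hq =>
    simp only [map_add]
    refine ⟨hp.1.add hq.1, fun k => ?_⟩
    rw [fderiv_fun_add hp.1 hq.1, add_apply, hp.2, hq.2]
  | mul_X p i hp =>
    have hX : DifferentiableAt ℝ (fun y => jetEval S g x y (MvPolynomial.X i)) y ∧
      ∀ k, fderiv ℝ (fun y => jetEval S g x y (MvPolynomial.X i)) y (EuclideanSpace.single k 1) =
        jetEval S g x y (jetDeriv k (MvPolynomial.X i)) := by
      rcases i with β | i
      · have e : (fun y => jetEval S g x y (MvPolynomial.X (Sum.inl β))) =
            fun y => Complex.I * (mixedDeriv β g y : ℂ) := funext fun y => jetEval_jetVar S g x y β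
        have hd : DifferentiableAt ℝ (mixedDeriv β g) y :=
          ((contDiffOn_mixedDeriv hM₂ hg β).contDiffAt (hM₂.mem_nhds hy)).differentiableAt (by simp)
        have hf := (Complex.ofRealCLM.hasFDerivAt.comp y hd.hasFDerivAt).const_mul Complex.I
        rw [e]
        refine ⟨hf.differentiableAt, fun k => ?_⟩
        erw [hf.fderiv]
        have h2 := jetDeriv_jetVar k β
        rw [jetVar] at h2
        rw [h2, jetEval_jetVar, mixedDeriv_add_single hM₂ hg k β hy]
        simp [partialDeriv]
      · have e : (fun y => jetEval S g x y (MvPolynomial.X (Sum.inr i))) =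
            fun y => Complex.I * (-Complex.I) ^ i.2.degree * S.coeff i.1 i.2 x :=
          funext fun y => jetEval_coeffVar S g x y i
        rw [e]
        refine ⟨differentiableAt_const _, fun k => ?_⟩
        have h2 := jetDeriv_coeffVar k i
        rw [coeffVar] at h2
        rw [h2]
        simp
    simp only [map_mul]
    refine ⟨hp.1.mul hX.1, fun k => ?_⟩
    rw [fderiv_fun_mul hp.1 hX.1, Derivation.leibniz]
    simp [hp.2, hX.2]

theorem contMDiff_base : ContMDiff (𝓡 n₁) 𝓘(ℝ, Coord n) ∞ S.base := by
  have h : ContMDiff (𝓡 n₁) 𝓘(ℝ, Fin n → ℝ) ∞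
      fun x i => (S.coeff 0 (Finsupp.single i 1) x).re := by
    rw [contMDiff_pi_space]
    intro i
    exact (Complex.reCLM.contDiff.contMDiff).comp (S.contMDiff_coeff 0 (Finsupp.single i 1))
  exact ((PiLp.continuousLinearEquiv 2 ℝ fun _ : Fin n => ℝ).symm.contDiff.contMDiff).comp h

theorem base_mem (x : M₁) : S.base x ∈ M₂ := S.base_mem x

theorem contMDiff_jetEval (hM₂ : IsOpen M₂) (hg : ContDiffOn ℝ ∞ g M₂) (u : JetRing n) :
    ContMDiff (𝓡 n₁) 𝓘(ℝ, ℂ) ∞ fun x => jetEval S g x (S.base x) u := by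
  induction u using MvPolynomial.induction_on with
  | C a =>
    have : (fun x => jetEval S g x (S.base x) (MvPolynomial.C a)) = fun _ => a := by
      funext y; exact MvPolynomial.aeval_C _ a
    rw [this]
    exact contMDiff_const
  | add p q hp hq =>
    simp only [map_add]
    exact hp.add hq
  | mul_X p i hp =>
    have hmul : ContMDiff 𝓘(ℝ, ℂ × ℂ) 𝓘(ℝ, ℂ) ∞ fun p : ℂ × ℂ => p.1 * p.2 :=
      contDiff_mul.contMDiff
    simp only [map_mul]
    refine hmul.comp (hp.prodMk_space ?_)
    rcases i with β | i
    · have e : (fun x => jetEval S g x (S.base x) (MvPolynomial.X (Sum.inl β))) =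
          fun x => Complex.I * (mixedDeriv β g (S.base x) : ℂ) :=
        funext fun x => jetEval_jetVar S g x _ β
      rw [e]
      refine hmul.comp (contMDiff_const.prodMk_space
        ((Complex.ofRealCLM.contDiff.contMDiff).comp ?_))
      exact ((contDiffOn_mixedDeriv hM₂ hg β).contMDiffOn.comp_contMDiff (contMDiff_base S)
        (base_mem S))
    · have e : (fun x => jetEval S g x (S.base x) (MvPolynomial.X (Sum.inr i))) =
          fun x => Complex.I * (-Complex.I) ^ i.2.degree * S.coeff i.1 i.2 x :=
        funext fun x => jetEval_coeffVar S g x _ i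
      rw [e]
      exact hmul.comp (contMDiff_const.prodMk_space (S.contMDiff_coeff _ _))

end Evaluation

/-! ### The nonlinear pullback as a formal solution -/

section Nonlinear

variable {n : ℕ}

/-- The terms of degree at least two of a generating function. -/
def higherPart (S₀ : MvPowerSeries (Fin n) ℝ) : MvPowerSeries (Fin n) ℝ :=
  fun α => if 2 ≤ α.degree then MvPowerSeries.coeff α S₀ else 0

theorem coeff_higherPart (S₀ : MvPowerSeries (Fin n) ℝ) (α : Fin n →₀ ℕ) :
    MvPowerSeries.coeff α (higherPart S₀) =
      if 2 ≤ α.degree then MvPowerSeries.coeff α S₀ else 0 := rfl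

theorem exists_eq_single_of_degree_eq_one {α : Fin n →₀ ℕ} (h : α.degree = 1) :
    ∃ i, α = Finsupp.single i 1 := by
  obtain ⟨i, hi⟩ : ∃ i, α i ≠ 0 := by
    by_contra! h0
    rw [show α = 0 from Finsupp.ext h0] at h
    simp at h
  have hle : Finsupp.single i 1 ≤ α := Finsupp.single_le_iff.2 (Nat.one_le_iff_ne_zero.2 hi)
  have e := add_tsub_cancel_of_le hle
  refine ⟨i, ?_⟩
  have hd := congrArg Finsupp.degree e
  rw [map_add, Finsupp.degree_single, h] at hd
  have h0 : α - Finsupp.single i 1 = 0 := (Finsupp.degree_eq_zero_iff _).1 (by omega)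
  rw [h0, add_zero] at e
  exact e.symm

theorem eq_add_higherPart (S₀ : MvPowerSeries (Fin n) ℝ) : S₀ =
    MvPowerSeries.C (MvPowerSeries.coeff 0 S₀) +
      ∑ i, MvPowerSeries.C (MvPowerSeries.coeff (Finsupp.single i 1) S₀) * MvPowerSeries.X i +
      higherPart S₀ := by
  classical
  ext α
  simp only [map_add, map_sum, MvPowerSeries.coeff_C_mul, MvPowerSeries.coeff_C,
    MvPowerSeries.coeff_X, coeff_higherPart, mul_ite, mul_one, mul_zero]
  rcases Nat.lt_or_ge α.degree 2 with h | h
  · rw [if_neg (by omega : ¬ 2 ≤ α.degree), add_zero]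
    rcases Nat.lt_or_ge α.degree 1 with h1 | h1
    · obtain rfl := (Finsupp.degree_eq_zero_iff α).1 (by omega)
      rw [if_pos rfl, Finset.sum_eq_zero, add_zero]
      intro i _
      rw [if_neg]
      intro h0
      simpa using congrArg Finsupp.degree h0
    · obtain ⟨i, rfl⟩ := exists_eq_single_of_degree_eq_one (show α.degree = 1 by omega)
      rw [if_neg (by simp), Finset.sum_eq_single i]
      · simp
      · intro j _ hj
        rw [if_neg]
        intro h0
        exact hj (Finsupp.single_left_injective one_ne_zero h0).symm
      · simp
  · have h0 : α ≠ 0 := by rintro rfl; simp at h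
    rw [if_neg h0, if_pos h, Finset.sum_eq_zero, add_zero, zero_add]
    intro i _
    rw [if_neg]
    rintro rfl
    simp at h

theorem substFormal_eq {S₀ : MvPowerSeries (Fin n) ℝ} {q : Fin n → PowerSeries ℝ}
    (hq : ∀ i, PowerSeries.X ∣ q i) : substFormal S₀ q =
      (PowerSeries.C (MvPowerSeries.coeff 0 S₀) +
      ∑ i, PowerSeries.C (MvPowerSeries.coeff (Finsupp.single i 1) S₀) * q i +
      MvPowerSeries.subst q (higherPart S₀) : PowerSeries ℝ) := by
  have hs := hasSubst_of_X_dvd hq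
  have hC : ∀ a : ℝ, MvPowerSeries.substAlgHom hs (MvPowerSeries.C a) = PowerSeries.C a :=
    fun a => (MvPowerSeries.substAlgHom_apply hs _).trans (MvPowerSeries.subst_C a)
  rw [substFormal, ← MvPowerSeries.coe_substAlgHom hs]
  conv_lhs => rw [eq_add_higherPart S₀]
  rw [map_add, map_add, map_sum, hC]
  congr 2
  refine Finset.sum_congr rfl fun i _ => ?_
  rw [map_mul, hC, MvPowerSeries.substAlgHom_X]

theorem substFormal_pderiv_eq {S₀ : MvPowerSeries (Fin n) ℝ} {q : Fin n → PowerSeries ℝ}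
    (hq : ∀ i, PowerSeries.X ∣ q i) (i : Fin n) :
    substFormal (MvPowerSeries.pderiv ℝ i S₀) q =
      (PowerSeries.C (MvPowerSeries.coeff (Finsupp.single i 1) S₀) +
      MvPowerSeries.subst q (MvPowerSeries.pderiv ℝ i (higherPart S₀)) : PowerSeries ℝ) := by
  classical
  have hs := hasSubst_of_X_dvd hq
  have e : MvPowerSeries.pderiv ℝ i S₀ = MvPowerSeries.C (MvPowerSeries.coeff
      (Finsupp.single i 1) S₀) + MvPowerSeries.pderiv ℝ i (higherPart S₀) := by
    ext α
    rw [map_add, MvPowerSeries.coeff_pderiv, MvPowerSeries.coeff_pderiv, MvPowerSeries.coeff_C,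
      coeff_higherPart, map_add, Finsupp.degree_single]
    by_cases h : α = 0
    · subst h; simp
    · have : α.degree ≠ 0 := fun h0 => h ((Finsupp.degree_eq_zero_iff α).1 h0)
      rw [if_neg h, if_pos (by omega), zero_add]
  rw [substFormal, e, MvPowerSeries.subst_add hs]
  congr 1
  exact MvPowerSeries.subst_C _

/-- Translating y by b cancels the linear part ∑bᵢqᵢ of S₀ against the same terms in ∑yᵢqᵢ. What
remains is the formal pullback for the part of degree at least two, plus the constant S₀(0). -/
theorem isNonlinearPullback_iff {M₂ : Set (Coord n)} (hM₂ : IsOpen M₂) {g : Coord n → ℝ}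
    (hg : ContDiffOn ℝ ∞ g M₂) {S₀ : MvPowerSeries (Fin n) ℝ} {b : Coord n} (hb : b ∈ M₂)
    (hbS : ∀ i, MvPowerSeries.coeff (Finsupp.single i 1) S₀ = b i) (f : PowerSeries ℝ) :
    IsNonlinearPullback S₀ b g f ↔ ∃ q η,
      IsFormalSolution (fun i => MvPowerSeries.pderiv ℝ i (taylorSeries g b))
        (fun i => MvPowerSeries.pderiv ℝ i (higherPart S₀)) q η ∧
      f = PowerSeries.C (MvPowerSeries.coeff 0 S₀) +
        formalPullback (taylorSeries g b) (higherPart S₀) q η := by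
  have hT : ∀ i, taylorSeries (partialDeriv i g) b =
      MvPowerSeries.pderiv ℝ i (taylorSeries g b) := by
    intro i
    ext α
    rw [MvPowerSeries.coeff_pderiv]
    change mixedDeriv α (partialDeriv i g) b / _ = mixedDeriv (α + Finsupp.single i 1) g b / _ * _
    rw [mixedDeriv_add_single hM₂ hg i α hb, partialDeriv_mixedDeriv hM₂ hg i α hb,
      prod_factorial_add_single, Nat.cast_mul, Nat.cast_succ, div_mul_eq_mul_div,
      mul_div_mul_right _ _ (Nat.cast_add_one_ne_zero (α i))]
  have hval : ∀ {y q : Fin n → PowerSeries ℝ}, (∀ i, PowerSeries.X ∣ q i) →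
      PowerSeries.X * compFormal g b y + substFormal S₀ q - ∑ i, y i * q i =
      PowerSeries.C (MvPowerSeries.coeff 0 S₀) + formalPullback (taylorSeries g b) (higherPart S₀) q
        fun i => y i - PowerSeries.C (b i) := by
    intro y q hq
    rw [substFormal_eq hq, formalPullback, compFormal]
    simp only [hbS, sub_mul, Finset.sum_sub_distrib]
    ring
  constructor
  · rintro ⟨y, q, h, rfl⟩
    have hq : ∀ i, PowerSeries.X ∣ q i := fun i => PowerSeries.X_dvd_iff.2 (h.constantCoeff_q i)
    refine ⟨q, fun i => y i - PowerSeries.C (b i), ⟨hq, fun i => ?_, fun i => ?_, fun i => ?_⟩,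
      hval hq⟩
    · rw [PowerSeries.X_dvd_iff, map_sub, h.constantCoeff_y, PowerSeries.constantCoeff_C, sub_self]
    · rw [h.momentum i, compFormal, hT]
    · rw [h.position i, substFormal_pderiv_eq hq, hbS]; ring
  · rintro ⟨q, η, h, rfl⟩
    have e : (fun i => η i + PowerSeries.C (b i) - PowerSeries.C (b i)) = η :=
      funext fun i => by ring
    refine ⟨fun i => η i + PowerSeries.C (b i), q, ⟨fun i => ?_, fun i => ?_, fun i => ?_,
      fun i => ?_⟩, ?_⟩
    · rw [map_add, PowerSeries.X_dvd_iff.1 (h.dvd_right i), PowerSeries.constantCoeff_C, zero_add]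
    · exact PowerSeries.X_dvd_iff.1 (h.dvd_left i)
    · rw [compFormal, e, hT, ← h.left_eq]
    · rw [substFormal_pderiv_eq h.dvd_left, hbS, h.right_eq i]; ring
    · rw [hval h.dvd_left, e]

end Nonlinear

/-! ### The nonlinear pullback as an evaluation of the universal one -/

section Classical

variable {n₁ n : ℕ} {M₁ : Type*} [TopologicalSpace M₁]
  [ChartedSpace (EuclideanSpace ℝ (Fin n₁)) M₁] {M₂ : Set (Coord n)}

theorem subst_C_mul {R : Type*} [CommRing R] {q : Fin n → PowerSeries R}
    (hq : ∀ i, PowerSeries.X ∣ q i) {P P' : MvPowerSeries (Fin n) R} {c d : R}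
    (h : ∀ α : Fin n →₀ ℕ, MvPowerSeries.coeff α P' * c ^ α.degree = d * MvPowerSeries.coeff α P) :
    (MvPowerSeries.subst (fun i => PowerSeries.C c * q i) P' : PowerSeries R) =
      (PowerSeries.C d * MvPowerSeries.subst q P : PowerSeries R) := by
  ext j
  rw [PowerSeries.coeff_C_mul, coeff_subst_eq_sum hq P j (s := degreeLE n j)
    (fun α h => mem_degreeLE.2 h), coeff_subst_eq_sum (fun i => (hq i).mul_left _) P' j
    (s := degreeLE n j) (fun α h => mem_degreeLE.2 h), Finset.mul_sum]
  refine Finset.sum_congr rfl fun α _ => ?_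
  simp only [mul_pow, Finset.prod_mul_distrib]
  rw [Finset.prod_pow_eq_pow_sum, ← Finsupp.degree_eq_sum, ← map_pow, PowerSeries.coeff_C_mul,
    ← mul_assoc, h, mul_assoc]

theorem map_formalPullback {R R' : Type*} [CommRing R] [CommRing R'] (ρ : R →+* R')
    (Γ H : MvPowerSeries (Fin n) R) {q η : Fin n → PowerSeries R}
    (hq : ∀ i, PowerSeries.X ∣ q i) (hη : ∀ i, PowerSeries.X ∣ η i) :
    PowerSeries.map ρ (formalPullback Γ H q η) =
      formalPullback (MvPowerSeries.map ρ Γ) (MvPowerSeries.map ρ H)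
        (fun i => PowerSeries.map ρ (q i)) (fun i => PowerSeries.map ρ (η i)) := by
  rw [formalPullback, map_sub, map_add, map_mul, PowerSeries.map_X, map_sum, formalPullback]
  congr 1
  · congr 1
    · congr 1
      exact MvPowerSeries.map_subst (hasSubst_of_X_dvd hη) Γ
    · exact MvPowerSeries.map_subst (hasSubst_of_X_dvd hq) H
  · exact Finset.sum_congr rfl fun i _ => map_mul _ _ _

theorem map_pderiv {R R' : Type*} [CommRing R] [CommRing R'] (ρ : R →+* R')
    (P : MvPowerSeries (Fin n) R) (i : Fin n) :
    MvPowerSeries.map ρ (MvPowerSeries.pderiv R i P) =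
      MvPowerSeries.pderiv R' i (MvPowerSeries.map ρ P) := by
  ext α
  simp [MvPowerSeries.coeff_pderiv]

variable (S : QuantumGeneratingFunction n₁ M₁ M₂) (g : Coord n → ℝ)

/-- The value at `x` of the nonlinear pullback. -/
def pullbackSeries (x : M₁) : PowerSeries ℝ := PowerSeries.mk fun j =>
  if j = 0 then (S.coeff 0 0 x).re
  else (jetEval S g x (S.base x) (PowerSeries.coeff j (universalPullback n))).im

variable {g}

/-- Evaluation turns Γ into iΓ and H(q) into iH(-iq). If (q, η) solves the real equations, then (iq,
η) solves the evaluated ones, and each of the three terms of the pullback acquires a factor i.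
Uniqueness of formal solutions identifies this with the evaluated universal solution. -/
theorem I_mul_formalPullback_eq (x : M₁) {q η : Fin n → PowerSeries ℝ}
    (h : IsFormalSolution (fun i => MvPowerSeries.pderiv ℝ i (taylorSeries g (S.base x)))
        (fun i => MvPowerSeries.pderiv ℝ i (higherPart (S.classical x))) q η) (j : ℕ) :
    jetEval S g x (S.base x) (PowerSeries.coeff j (universalPullback n)) =
      Complex.I * (PowerSeries.coeff j
        (formalPullback (taylorSeries g (S.base x)) (higherPart (S.classical x)) q η) : ℝ) := by
  set ρ : JetRing n →+* ℂ := (jetEval S g x (S.base x)).toRingHom with hρ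
  have hρa : ∀ u, ρ u = jetEval S g x (S.base x) u := fun _ => rfl
  have hreal : ∀ α, ((S.coeff 0 α x).re : ℂ) = S.coeff 0 α x := fun α =>
    Complex.ext rfl (by simp [S.classical_real α x])
  set Γ := MvPowerSeries.map Complex.ofRealHom (taylorSeries g (S.base x)) with hΓ
  set Γ' := MvPowerSeries.map ρ (jetSeries jetVar) with hΓ'
  set H := MvPowerSeries.map Complex.ofRealHom (higherPart (S.classical x)) with hH
  set H' := MvPowerSeries.map ρ (universalHamiltonian n) with hH'
  have hΓc : ∀ α, MvPowerSeries.coeff α Γ' = Complex.I * MvPowerSeries.coeff α Γ := by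
    intro α
    rw [hΓ', hΓ, MvPowerSeries.coeff_map, MvPowerSeries.coeff_map, coeff_jetSeries, hρa,
      map_smul, jetEval_jetVar]
    change _ = Complex.I * ((mixedDeriv α g (S.base x) / ((∏ i, (α i).factorial : ℕ) : ℝ) : ℝ) : ℂ)
    rw [Complex.ofReal_div, Complex.ofReal_natCast, smul_eq_mul]
    ring
  have hHc : ∀ α : Fin n →₀ ℕ, MvPowerSeries.coeff α H' =
      Complex.I * (-Complex.I) ^ α.degree * MvPowerSeries.coeff α H := by
    intro α
    rw [hH', hH, MvPowerSeries.coeff_map, MvPowerSeries.coeff_map, coeff_universalHamiltonian,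
      coeff_higherPart]
    split_ifs
    · rw [hρa, jetEval_coeffVar]
      congr 1
      exact (hreal α).symm
    · simp
  have hI : ∀ k : ℕ, (-Complex.I) ^ k * Complex.I ^ k = 1 := fun k => by
    rw [← mul_pow, neg_mul, Complex.I_mul_I, neg_neg, one_pow]
  have hU := universal_isFormalSolution.map ρ
  have hR := h.map Complex.ofRealHom
  simp only [map_pderiv] at hU hR
  rw [← hΓ', ← hH'] at hU
  rw [← hΓ, ← hH] at hR
  set qc := fun i => PowerSeries.map Complex.ofRealHom (q i)
  set ηc := fun i => PowerSeries.map Complex.ofRealHom (η i)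
  have hone : (fun i => PowerSeries.C (1 : ℂ) * ηc i) = ηc := by funext i; simp
  have hsubη : ∀ P P' : MvPowerSeries (Fin n) ℂ, (∀ α, MvPowerSeries.coeff α P' =
      Complex.I * MvPowerSeries.coeff α P) → (MvPowerSeries.subst ηc P' : PowerSeries ℂ) =
        (PowerSeries.C Complex.I * MvPowerSeries.subst ηc P : PowerSeries ℂ) := by
    intro P P' hP
    have := subst_C_mul hR.dvd_right (P := P) (P' := P') (c := 1) (d := Complex.I)
      (fun α => by rw [hP, one_pow, mul_one])
    rwa [hone] at this
  have hR' : IsFormalSolution (fun i => MvPowerSeries.pderiv ℂ i Γ')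
      (fun i => MvPowerSeries.pderiv ℂ i H') (fun i => PowerSeries.C Complex.I * qc i) ηc := by
    refine ⟨fun i => (hR.dvd_left i).mul_left _, hR.dvd_right, fun i => ?_, fun i => ?_⟩
    · rw [hsubη (MvPowerSeries.pderiv ℂ i Γ) (MvPowerSeries.pderiv ℂ i Γ') fun α => by
        rw [MvPowerSeries.coeff_pderiv, MvPowerSeries.coeff_pderiv, hΓc, mul_assoc], hR.left_eq i]
      ring
    · rw [subst_C_mul hR.dvd_left (P := MvPowerSeries.pderiv ℂ i H) (d := 1), hR.right_eq i,
        map_one, one_mul]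
      intro α
      rw [MvPowerSeries.coeff_pderiv, MvPowerSeries.coeff_pderiv, hHc, map_add,
        Finsupp.degree_single, pow_succ]
      have := hI α.degree
      linear_combination (MvPowerSeries.coeff (α + Finsupp.single i 1) H * (α i + 1)) *
        (this - (-Complex.I) ^ α.degree * Complex.I ^ α.degree * Complex.I_sq)
  obtain ⟨eq, eη⟩ := (existsUnique_isFormalSolution _ (fun i => by
    rw [← MvPowerSeries.coeff_zero_eq_constantCoeff_apply, MvPowerSeries.coeff_pderiv, hHc, hH,
      MvPowerSeries.coeff_map, coeff_higherPart, zero_add, Finsupp.degree_single,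
      if_neg (by norm_num)]
    simp)).2 _ _ _ _ hU hR'
  have hfin : PowerSeries.map ρ (universalPullback n) = PowerSeries.C Complex.I *
      PowerSeries.map Complex.ofRealHom
        (formalPullback (taylorSeries g (S.base x)) (higherPart (S.classical x)) q η) := by
    rw [universalPullback, map_formalPullback ρ _ _ universal_isFormalSolution.dvd_left
      universal_isFormalSolution.dvd_right, map_formalPullback _ _ _ h.dvd_left h.dvd_right, eq, eη,
      ← hΓ, ← hΓ', ← hH, ← hH', formalPullback, formalPullback, hsubη Γ Γ' hΓc,
      subst_C_mul hR.dvd_left (P := H) (d := Complex.I) (fun α => by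
        rw [hHc]; linear_combination (Complex.I * MvPowerSeries.coeff α H) * hI α.degree),
      mul_sub, mul_add, Finset.mul_sum]
    congr 1
    · ring
    · exact Finset.sum_congr rfl fun i _ => by ring
  have := congrArg (PowerSeries.coeff j) hfin
  rwa [PowerSeries.coeff_map, PowerSeries.coeff_C_mul, PowerSeries.coeff_map] at this

theorem coeff_single_classical (x : M₁) (i : Fin n) :
    MvPowerSeries.coeff (Finsupp.single i 1) (S.classical x) = S.base x i := rfl

theorem coeff_zero_formalPullback {R : Type*} [CommRing R] {Γ H : MvPowerSeries (Fin n) R}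
    {q η : Fin n → PowerSeries R} (hq : ∀ i, PowerSeries.X ∣ q i) (hη : ∀ i, PowerSeries.X ∣ η i)
    (hH : MvPowerSeries.coeff 0 H = 0) : PowerSeries.coeff 0 (formalPullback Γ H q η) = 0 := by
  have h1 : PowerSeries.coeff 0 (∑ i, η i * q i) = 0 := by
    refine (PowerSeries.X_pow_dvd_iff (n := 1)).1 (Finset.dvd_sum fun i _ => ?_) 0 zero_lt_one
    rw [pow_one]
    exact (hη i).mul_right _
  rw [formalPullback, map_sub, map_add, PowerSeries.coeff_zero_X_mul, h1,
    constantCoeff_subst_eq hq, hH]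
  simp

theorem exists_real_isFormalSolution (Γ : Fin n → MvPowerSeries (Fin n) ℝ)
    (S₀ : MvPowerSeries (Fin n) ℝ) : ∃ q η, IsFormalSolution Γ
      (fun i => MvPowerSeries.pderiv ℝ i (higherPart S₀)) q η :=
  (existsUnique_isFormalSolution _ fun i => by
    rw [← MvPowerSeries.coeff_zero_eq_constantCoeff_apply, MvPowerSeries.coeff_pderiv,
      coeff_higherPart, zero_add, Finsupp.degree_single, if_neg (by norm_num), zero_mul]).1

theorem add_formalPullback_eq_pullbackSeries (x : M₁) {q η : Fin n → PowerSeries ℝ}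
    (h : IsFormalSolution (fun i => MvPowerSeries.pderiv ℝ i (taylorSeries g (S.base x)))
        (fun i => MvPowerSeries.pderiv ℝ i (higherPart (S.classical x))) q η) :
    PowerSeries.C (MvPowerSeries.coeff 0 (S.classical x)) +
      formalPullback (taylorSeries g (S.base x)) (higherPart (S.classical x)) q η =
        pullbackSeries S g x := by
  ext j
  rw [map_add, PowerSeries.coeff_C, pullbackSeries, PowerSeries.coeff_mk]
  split_ifs with hj
  · subst hj
    rw [coeff_zero_formalPullback h.dvd_left h.dvd_right, add_zero]
    · rfl
    · rw [coeff_higherPart]; simp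
  · rw [I_mul_formalPullback_eq S x h j]
    simp

theorem isNonlinearPullback_iff_eq_pullbackSeries (hM₂ : IsOpen M₂) (hg : ContDiffOn ℝ ∞ g M₂)
    (x : M₁) (f : PowerSeries ℝ) : IsNonlinearPullback (S.classical x) (S.base x) g f ↔
      f = pullbackSeries S g x := by
  rw [isNonlinearPullback_iff hM₂ hg (base_mem S x) (coeff_single_classical S x)]
  constructor
  · rintro ⟨q, η, h, rfl⟩
    exact add_formalPullback_eq_pullbackSeries S x h
  · rintro rfl
    obtain ⟨q, η, h⟩ := exists_real_isFormalSolution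
      (fun i => MvPowerSeries.pderiv ℝ i (taylorSeries g (S.base x))) (S.classical x)
    exact ⟨q, η, h, (add_formalPullback_eq_pullbackSeries S x h).symm⟩

theorem jetEval_coeff_universalPullback (x : M₁) {j : ℕ} (hj : j ≠ 0) :
    jetEval S g x (S.base x) (PowerSeries.coeff j (universalPullback n)) =
      Complex.I * (PowerSeries.coeff j (pullbackSeries S g x) : ℝ) := by
  obtain ⟨q, η, h⟩ := exists_real_isFormalSolution
    (fun i => MvPowerSeries.pderiv ℝ i (taylorSeries g (S.base x))) (S.classical x)
  rw [I_mul_formalPullback_eq S x h, ← add_formalPullback_eq_pullbackSeries S x h, map_add,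
    PowerSeries.coeff_C, if_neg hj, zero_add]

/-- Each coefficient of positive degree is the imaginary part of a fixed polynomial in the jets of g
at φ(x) and the coefficients of S, so no smooth dependence of formal solutions has to be studied. -/
theorem contMDiff_coeff_pullbackSeries (hM₂ : IsOpen M₂) (hg : ContDiffOn ℝ ∞ g M₂) (j : ℕ) :
    ContMDiff (𝓡 n₁) 𝓘(ℝ, ℝ) ∞ fun x => PowerSeries.coeff j (pullbackSeries S g x) := by
  simp only [pullbackSeries, PowerSeries.coeff_mk]
  split_ifs
  · exact Complex.reCLM.contDiff.contMDiff.comp (S.contMDiff_coeff 0 0)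
  · exact Complex.imCLM.contDiff.contMDiff.comp (contMDiff_jetEval S hM₂ hg _)

end Classical

/-! ### The remainder of a formal exponential -/

section ExpRemainder

variable {ι : Type*} {Λ : Finset ι} {r : ι → ℕ}

/-- The Taylor coefficients of `exp (∑ cᵢ z^{rᵢ})`. -/
abbrev expCoeff (Λ : Finset ι) (r : ι → ℕ) (c : ι → ℂ) : ℕ → ℂ :=
  flow Λ r (fun i u => c i * u) (1 : ℂ)

/-- Weighted homogeneity, which allows a power of the size of ξ to be moved from the exponents into
the expansion variable. -/
theorem expCoeff_smul (c : ι → ℂ) (s : ℂ) (l : ℕ) :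
    expCoeff Λ r (fun i => s ^ r i * c i) l = s ^ l * expCoeff Λ r c l := by
  induction l using Nat.strong_induction_on with
  | _ l ih =>
    cases l with
    | zero => simp [expCoeff, flow_zero]
    | succ l =>
      have ih' : ∀ i, ¬ (l + 1 < r i) → 1 ≤ r i →
          flow Λ r (fun i u => s ^ r i * c i * u) 1 (l + 1 - r i) =
            s ^ (l + 1 - r i) * flow Λ r (fun i u => c i * u) (1 : ℂ) (l + 1 - r i) :=
        fun i _ _ => ih _ (by omega)
      simp only [expCoeff, flow, smul_eq_mul]
      rw [mul_left_comm, Finset.mul_sum (a := s ^ (l + 1))]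
      congr 1
      refine Finset.sum_congr rfl fun i _ => ?_
      split_ifs with h
      · have hs : s ^ (l + 1) = s ^ (l + 1 - r i) * s ^ r i := by rw [← pow_add]; congr 1; omega
        rw [ih' i (by omega) h.1, hs]
        ring
      · rw [mul_zero]

theorem exists_expCoeff_bound (Λ : Finset ι) (r : ι → ℕ) {C : ℝ} (hC : 0 ≤ C) (L : ℕ) :
    ∃ B : ℝ, 0 ≤ B ∧ ∀ c : ι → ℂ, (∀ i ∈ Λ, ‖c i‖ ≤ C) → ∀ l ≤ L, ‖expCoeff Λ r c l‖ ≤ B := by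
  induction L with
  | zero =>
    refine ⟨1, zero_le_one, fun c _ l hl => ?_⟩
    obtain rfl : l = 0 := by omega
    simp [expCoeff, flow_zero]
  | succ L ih =>
    obtain ⟨B, hB, h⟩ := ih
    have hs : 0 ≤ ∑ i ∈ Λ, (r i : ℝ) * (C * B) := Finset.sum_nonneg fun i _ => by positivity
    refine ⟨B + ∑ i ∈ Λ, (r i : ℝ) * (C * B), by positivity, fun c hc l hl => ?_⟩
    rcases Nat.lt_or_ge l (L + 1) with h1 | h1
    · exact (h c hc l (by omega)).trans (le_add_of_nonneg_right hs)
    obtain rfl : l = L + 1 := by omega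
    rw [expCoeff, flow, norm_smul]
    have h2 : ‖((L : ℂ) + 1)⁻¹‖ ≤ 1 := by
      rw [norm_inv, ← Nat.cast_succ, Complex.norm_natCast]
      exact inv_le_one_of_one_le₀ (by exact_mod_cast Nat.succ_pos L)
    refine (mul_le_of_le_one_left (norm_nonneg _) h2).trans
      ((norm_sum_le _ _).trans ((Finset.sum_le_sum fun i hi => ?_).trans (le_add_of_nonneg_left hB)))
    split_ifs with h'
    · rw [norm_smul, Complex.norm_natCast, norm_mul]
      gcongr
      · exact hc i hi
      · exact h c hc _ (by omega)
    · rw [norm_zero]; positivity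

/-- In E' - P'E the recursion cancels every term of degree below R. What remains are the products
that overshoot the truncation. -/
theorem sum_expCoeff_deriv (hr : ∀ i ∈ Λ, 1 ≤ r i) (c : ι → ℂ) (R : ℕ) (x : ℂ) :
    (∑ l ∈ Finset.range R, ((l : ℂ) + 1) * expCoeff Λ r c (l + 1) * x ^ l) -
      (∑ i ∈ Λ, c i * ((r i : ℂ) * x ^ (r i - 1))) *
        (∑ k ∈ Finset.range (R + 1), expCoeff Λ r c k * x ^ k) =
    -∑ i ∈ Λ, ∑ k ∈ Finset.range (R + 1), if R < k + r i then
      c i * r i * expCoeff Λ r c k * x ^ (k + r i - 1) else 0 := by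
  set e := expCoeff Λ r c with he
  have h1 : ∑ l ∈ Finset.range R, ((l : ℂ) + 1) * e (l + 1) * x ^ l =
      ∑ i ∈ Λ, ∑ k ∈ Finset.range (R + 1), if k + r i ≤ R then
        c i * r i * e k * x ^ (k + r i - 1) else 0 := by
    have : ∀ l ∈ Finset.range R, ((l : ℂ) + 1) * e (l + 1) * x ^ l = ∑ i ∈ Λ,
        if r i ≤ l + 1 then c i * r i * e (l + 1 - r i) * x ^ l else 0 := by
      intro l _
      have h := flow_eq hr (fun i u => c i * u) (1 : ℂ) (l + 1)
      rw [smul_eq_mul, Nat.cast_succ] at h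
      rw [he, expCoeff, h, Finset.sum_mul]
      refine Finset.sum_congr rfl fun i _ => ?_
      split_ifs
      · rw [smul_eq_mul]; ring
      · rw [zero_mul]
    rw [Finset.sum_congr rfl this, Finset.sum_comm]
    refine Finset.sum_congr rfl fun i hi => ?_
    have hri := hr i hi
    rw [← Finset.sum_filter, ← Finset.sum_filter]
    refine Finset.sum_nbij' (fun l => l + 1 - r i) (fun k => k + r i - 1) ?_ ?_ ?_ ?_ ?_
    · intro l hl
      rw [Finset.mem_filter, Finset.mem_range] at hl ⊢
      omega
    · intro k hk
      rw [Finset.mem_filter, Finset.mem_range] at hk ⊢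
      omega
    · intro l hl
      rw [Finset.mem_filter, Finset.mem_range] at hl
      omega
    · intro k hk
      rw [Finset.mem_filter, Finset.mem_range] at hk
      omega
    · intro l hl
      rw [Finset.mem_filter, Finset.mem_range] at hl
      rw [show l + 1 - r i + r i - 1 = l by omega]
  rw [h1, Finset.sum_mul, ← Finset.sum_sub_distrib, ← Finset.sum_neg_distrib]
  refine Finset.sum_congr rfl fun i hi => ?_
  have hri := hr i hi
  rw [Finset.mul_sum, ← Finset.sum_sub_distrib, ← Finset.sum_neg_distrib]
  refine Finset.sum_congr rfl fun k _ => ?_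
  have hx : x ^ (k + r i - 1) = x ^ (r i - 1) * x ^ k := by rw [← pow_add]; congr 1; omega
  by_cases h : k + r i ≤ R
  · rw [if_pos h, if_neg (by omega), hx]; ring
  · rw [if_neg h, if_pos (by omega), hx]; ring

/-- The function exp(-P)E equals 1 at 0, and its derivative exp(-P)(E' - P'E) is O(xᴿ) by
`sum_expCoeff_deriv`. The mean value inequality supplies the last power of x, and all constants
depend only on the bound for the exponents. -/
theorem exists_exp_remainder_bound (hr : ∀ i ∈ Λ, 1 ≤ r i) {C : ℝ} (hC : 0 ≤ C) (R : ℕ) :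
    ∃ B : ℝ, 0 ≤ B ∧ ∀ c : ι → ℂ, (∀ i ∈ Λ, ‖c i‖ ≤ C) →
      (∀ l ≤ R, ‖expCoeff Λ r c l‖ ≤ B) ∧ ∀ x : ℝ, 0 ≤ x → x ≤ 1 →
        ‖Complex.exp (∑ i ∈ Λ, c i * (x : ℂ) ^ r i) -
          ∑ k ∈ Finset.range (R + 1), expCoeff Λ r c k * (x : ℂ) ^ k‖ ≤ B * x ^ (R + 1) := by
  obtain ⟨B, hB, hBc⟩ := exists_expCoeff_bound Λ r hC R
  set A := Real.exp (Λ.card * C) with hA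
  set K := ∑ i ∈ Λ, ∑ _k ∈ Finset.range (R + 1), C * r i * B with hK
  have hK0 : 0 ≤ K := Finset.sum_nonneg fun i _ => Finset.sum_nonneg fun k _ => by positivity
  have hA0 : 0 < A := Real.exp_pos _
  refine ⟨B + A * (A * K), by positivity, fun c hc => ⟨fun l hl => (hBc c hc l hl).trans
    (le_add_of_nonneg_right (by positivity)), fun x hx0 hx1 => ?_⟩⟩
  set P : ℝ → ℂ := fun x => ∑ i ∈ Λ, c i * (x : ℂ) ^ r i with hP
  set E : ℝ → ℂ := fun x => ∑ k ∈ Finset.range (R + 1), expCoeff Λ r c k * (x : ℂ) ^ k with hE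
  set P' : ℝ → ℂ := fun x => ∑ i ∈ Λ, c i * ((r i : ℂ) * (x : ℂ) ^ (r i - 1)) with hP'
  set E' : ℝ → ℂ := fun x =>
    ∑ l ∈ Finset.range R, ((l : ℂ) + 1) * expCoeff Λ r c (l + 1) * (x : ℂ) ^ l with hE'
  have hpow : ∀ (k : ℕ) (x : ℝ), HasDerivAt (fun x : ℝ => (x : ℂ) ^ k)
      ((k : ℂ) * (x : ℂ) ^ (k - 1)) x := fun k x => by
    simpa using (hasDerivAt_pow k (x : ℂ)).comp_ofReal
  have hPd : ∀ x, HasDerivAt P (P' x) x := fun x =>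
    HasDerivAt.fun_sum fun i _ => (hpow (r i) x).const_mul (c i)
  have hEd : ∀ x, HasDerivAt E (E' x) x := fun x => by
    have h := HasDerivAt.fun_sum (u := Finset.range (R + 1)) fun k _ =>
      (hpow k x).const_mul (expCoeff Λ r c k)
    refine h.congr_deriv ?_
    rw [Finset.sum_range_succ']
    simp only [Nat.cast_zero, zero_mul, mul_zero, add_zero, hE', Nat.add_sub_cancel]
    exact Finset.sum_congr rfl fun k _ => by push_cast; ring
  have hPn : ∀ y : ℝ, 0 ≤ y → y ≤ 1 → ‖P y‖ ≤ Λ.card * C := by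
    intro y hy0 hy1
    refine (norm_sum_le _ _).trans ?_
    rw [← nsmul_eq_mul, ← Finset.sum_const]
    refine Finset.sum_le_sum fun i hi => ?_
    rw [norm_mul, norm_pow, Complex.norm_real, Real.norm_of_nonneg hy0]
    exact (mul_le_of_le_one_right (norm_nonneg _) (pow_le_one₀ hy0 hy1)).trans (hc i hi)
  have hexp : ∀ y : ℝ, 0 ≤ y → y ≤ 1 → ‖Complex.exp (P y)‖ ≤ A ∧ ‖Complex.exp (-P y)‖ ≤ A := by
    intro y hy0 hy1
    refine ⟨(Complex.norm_exp_le_exp_norm _).trans (Real.exp_le_exp.2 (hPn y hy0 hy1)),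
      (Complex.norm_exp_le_exp_norm _).trans (Real.exp_le_exp.2 ?_)⟩
    rw [norm_neg]; exact hPn y hy0 hy1
  have hdiff : ∀ y, HasDerivAt (fun y => Complex.exp (-P y) * E y)
      (Complex.exp (-P y) * (E' y - P' y * E y)) y := by
    intro y
    refine ((hPd y).fun_neg.cexp.mul (hEd y)).congr_deriv ?_
    ring
  have hbound : ∀ y ∈ Set.Ico 0 x, ‖Complex.exp (-P y) * (E' y - P' y * E y)‖ ≤
      A * (K * x ^ R) := by
    intro y hy
    have hy1 : y ≤ 1 := hy.2.le.trans hx1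
    rw [norm_mul]
    refine mul_le_mul (hexp y hy.1 hy1).2 ?_ (norm_nonneg _) hA0.le
    rw [sum_expCoeff_deriv hr c R (y : ℂ), norm_neg, hK, Finset.sum_mul]
    refine (norm_sum_le _ _).trans (Finset.sum_le_sum fun i hi => ?_)
    rw [Finset.sum_mul]
    refine (norm_sum_le _ _).trans (Finset.sum_le_sum fun k hk => ?_)
    rw [Finset.mem_range] at hk
    split_ifs with h
    · rw [norm_mul, norm_mul, norm_mul, Complex.norm_natCast, norm_pow, Complex.norm_real,
        Real.norm_of_nonneg hy.1]
      gcongr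
      · exact pow_nonneg hy.1 _
      · exact hc i hi
      · exact hBc c hc k (by omega)
      · exact (pow_le_pow_of_le_one hy.1 hy1 (show R ≤ k + r i - 1 by omega)).trans (pow_le_pow_left₀ hy.1 hy.2.le R)
    · rw [norm_zero]; positivity
  have hmv := norm_image_sub_le_of_norm_deriv_le_segment' (fun y _ => (hdiff y).hasDerivWithinAt)
    hbound x ⟨hx0, le_rfl⟩
  have h0 : Complex.exp (-P 0) * E 0 = 1 := by
    have hP0 : P 0 = 0 := Finset.sum_eq_zero fun i hi => by
      rw [Complex.ofReal_zero, zero_pow (by have := hr i hi; omega), mul_zero]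
    have hE0 : E 0 = 1 := by
      simp only [hE]
      rw [Finset.sum_range_succ', Finset.sum_eq_zero]
      · simp [expCoeff, flow_zero]
      · intro k _; simp
    rw [hP0, hE0, neg_zero, Complex.exp_zero, one_mul]
  rw [h0, sub_zero] at hmv
  have hfin : Complex.exp (P x) - E x =
      -(Complex.exp (P x) * (Complex.exp (-P x) * E x - 1)) := by
    rw [mul_sub, ← mul_assoc, ← Complex.exp_add, add_neg_cancel, Complex.exp_zero]; ring
  change ‖Complex.exp (P x) - E x‖ ≤ _
  rw [hfin, norm_neg, norm_mul]
  calc _ ≤ A * (A * (K * x ^ R) * x) := mul_le_mul (hexp x hx0 hx1).1 hmv (norm_nonneg _) hA0.le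
    _ = A * (A * K) * x ^ (R + 1) := by ring
    _ ≤ (B + A * (A * K)) * x ^ (R + 1) := by
      gcongr; exact le_add_of_nonneg_left hB

end ExpRemainder

/-! ### The symbol of a quantum thick morphism -/

section Symbol

variable {n₁ n : ℕ} {M₁ : Type*} [TopologicalSpace M₁]
  [ChartedSpace (EuclideanSpace ℝ (Fin n₁)) M₁] {M₂ : Set (Coord n)}

theorem sum_finsuppAntidiag_one (f : (Fin n →₀ ℕ) → ℂ) :
    ∑ α ∈ Finset.finsuppAntidiag (Finset.univ : Finset (Fin n)) 1, f α =
      ∑ i, f (Finsupp.single i 1) := by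
  symm
  refine Finset.sum_bij (fun i _ => Finsupp.single i 1) ?_ ?_ ?_ fun _ _ => rfl
  · intro i _
    simp [Finset.mem_finsuppAntidiag, Finsupp.single_apply]
  · intro i _ j _ h
    exact Finsupp.single_left_injective one_ne_zero h
  · intro α hα
    obtain ⟨i, rfl⟩ := exists_eq_single_of_degree_eq_one (α := α) (by
      rw [Finsupp.degree_eq_sum]; exact (Finset.mem_finsuppAntidiag.1 hα).1)
    exact ⟨i, Finset.mem_univ _, rfl⟩

variable (S : QuantumGeneratingFunction n₁ M₁ M₂)

theorem partialSum_eq (N : ℕ) (ħ : ℝ) (x : M₁) (q : Coord n) : S.partialSum N ħ x q =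
    ∑ i ∈ hIndexLT n N, S.coeff i.1 i.2 x * (ħ : ℂ) ^ i.1 * ((∏ j, q j ^ i.2 j : ℝ) : ℂ) := by
  have hdeg : ∀ α : Fin n →₀ ℕ, α.degree = ∑ i, α i := fun α => Finsupp.degree_eq_sum α
  unfold QuantumGeneratingFunction.partialSum
  simp only [Finset.sum_sigma']
  refine Finset.sum_nbij' (fun p => (p.1, p.2.2)) (fun i => ⟨i.1, i.2.degree, i.2⟩) ?_ ?_ ?_ ?_ ?_
  · rintro ⟨m, k, α⟩ h
    simp only [Finset.mem_sigma, Finset.mem_range, Finset.mem_finsuppAntidiag, ← hdeg] at h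
    rw [mem_hIndexLT]
    simp only
    omega
  · rintro ⟨m, α⟩ h
    rw [mem_hIndexLT] at h
    simp only at h
    simp only [Finset.mem_sigma, Finset.mem_range, Finset.mem_finsuppAntidiag, ← hdeg]
    refine ⟨by omega, by omega, ?_⟩
    simp
  · rintro ⟨m, k, α⟩ h
    simp only [Finset.mem_sigma, Finset.mem_range, Finset.mem_finsuppAntidiag, ← hdeg] at h
    obtain ⟨_, _, rfl, _⟩ := h
    rfl
  · rintro ⟨m, α⟩ _
    rfl
  · rintro ⟨m, k, α⟩ _
    rfl

theorem partialSum_two (ħ : ℝ) (x : M₁) (q : Coord n) : S.partialSum 2 ħ x q =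
    S.coeff 0 0 x + S.coeff 1 0 x * ħ + (pairing (S.base x) q : ℂ) := by
  have h1 : ∀ i, S.coeff 0 (Finsupp.single i 1) x * ((q i : ℝ) : ℂ) =
      ((S.base x i * q i : ℝ) : ℂ) := fun i => by
    rw [Complex.ofReal_mul]
    congr 1
    apply Complex.ext
    · simp [QuantumGeneratingFunction.base]
    · simpa using S.classical_real (Finsupp.single i 1) x
  have h2 : ∀ i : Fin n, ∏ j, q j ^ (Finsupp.single i 1 : Fin n →₀ ℕ) j = q i := fun i => by
    rw [Finset.prod_eq_single i]
    · simp
    · intro j _ hj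
      simp [hj.symm]
    · simp
  unfold QuantumGeneratingFunction.partialSum
  rw [Finset.sum_range_succ, Finset.sum_range_one, Finset.sum_range_succ, Finset.sum_range_one,
    show 2 - 1 = 1 from rfl, Finset.sum_range_one, sum_finsuppAntidiag_one,
    Finset.finsuppAntidiag_zero]
  simp only [Finset.sum_singleton, pow_zero, mul_one, h2, h1, Finsupp.coe_zero, Pi.zero_apply,
    Finset.prod_const_one, Complex.ofReal_one, pow_one, pairing, Complex.ofReal_sum]
  ring

/-- The exponents `i S_{m,α}(x) ξ^α`. -/
def symbolCoeff (x : M₁) (ξ : Coord n) (i : HIndex n) : ℂ :=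
  Complex.I * (S.coeff i.1 i.2 x * ((∏ j, ξ j ^ i.2 j : ℝ) : ℂ))

/-- `exp (i F_ħ(x, ħξ) / ħ)`, without the contribution of the terms of degree at most one. -/
def normalizedSymbol (F : ℝ → M₁ → Coord n → ℂ) (ħ : ℝ) (x : M₁) (ξ : Coord n) : ℂ :=
  Complex.exp (Complex.I / (ħ : ℂ) * F ħ x (ħ • ξ)) *
    Complex.exp (-(Complex.I / (ħ : ℂ) * S.coeff 0 0 x) - Complex.I * S.coeff 1 0 x -
      Complex.I * (pairing (S.base x) ξ : ℂ))

/-- After q = ħξ and division by ħ the degrees 0 and 1 separate: a scalar and the pairing with φ(x).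
All other terms carry a positive power of ħ. -/
theorem partialSum_smul (R : ℕ) {ħ : ℝ} (hħ : ħ ≠ 0) (x : M₁) (ξ : Coord n) :
    Complex.I / (ħ : ℂ) * S.partialSum (R + 2) ħ x (ħ • ξ) =
      Complex.I / (ħ : ℂ) * S.coeff 0 0 x + Complex.I * S.coeff 1 0 x +
      Complex.I * (pairing (S.base x) ξ : ℂ) +
      ∑ i ∈ higherIndex n R, symbolCoeff S x ξ i * (ħ : ℂ) ^ weight i := by
  have hħ' : (ħ : ℂ) ≠ 0 := Complex.ofReal_ne_zero.2 hħ
  have hsplit : S.partialSum (R + 2) ħ x (ħ • ξ) = S.partialSum 2 ħ x (ħ • ξ) +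
      ∑ i ∈ higherIndex n R, S.coeff i.1 i.2 x * (ħ : ℂ) ^ i.1 *
        ((∏ j, (ħ • ξ) j ^ i.2 j : ℝ) : ℂ) := by
    rw [partialSum_eq, partialSum_eq, higherIndex,
      ← Finset.sum_filter_add_sum_filter_not (hIndexLT n (R + 2)) fun i => 2 ≤ i.1 + i.2.degree,
      add_comm]
    congr 1
    refine Finset.sum_congr ?_ fun _ _ => rfl
    ext i
    simp only [Finset.mem_filter, mem_hIndexLT]
    omega
  have hpair : pairing (S.base x) (ħ • ξ) = ħ * pairing (S.base x) ξ := by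
    simp only [pairing, PiLp.smul_apply, smul_eq_mul, Finset.mul_sum]
    exact Finset.sum_congr rfl fun i _ => by ring
  rw [hsplit, partialSum_two, hpair, mul_add, Finset.mul_sum]
  congr 1
  · push_cast
    field_simp
  · refine Finset.sum_congr rfl fun i hi => ?_
    have hw : i.1 + i.2.degree = weight i + 1 := by
      have := (mem_higherIndex.1 hi).2; unfold weight; omega
    have hprod : ∏ j, (ħ • ξ) j ^ i.2 j = ħ ^ i.2.degree * ∏ j, ξ j ^ i.2 j := by
      rw [Finsupp.degree_eq_sum, ← Finset.prod_pow_eq_pow_sum, ← Finset.prod_mul_distrib]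
      exact Finset.prod_congr rfl fun j _ => by rw [PiLp.smul_apply, smul_eq_mul, mul_pow]
    rw [hprod, symbolCoeff]
    push_cast
    have hpow : (ħ : ℂ) ^ i.1 * (ħ : ℂ) ^ i.2.degree = ħ ^ weight i * ħ := by
      rw [← pow_add, hw, pow_succ]
    calc _ = Complex.I / ħ * (S.coeff i.1 i.2 x * (∏ j, (ξ j : ℂ) ^ i.2 j) *
          ((ħ : ℂ) ^ i.1 * (ħ : ℂ) ^ i.2.degree)) := by ring
      _ = _ := by rw [hpow]; field_simp

/-- For m + |α| ≥ 2 one has |α| ≤ 2(m + |α| - 1), so the growth in ξ is controlled by the weight.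
This is why ħ(1 + ‖ξ‖)² is the natural small quantity. -/
theorem norm_symbolCoeff_le (x : M₁) (ξ : Coord n) {i : HIndex n} (hi : 2 ≤ i.1 + i.2.degree) :
    ‖symbolCoeff S x ξ i‖ ≤ ‖S.coeff i.1 i.2 x‖ * ((1 + ‖ξ‖) ^ 2) ^ weight i := by
  rw [symbolCoeff, norm_mul, Complex.norm_I, one_mul, norm_mul, Complex.norm_real]
  refine mul_le_mul_of_nonneg_left ?_ (norm_nonneg _)
  rw [norm_prod, ← pow_mul]
  have h1 : 1 ≤ 1 + ‖ξ‖ := le_add_of_nonneg_right (norm_nonneg _)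
  calc ∏ j, ‖ξ j ^ i.2 j‖ ≤ ∏ j, (1 + ‖ξ‖) ^ i.2 j := by
        refine Finset.prod_le_prod (fun _ _ => norm_nonneg _) fun j _ => ?_
        rw [norm_pow]
        refine pow_le_pow_left₀ (norm_nonneg _) ?_ _
        exact (PiLp.norm_apply_le ξ j).trans (le_add_of_nonneg_left zero_le_one)
    _ = (1 + ‖ξ‖) ^ i.2.degree := by rw [Finset.prod_pow_eq_pow_sum, Finsupp.degree_eq_sum]
    _ ≤ _ := pow_le_pow_right₀ h1 (by unfold weight; omega)

theorem eventually_norm_coeff_le (x₀ : M₁) (Λ : Finset (HIndex n)) :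
    ∃ C : ℝ, 0 ≤ C ∧ ∀ᶠ x in 𝓝 x₀, ∀ i ∈ Λ, ‖S.coeff i.1 i.2 x‖ ≤ C := by
  refine ⟨∑ i ∈ Λ, (‖S.coeff i.1 i.2 x₀‖ + 1),
    Finset.sum_nonneg fun i _ => by positivity, ?_⟩
  rw [Filter.eventually_all_finset]
  intro i hi
  have h := ((S.contMDiff_coeff i.1 i.2).continuous.norm.continuousAt (x := x₀)).eventually_lt
    (continuousAt_const (y := ‖S.coeff i.1 i.2 x₀‖ + 1)) (lt_add_one _)
  filter_upwards [h] with x hx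
  exact hx.le.trans (Finset.single_le_sum (f := fun i : HIndex n => ‖S.coeff i.1 i.2 x₀‖ + 1)
    (fun i _ => by positivity) hi)

variable {S}

/-- Let e = ħ(1 + ‖ξ‖)². For e ≤ 1 the momentum ħξ is small, the expansion of F applies, and the
rescaled exponents are bounded. For e > 1 the boundedness of exp(iF/ħ) suffices, because e^{R+1} ≥ 1
dominates the symbol and every term of the sum. -/
theorem exists_symbol_bound {F : ℝ → M₁ → Coord n → ℂ} (hF : S.IsRepresentedBy F) (x₀ : M₁)
    (R : ℕ) : ∃ C : ℝ, ∀ᶠ p : ℝ × M₁ in 𝓝[>] 0 ×ˢ 𝓝 x₀, ∀ ξ : Coord n,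
      ‖normalizedSymbol S F p.1 p.2 ξ - ∑ l ∈ Finset.range (R + 1),
        expCoeff (higherIndex n R) weight (symbolCoeff S p.2 ξ) l * (p.1 : ℂ) ^ l‖ ≤
      C * (p.1 * (1 + ‖ξ‖) ^ 2) ^ (R + 1) := by
  -- The index (1, 0) is included because the normalizing factor has modulus exp(Im S_{1,0}),
  -- S_{0,0} being real.
  obtain ⟨Cs, hCs0, hCs⟩ := eventually_norm_coeff_le S x₀ (insert (1, 0) (higherIndex n R))
  obtain ⟨Cb, hCb⟩ := hF.bounded x₀
  obtain ⟨B, hB0, hB⟩ := exists_exp_remainder_bound (Λ := higherIndex n R) (r := weight)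
    (fun i hi => by have := (mem_higherIndex.1 hi).2; unfold weight; omega) hCs0 R
  -- Order R + 2 is needed, since the factor 1/ħ in the exponent costs one order.
  obtain ⟨K, hK0, hK⟩ := (hF.expansion x₀ (R + 2)).exists_pos
  have hexp := hK.bound
  rw [eventually_prod_iff] at hexp
  obtain ⟨pa, hpa, pb, hpb, hpab⟩ := hexp
  rw [eventually_prod_iff] at hpb
  obtain ⟨pc, hpc, pd, hpd, hpcd⟩ := hpb
  obtain ⟨ε, hε, hpd⟩ := Metric.eventually_nhds_iff.1 hpd
  set N : ℝ := (R : ℝ) + 1 with hN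
  refine ⟨(B + (N * B + B) * (K * Real.exp K)) + (|Cb| * Real.exp Cs + N * B), ?_⟩
  -- For e ≤ 1 one has (ħ‖ξ‖)² ≤ ħ, so ħ < ε² places ħξ in the ball where the expansion holds.
  have hsmall : ∀ᶠ ħ : ℝ in 𝓝[>] 0, 0 < ħ ∧ ħ < ε ^ 2 := by
    filter_upwards [self_mem_nhdsWithin, nhdsWithin_le_nhds (Iio_mem_nhds (by positivity :
      (0 : ℝ) < ε ^ 2))] with ħ h1 h2
    exact ⟨h1, h2⟩
  filter_upwards [hCb, (hsmall.and hpa).prod_mk (hCs.and hpc)]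
    with ⟨ħ, x⟩ hbd ⟨⟨⟨hħ, hħε⟩, hpaħ⟩, hcx, hpcx⟩ ξ
  simp only at hbd hħ hħε hpaħ hcx hpcx ⊢
  set V : ℝ := 1 + ‖ξ‖ with hV
  have hV1 : 1 ≤ V := le_add_of_nonneg_right (norm_nonneg _)
  have hV0 : 0 < V := zero_lt_one.trans_le hV1
  set c := symbolCoeff S x ξ with hc
  set e : ℝ := ħ * V ^ 2 with he
  have he0 : 0 < e := by positivity
  set c' : HIndex n → ℂ := fun i => c i / ((V ^ 2 : ℝ) : ℂ) ^ weight i with hc'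
  have hVc : ((V ^ 2 : ℝ) : ℂ) ≠ 0 := Complex.ofReal_ne_zero.2 (by positivity)
  have hcc' : c = fun i => ((V ^ 2 : ℝ) : ℂ) ^ weight i * c' i := by
    funext i
    rw [hc', mul_div_cancel₀]
    exact pow_ne_zero _ hVc
  have hc'n : ∀ i ∈ higherIndex n R, ‖c' i‖ ≤ Cs := by
    intro i hi
    rw [hc', norm_div, norm_pow, Complex.norm_real, Real.norm_of_nonneg (by positivity),
      div_le_iff₀ (by positivity)]
    exact (norm_symbolCoeff_le S x ξ (mem_higherIndex.1 hi).2).trans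
      (mul_le_mul_of_nonneg_right (hcx i (Finset.mem_insert_of_mem hi)) (by positivity))
  obtain ⟨hl, hrem⟩ := hB c' hc'n
  have hec : (e : ℂ) = ((V ^ 2 : ℝ) : ℂ) * ħ := by rw [he]; push_cast; ring
  have hsum : ∀ l, expCoeff (higherIndex n R) weight c l * (ħ : ℂ) ^ l =
      expCoeff (higherIndex n R) weight c' l * (e : ℂ) ^ l := by
    intro l
    rw [hcc', expCoeff_smul, hec]
    ring
  have hP : ∑ i ∈ higherIndex n R, c i * (ħ : ℂ) ^ weight i =
      ∑ i ∈ higherIndex n R, c' i * (e : ℂ) ^ weight i := by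
    refine Finset.sum_congr rfl fun i _ => ?_
    rw [hcc', hec]
    ring
  rw [Finset.sum_congr rfl fun l _ => hsum l]
  set E : ℂ := ∑ l ∈ Finset.range (R + 1), expCoeff (higherIndex n R) weight c' l * (e : ℂ) ^ l
    with hE
  set P : ℂ := ∑ i ∈ higherIndex n R, c' i * (e : ℂ) ^ weight i with hPdef
  have hterm : ∀ T : ℝ, 0 ≤ T → (∀ l ≤ R, e ^ l ≤ T) → ‖E‖ ≤ N * B * T := by
    intro T hT0 hT
    refine (norm_sum_le _ _).trans ?_
    have : N * B * T = ∑ _l ∈ Finset.range (R + 1), B * T := by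
      rw [Finset.sum_const, Finset.card_range, nsmul_eq_mul, hN]; push_cast; ring
    rw [this]
    refine Finset.sum_le_sum fun l hlR => ?_
    have hlR : l ≤ R := Nat.lt_succ_iff.1 (Finset.mem_range.1 hlR)
    rw [norm_mul, norm_pow, Complex.norm_real, Real.norm_of_nonneg he0.le]
    exact mul_le_mul (hl l hlR) (hT l hlR) (by positivity) hB0
  have hN0 : 0 ≤ N := by positivity
  rcases le_or_gt e 1 with he1 | he1
  · -- the region in which the expansion of `F` applies
    have hq : ‖ħ • ξ‖ < ε := by
      rw [norm_smul, Real.norm_of_nonneg hħ.le]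
      refine lt_of_pow_lt_pow_left₀ 2 hε.le (lt_of_le_of_lt ?_ hħε)
      calc (ħ * ‖ξ‖) ^ 2 = ħ * (ħ * ‖ξ‖ ^ 2) := by ring
        _ ≤ ħ * e := by
          rw [he]; gcongr; exact le_add_of_nonneg_left zero_le_one
        _ ≤ ħ := mul_le_of_le_one_right hħ.le he1
    have hF' := hpab hpaħ (hpcd hpcx (hpd (by rwa [dist_zero_right])))
    simp only at hF'
    set ρ : ℂ := Complex.I / (ħ : ℂ) * (F ħ x (ħ • ξ) - S.partialSum (R + 2) ħ x (ħ • ξ)) with hρ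
    have hρn : ‖ρ‖ ≤ K * e ^ (R + 1) := by
      rw [hρ, norm_mul, norm_div, Complex.norm_I, Complex.norm_real, Real.norm_of_nonneg hħ.le]
      have h1 : ‖(ħ + ‖ħ • ξ‖) ^ (R + 2)‖ = ħ * (ħ ^ (R + 1) * V ^ (R + 2)) := by
        rw [norm_smul, Real.norm_of_nonneg hħ.le, ← mul_one_add, ← hV,
          Real.norm_of_nonneg (by positivity)]
        rw [mul_pow, pow_succ' ħ (R + 1), mul_assoc]
      rw [h1] at hF'
      calc 1 / ħ * ‖F ħ x (ħ • ξ) - S.partialSum (R + 2) ħ x (ħ • ξ)‖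
          ≤ 1 / ħ * (K * (ħ * (ħ ^ (R + 1) * V ^ (R + 2)))) := by gcongr
        _ = K * (ħ ^ (R + 1) * V ^ (R + 2)) := by field_simp
        _ ≤ K * (ħ ^ (R + 1) * V ^ (2 * (R + 1))) := by
          gcongr 2
          exact pow_le_pow_right₀ hV1 (by omega)
        _ = K * e ^ (R + 1) := by rw [he, mul_pow, ← pow_mul]
    have hsym : normalizedSymbol S F ħ x ξ = Complex.exp P * Complex.exp ρ := by
      rw [normalizedSymbol, ← Complex.exp_add, ← Complex.exp_add, hρ, mul_sub,
        partialSum_smul S R hħ.ne', ← hc, hP]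
      congr 1
      ring
    have hexpρ : ‖Complex.exp ρ - 1‖ ≤ K * Real.exp K * e ^ (R + 1) := by
      have h := Complex.norm_exp_sub_sum_le_norm_mul_exp ρ 1
      simp only [Finset.sum_range_one, pow_zero, Nat.factorial_zero, Nat.cast_one, div_one,
        pow_one] at h
      have hρK : ‖ρ‖ ≤ K := hρn.trans (mul_le_of_le_one_right hK0.le (pow_le_one₀ he0.le he1))
      calc _ ≤ ‖ρ‖ * Real.exp ‖ρ‖ := h
        _ ≤ (K * e ^ (R + 1)) * Real.exp K := by gcongr
        _ = _ := by ring
    have hPE : ‖Complex.exp P - E‖ ≤ B * e ^ (R + 1) := hrem e he0.le he1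
    have hexpP : ‖Complex.exp P‖ ≤ N * B + B := by
      have h1 : ‖E‖ ≤ N * B * 1 := hterm 1 zero_le_one fun l _ => pow_le_one₀ he0.le he1
      have h2 : B * e ^ (R + 1) ≤ B := mul_le_of_le_one_right hB0 (pow_le_one₀ he0.le he1)
      calc ‖Complex.exp P‖ = ‖E + (Complex.exp P - E)‖ := by rw [add_sub_cancel]
        _ ≤ ‖E‖ + ‖Complex.exp P - E‖ := norm_add_le _ _
        _ ≤ _ := by linarith
    calc ‖normalizedSymbol S F ħ x ξ - E‖
        = ‖(Complex.exp P - E) + Complex.exp P * (Complex.exp ρ - 1)‖ := by rw [hsym]; congr 1; ring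
      _ ≤ ‖Complex.exp P - E‖ + ‖Complex.exp P‖ * ‖Complex.exp ρ - 1‖ :=
        (norm_add_le _ _).trans_eq (by rw [norm_mul])
      _ ≤ B * e ^ (R + 1) + (N * B + B) * (K * Real.exp K * e ^ (R + 1)) := by gcongr
      _ = (B + (N * B + B) * (K * Real.exp K)) * e ^ (R + 1) := by ring
      _ ≤ _ := mul_le_mul_of_nonneg_right (le_add_of_nonneg_right (by positivity)) (by positivity)
  · have hone : 1 ≤ e ^ (R + 1) := one_le_pow₀ he1.le
    have hEn : ‖E‖ ≤ N * B * e ^ (R + 1) := hterm _ (by positivity) fun l hlR =>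
      pow_le_pow_right₀ he1.le (by omega)
    have hsym : ‖normalizedSymbol S F ħ x ξ‖ ≤ |Cb| * Real.exp Cs := by
      rw [normalizedSymbol, norm_mul, Complex.norm_exp (_ - _ - _)]
      refine mul_le_mul ((hbd _).trans (le_abs_self _)) (Real.exp_le_exp.2 ?_) (Real.exp_pos _).le
        (abs_nonneg _)
      have h0 : (-(Complex.I / (ħ : ℂ) * S.coeff 0 0 x) - Complex.I * S.coeff 1 0 x -
          Complex.I * (pairing (S.base x) ξ : ℂ)).re = (S.coeff 1 0 x).im := by
        have h00 : S.coeff 0 0 x = ((S.coeff 0 0 x).re : ℂ) :=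
          Complex.ext rfl (S.classical_real 0 x)
        rw [h00, div_mul_eq_mul_div, mul_comm Complex.I, mul_div_right_comm, ← Complex.ofReal_div]
        simp
      rw [h0]
      exact (Complex.im_le_norm _).trans (hcx (1, 0) (Finset.mem_insert_self _ _))
    calc ‖normalizedSymbol S F ħ x ξ - E‖ ≤ ‖normalizedSymbol S F ħ x ξ‖ + ‖E‖ := norm_sub_le _ _
      _ ≤ |Cb| * Real.exp Cs * e ^ (R + 1) + N * B * e ^ (R + 1) :=
        add_le_add (hsym.trans (le_mul_of_one_le_right (by positivity) hone)) hEn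
      _ = (|Cb| * Real.exp Cs + N * B) * e ^ (R + 1) := by ring
      _ ≤ _ := mul_le_mul_of_nonneg_right (le_add_of_nonneg_left (by positivity)) (by positivity)

end Symbol

/-! ### The quantum pullback of Schwartz functions -/

section Fourier

open scoped SchwartzMap FourierTransform LineDeriv

variable {n₁ n : ℕ} {M₁ : Type*} [TopologicalSpace M₁]
  [ChartedSpace (EuclideanSpace ℝ (Fin n₁)) M₁] {M₂ : Set (Coord n)}

theorem pairing_eq_inner (y q : Coord n) : pairing y q = inner ℝ y q := by
  rw [pairing, PiLp.inner_apply]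
  exact Finset.sum_congr rfl fun i _ => by simp [mul_comm]

theorem pairing_smul (y q : Coord n) (c : ℝ) : pairing y (c • q) = c * pairing y q := by
  rw [pairing_eq_inner, pairing_eq_inner, inner_smul_right]

theorem continuous_pairing (y : Coord n) : Continuous (pairing y) := by
  unfold pairing; fun_prop

theorem norm_exp_I_mul_ofReal (r : ℝ) : ‖Complex.exp (Complex.I * (r : ℂ))‖ = 1 := by
  rw [mul_comm, Complex.norm_exp_ofReal_mul_I]

theorem fourier_apply_eq (w : 𝓢(Coord n, ℂ)) (ζ : Coord n) : 𝓕 w ζ =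
    ∫ y, Complex.exp (-(Complex.I * ((2 * Real.pi * pairing y ζ : ℝ) : ℂ))) * w y := by
  rw [SchwartzMap.fourier_coe, Real.fourier_eq']
  refine integral_congr_ae (ae_of_all _ fun y => ?_)
  simp only [smul_eq_mul, pairing_eq_inner]
  congr 2
  push_cast
  ring

theorem integral_exp_mul_fourier (w : 𝓢(Coord n, ℂ)) (y : Coord n) :
    ∫ ζ, Complex.exp (Complex.I * (pairing y ((2 * Real.pi) • ζ) : ℂ)) * 𝓕 w ζ = w y := by
  have h : 𝓕⁻ (𝓕 w) = w := FourierTransform.fourierInv_fourier_eq w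
  conv_rhs => rw [← h]
  rw [SchwartzMap.fourierInv_coe, Real.fourierInv_eq']
  refine integral_congr_ae (ae_of_all _ fun ζ => ?_)
  simp only [smul_eq_mul, pairing_smul, real_inner_comm y ζ, ← pairing_eq_inner]
  congr 2
  push_cast
  ring

section Pullback

variable {X : Type*} {F : ℝ → X → Coord n → ℂ} {ħ : ℝ} {x : X} {w : 𝓢(Coord n, ℂ)}

theorem exp_sub_pairing (c : ℂ) (y q : Coord n) :
    Complex.exp (Complex.I / (ħ : ℂ) * (c - (pairing y q : ℂ))) =
      Complex.exp (Complex.I / (ħ : ℂ) * c) *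
        Complex.exp (-(Complex.I * ((pairing y q / ħ : ℝ) : ℂ))) := by
  rw [← Complex.exp_add]
  congr 1
  push_cast
  ring

theorem fibreIntegral_eq (hw : Function.support w ⊆ M₂) (q : Coord n) :
    fibreIntegral M₂ F ħ w x q =
      Complex.exp (Complex.I / (ħ : ℂ) * F ħ x q) * 𝓕 w ((2 * Real.pi * ħ)⁻¹ • q) := by
  rw [fibreIntegral, setIntegral_eq_integral_of_forall_compl_eq_zero, fourier_apply_eq,
    ← integral_const_mul]
  · refine integral_congr_ae (ae_of_all _ fun y => ?_)
    simp only
    rw [exp_sub_pairing, mul_assoc, pairing_smul]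
    congr 5
    rw [mul_inv]
    field_simp [Real.pi_ne_zero]
  · intro y hy
    rw [Function.notMem_support.1 fun h => hy (hw h), mul_zero]

variable {C : ℝ} (hF : Continuous (F ħ x))
  (hC : ∀ q, ‖Complex.exp (Complex.I / (ħ : ℂ) * F ħ x q)‖ ≤ C)

include hF hC

theorem quantumPullbackConverges (hw : Function.support w ⊆ M₂) (hħ : ħ ≠ 0) :
    QuantumPullbackConverges M₂ F ħ w x := by
  have hπ := Real.pi_ne_zero
  refine ⟨fun q => Integrable.integrableOn ?_, ?_⟩
  · simp only [exp_sub_pairing, mul_assoc]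
    refine Integrable.const_mul ?_ _
    refine w.integrable.bdd_mul (c := 1) (Continuous.aestronglyMeasurable ?_)
      (ae_of_all _ fun y => ?_)
    · unfold pairing; fun_prop
    · rw [← mul_neg, ← Complex.ofReal_neg, norm_exp_I_mul_ofReal]
  · rw [show fibreIntegral M₂ F ħ w x = _ from funext fun q => fibreIntegral_eq hw q]
    refine Integrable.bdd_mul (c := C) ?_ (Continuous.aestronglyMeasurable ?_)
      (ae_of_all _ hC)
    · exact (𝓕 w).integrable.comp_smul (inv_ne_zero (by positivity))
    · fun_prop

theorem integrable_exp_mul_fourier : Integrable fun ζ : Coord n =>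
    Complex.exp (Complex.I / (ħ : ℂ) * F ħ x (ħ • (2 * Real.pi) • ζ)) * 𝓕 w ζ :=
  Integrable.bdd_mul (c := C) (𝓕 w).integrable
    (Continuous.aestronglyMeasurable (by fun_prop)) (ae_of_all _ fun _ => hC _)

omit hF hC

/-- The substitution q = 2πħζ matches the normalization of the Fourier transform and absorbs the
factor (2πħ)^{-n} exactly. The variable ξ used for symbols is 2πζ. -/
theorem quantumPullback_eq (hw : Function.support w ⊆ M₂) (hħ : 0 < ħ) :
    quantumPullback M₂ F ħ w x =
      ∫ ζ, Complex.exp (Complex.I / (ħ : ℂ) * F ħ x (ħ • (2 * Real.pi) • ζ)) * 𝓕 w ζ := by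
  have hπ := Real.pi_pos
  have h0 : 2 * Real.pi * ħ ≠ 0 := by positivity
  have h := Measure.integral_comp_smul volume (fibreIntegral M₂ F ħ w x) (2 * Real.pi * ħ)
  rw [finrank_euclideanSpace_fin, abs_of_pos (by positivity)] at h
  rw [quantumPullback, one_div, ← Complex.ofReal_inv, ← Complex.real_smul, ← h]
  refine integral_congr_ae (ae_of_all _ fun ζ => ?_)
  simp only
  rw [fibreIntegral_eq hw, inv_smul_smul₀ h0, smul_smul, mul_comm ħ]

end Pullback

/-! ### Differential operators on Schwartz functions -/

theorem fourier_multiDeriv (α : Fin n →₀ ℕ) (w : 𝓢(Coord n, ℂ)) (ζ : Coord n) :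
    𝓕 (multiDeriv (fun i (v : 𝓢(Coord n, ℂ)) => ∂_{(EuclideanSpace.single i 1 : Coord n)} v) α w) ζ
      = (∏ j, (Complex.I * (((2 * Real.pi) • ζ) j : ℂ)) ^ α j) * 𝓕 w ζ := by
  refine multiDeriv_induction (C := fun β (v : 𝓢(Coord n, ℂ)) => 𝓕 v ζ =
    (∏ j, (Complex.I * (((2 * Real.pi) • ζ) j : ℂ)) ^ β j) * 𝓕 w ζ) (by simp) ?_ α
  intro i β v hv
  have hg : (inner ℝ · (EuclideanSpace.single i 1 : Coord n)).HasTemperateGrowth :=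
    ((innerSL ℝ).flip (EuclideanSpace.single i 1 : Coord n)).hasTemperateGrowth
  have hprod : ∏ j, (Complex.I * (((2 * Real.pi) • ζ) j : ℂ)) ^ (β + Finsupp.single i 1 : Fin n →₀ ℕ) j =
      (Complex.I * (((2 * Real.pi) • ζ) i : ℂ)) *
        ∏ j, (Complex.I * (((2 * Real.pi) • ζ) j : ℂ)) ^ β j := by
    simp only [Finsupp.add_apply, pow_add, Finset.prod_mul_distrib]
    rw [mul_comm, Finset.prod_eq_single i]
    · simp
    · intro j _ hj; simp [hj.symm]
    · simp
  rw [SchwartzMap.fourier_lineDerivOp_eq, smul_apply,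
    SchwartzMap.smulLeftCLM_apply_apply hg, hv, hprod]
  simp only [EuclideanSpace.inner_single_right, PiLp.smul_apply, smul_eq_mul, Complex.real_smul]
  simp
  ring

variable (S : QuantumGeneratingFunction n₁ M₁ M₂)

/-- The operators `c_l` in the expansion `∑ ħ^l c_l` of the reduced quantum pullback. -/
def schwartzFlow (R : ℕ) (x : M₁) (w : 𝓢(Coord n, ℂ)) : ℕ → 𝓢(Coord n, ℂ) :=
  flow (higherIndex n R) weight (diffOp
    (fun i (v : 𝓢(Coord n, ℂ)) => ∂_{(EuclideanSpace.single i 1 : Coord n)} v)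
    fun i => Complex.I * (-Complex.I) ^ i.2.degree * S.coeff i.1 i.2 x) w

/-- The Fourier transform replaces ∂^α by (iξ)^α, and the factor (-i)^{|α|} in the operator was
chosen to cancel i^{|α|}. -/
theorem fourier_schwartzFlow (R : ℕ) (x : M₁) (w : 𝓢(Coord n, ℂ)) (l : ℕ) (ζ : Coord n) :
    𝓕 (schwartzFlow S R x w l) ζ = expCoeff (higherIndex n R) weight
      (symbolCoeff S x ((2 * Real.pi) • ζ)) l * 𝓕 w ζ := by
  refine flow_rel (C := fun (v : 𝓢(Coord n, ℂ)) (c : ℂ) => 𝓕 v ζ = c * 𝓕 w ζ)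
    ?_ ?_ ?_ ?_ ?_ l
  · rw [zero_mul, show 𝓕 (0 : 𝓢(Coord n, ℂ)) = 0 from FourierTransform.fourier_zero ..]
    rfl
  · intro u v u' v' hu hv
    rw [FourierTransform.fourier_add, add_apply, hu, hv, add_mul]
  · intro c u u' hu
    rw [FourierTransform.fourier_smul, smul_apply, hu, smul_eq_mul, smul_eq_mul,
      mul_assoc]
  · intro i _ u u' hu
    rw [diffOp, FourierTransform.fourier_smul, smul_apply, fourier_multiDeriv, hu,
      symbolCoeff, smul_eq_mul, Finset.prod_congr rfl fun j _ => mul_pow _ _ _,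
      Finset.prod_mul_distrib, Finset.prod_pow_eq_pow_sum, ← Finsupp.degree_eq_sum]
    have hI : (-Complex.I) ^ i.2.degree * Complex.I ^ i.2.degree = 1 := by
      rw [← mul_pow, neg_mul, Complex.I_mul_I, neg_neg, one_pow]
    push_cast
    linear_combination (Complex.I * S.coeff i.1 i.2 x *
      (∏ j, (((2 * Real.pi) • ζ) j : ℂ) ^ i.2 j) * u' * 𝓕 w ζ) * hI
  · rw [one_mul]

variable {S}

/-- Differential operators are local, so equality on an open set is preserved by the flow. This
makes the cutoff invisible where it equals 1. -/
theorem schwartzFlow_eq_jetEval (hM₂ : IsOpen M₂) {g : Coord n → ℝ} (hg : ContDiffOn ℝ ∞ g M₂)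
    (R : ℕ) (x : M₁) {O : Set (Coord n)} (hO : IsOpen O) (hOM : O ⊆ M₂) {w : 𝓢(Coord n, ℂ)}
    {u : JetRing n} (hw : ∀ y ∈ O, w y = jetEval S g x y u) (l : ℕ) :
    ∀ y ∈ O, schwartzFlow S R x w l y = jetEval S g x y
      (flow (higherIndex n R) weight (diffOp (fun i => jetDeriv i) coeffVar) u l) := by
  refine flow_rel (C := fun (v : 𝓢(Coord n, ℂ)) u => ∀ y ∈ O, v y = jetEval S g x y u)
    ?_ ?_ ?_ ?_ hw l
  · intro y _
    rw [map_zero, zero_apply]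
  · intro u v u' v' hu hv y hy
    rw [map_add, add_apply, hu y hy, hv y hy]
  · intro c u u' hu y hy
    rw [map_smul, smul_apply, hu y hy]
  · intro i _ v v' hv y hy
    rw [diffOp, diffOp, smul_apply, smul_eq_mul, smul_eq_mul, map_mul,
      jetEval_coeffVar]
    congr 1
    refine multiDeriv_rel (C := fun _ (v : 𝓢(Coord n, ℂ)) u => ∀ y ∈ O, v y = jetEval S g x y u)
      hv ?_ i.2 y hy
    intro k _ v v' hv y hy
    rw [SchwartzMap.lineDerivOp_apply_eq_fderiv, ← (hasFDerivAt_jetEval S hM₂ hg x (hOM hy) v').2 k]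
    congr 1
    exact Filter.EventuallyEq.fderiv_eq (Filter.eventuallyEq_of_mem (hO.mem_nhds hy) hv)

end Fourier

/-! ### The stationary phase expansion -/

section StationaryPhase

open scoped SchwartzMap FourierTransform

variable {n₁ n : ℕ} {M₁ : Type*} [TopologicalSpace M₁]
  [ChartedSpace (EuclideanSpace ℝ (Fin n₁)) M₁] {M₂ : Set (Coord n)}
  (S : QuantumGeneratingFunction n₁ M₁ M₂)

/-- The quantum pullback, without the contribution of the terms of degree zero in `q` and of degree
at most one in `ħ`. -/
def reducedPullback (F : ℝ → M₁ → Coord n → ℂ) (ħ : ℝ) (w : Coord n → ℂ) (x : M₁) : ℂ :=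
  Complex.exp (-(Complex.I / (ħ : ℂ) * S.coeff 0 0 x) - Complex.I * S.coeff 1 0 x) *
    quantumPullback M₂ F ħ w x

variable {F : ℝ → M₁ → Coord n → ℂ} {w : 𝓢(Coord n, ℂ)}

theorem symbol_mul_exp_pairing (ħ : ℝ) (x : M₁) (ξ : Coord n) :
    Complex.exp (-(Complex.I / (ħ : ℂ) * S.coeff 0 0 x) - Complex.I * S.coeff 1 0 x) *
      Complex.exp (Complex.I / (ħ : ℂ) * F ħ x (ħ • ξ)) =
    normalizedSymbol S F ħ x ξ * Complex.exp (Complex.I * (pairing (S.base x) ξ : ℂ)) := by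
  rw [normalizedSymbol, ← Complex.exp_add, ← Complex.exp_add, ← Complex.exp_add]
  congr 1
  ring

theorem reducedPullback_eq (hw : Function.support w ⊆ M₂) {ħ : ℝ} (hħ : 0 < ħ) (x : M₁) :
    reducedPullback S F ħ w x = ∫ ζ, normalizedSymbol S F ħ x ((2 * Real.pi) • ζ) *
      (Complex.exp (Complex.I * (pairing (S.base x) ((2 * Real.pi) • ζ) : ℂ)) * 𝓕 w ζ) := by
  rw [reducedPullback, quantumPullback_eq hw hħ, ← integral_const_mul]
  refine integral_congr_ae (ae_of_all _ fun ζ => ?_)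
  simp only
  rw [← mul_assoc, ← mul_assoc, symbol_mul_exp_pairing]

theorem integrable_symbol_mul {ħ C : ℝ} {x : M₁} (hF : Continuous (F ħ x))
    (hC : ∀ q, ‖Complex.exp (Complex.I / (ħ : ℂ) * F ħ x q)‖ ≤ C) :
    Integrable fun ζ => normalizedSymbol S F ħ x ((2 * Real.pi) • ζ) *
      (Complex.exp (Complex.I * (pairing (S.base x) ((2 * Real.pi) • ζ) : ℂ)) * 𝓕 w ζ) := by
  have h := (integrable_exp_mul_fourier (w := w) hF hC).const_mul
    (Complex.exp (-(Complex.I / (ħ : ℂ) * S.coeff 0 0 x) - Complex.I * S.coeff 1 0 x))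
  refine h.congr (ae_of_all _ fun ζ => ?_)
  simp only
  rw [← mul_assoc, ← mul_assoc, symbol_mul_exp_pairing]

theorem integrable_weight_mul_fourier (w : 𝓢(Coord n, ℂ)) (k : ℕ) :
    Integrable fun ζ : Coord n => (1 + ‖(2 * Real.pi) • ζ‖) ^ k * ‖𝓕 w ζ‖ := by
  have h := (((𝓕 w).integrable_pow_mul volume k).const_mul ((2 * Real.pi) ^ k)).add
    (𝓕 w).integrable.norm
  refine (h.const_mul (2 ^ (k - 1))).mono' (Continuous.aestronglyMeasurable (by fun_prop))
    (ae_of_all _ fun ζ => ?_)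
  have hπ := Real.pi_pos
  rw [norm_smul, Real.norm_of_nonneg (by positivity), Real.norm_of_nonneg (by positivity)]
  calc (1 + 2 * Real.pi * ‖ζ‖) ^ k * ‖𝓕 w ζ‖
      ≤ (2 ^ (k - 1) * (1 ^ k + (2 * Real.pi * ‖ζ‖) ^ k)) * ‖𝓕 w ζ‖ := by
        gcongr
        exact add_pow_le zero_le_one (by positivity) k
    _ = _ := by simp only [Pi.add_apply]; ring

variable {S}

/-- The symbol bound is integrated against 𝓕w, whose rapid decay absorbs the polynomial weight in ξ.
Fourier inversion turns each term into the value of a differential operator at φ(x). -/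
theorem exists_reducedPullback_expansion (hF : S.IsRepresentedBy F) (hM₂ : IsOpen M₂)
    {g : Coord n → ℝ} (hg : ContDiffOn ℝ ∞ g M₂) (x₀ : M₁) (R : ℕ)
    (hwM : Function.support w ⊆ M₂) {O : Set (Coord n)} (hO : IsOpen O) (hOM : O ⊆ M₂)
    (hxO : S.base x₀ ∈ O) {u : JetRing n} (hw : ∀ x, ∀ y ∈ O, w y = jetEval S g x y u) :
    ∃ C : ℝ, ∀ᶠ p : ℝ × M₁ in 𝓝[>] 0 ×ˢ 𝓝 x₀,
      ‖reducedPullback S F p.1 w p.2 - ∑ l ∈ Finset.range (R + 1),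
        jetEval S g p.2 (S.base p.2)
          (flow (higherIndex n R) weight (diffOp (fun i => jetDeriv i) coeffVar) u l) *
            (p.1 : ℂ) ^ l‖ ≤ C * p.1 ^ (R + 1) := by
  obtain ⟨C, hC⟩ := exists_symbol_bound hF x₀ R
  obtain ⟨Cb, hCb⟩ := hF.bounded x₀
  have hint := integrable_weight_mul_fourier w (2 * (R + 1))
  refine ⟨C * ∫ ζ, (1 + ‖(2 * Real.pi) • ζ‖) ^ (2 * (R + 1)) * ‖𝓕 w ζ‖, ?_⟩
  have hbase : ∀ᶠ x in 𝓝 x₀, S.base x ∈ O :=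
    (contMDiff_base S).continuous.continuousAt.eventually (hO.mem_nhds hxO)
  have hpos : ∀ᶠ ħ : ℝ in 𝓝[>] 0, 0 < ħ := self_mem_nhdsWithin
  filter_upwards [hC, hCb, hpos.prod_mk hbase] with ⟨ħ, x⟩ hC hCb ⟨hħ, hb⟩
  simp only at hC hCb hħ hb ⊢
  have hterm : ∀ l, jetEval S g x (S.base x)
      (flow (higherIndex n R) weight (diffOp (fun i => jetDeriv i) coeffVar) u l) * (ħ : ℂ) ^ l =
      ∫ ζ, (expCoeff (higherIndex n R) weight (symbolCoeff S x ((2 * Real.pi) • ζ)) l *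
        (ħ : ℂ) ^ l) *
        (Complex.exp (Complex.I * (pairing (S.base x) ((2 * Real.pi) • ζ) : ℂ)) * 𝓕 w ζ) := by
    intro l
    rw [← schwartzFlow_eq_jetEval hM₂ hg R x hO hOM (hw x) l _ hb,
      ← integral_exp_mul_fourier, ← integral_mul_const]
    refine integral_congr_ae (ae_of_all _ fun ζ => ?_)
    simp only [fourier_schwartzFlow]
    ring
  have htermint : ∀ l, Integrable fun ζ => (expCoeff (higherIndex n R) weight
      (symbolCoeff S x ((2 * Real.pi) • ζ)) l * (ħ : ℂ) ^ l) *
        (Complex.exp (Complex.I * (pairing (S.base x) ((2 * Real.pi) • ζ) : ℂ)) * 𝓕 w ζ) := by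
    intro l
    have h : Integrable fun ζ => (Complex.exp (Complex.I *
        (pairing (S.base x) ((2 * Real.pi) • ζ) : ℂ)) * 𝓕 (schwartzFlow S R x w l) ζ) :=
      (𝓕 (schwartzFlow S R x w l)).integrable.bdd_mul (c := 1)
        (Continuous.aestronglyMeasurable (by
          have := continuous_pairing (S.base x)
          fun_prop)) (ae_of_all _ fun ζ => (norm_exp_I_mul_ofReal _).le)
    refine (h.const_mul ((ħ : ℂ) ^ l)).congr (ae_of_all _ fun ζ => ?_)
    simp only [fourier_schwartzFlow]
    ring
  rw [reducedPullback_eq S hwM hħ, Finset.sum_congr rfl fun l _ => hterm l,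
    ← integral_finsetSum _ fun l _ => htermint l,
    ← integral_sub (integrable_symbol_mul S (hF.continuous ħ hħ x) hCb)
      (integrable_finsetSum _ fun l _ => htermint l)]
  have hle : ∀ ζ : Coord n, ‖normalizedSymbol S F ħ x ((2 * Real.pi) • ζ) *
      (Complex.exp (Complex.I * (pairing (S.base x) ((2 * Real.pi) • ζ) : ℂ)) * 𝓕 w ζ) -
      ∑ l ∈ Finset.range (R + 1), (expCoeff (higherIndex n R) weight
        (symbolCoeff S x ((2 * Real.pi) • ζ)) l * (ħ : ℂ) ^ l) *
        (Complex.exp (Complex.I * (pairing (S.base x) ((2 * Real.pi) • ζ) : ℂ)) * 𝓕 w ζ)‖ ≤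
      C * ħ ^ (R + 1) * ((1 + ‖(2 * Real.pi) • ζ‖) ^ (2 * (R + 1)) * ‖𝓕 w ζ‖) := by
    intro ζ
    rw [← Finset.sum_mul, ← sub_mul, norm_mul, norm_mul, norm_exp_I_mul_ofReal, one_mul]
    refine (mul_le_mul_of_nonneg_right (hC _) (norm_nonneg _)).trans_eq ?_
    rw [mul_pow, ← pow_mul]
    ring
  refine (norm_integral_le_of_norm_le (hint.const_mul _) (ae_of_all _ hle)).trans_eq ?_
  rw [integral_const_mul]
  ring

end StationaryPhase

/-! ### Expansion of wave functions in powers of the phase -/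

section PhasePowers

open scoped SchwartzMap FourierTransform

variable {n : ℕ} {M₂ : Set (Coord n)} {χ g : Coord n → ℝ}

theorem exists_schwartz_cutoff (hM₂ : IsOpen M₂) (hχ : ContDiff ℝ ∞ χ) (hχc : HasCompactSupport χ)
    (hχM : tsupport χ ⊆ M₂) {h : Coord n → ℂ} (hh : ContDiffOn ℝ ∞ h M₂) :
    ∃ w : 𝓢(Coord n, ℂ), ∀ y, w y = (χ y : ℂ) * h y := by
  have hsub : tsupport (fun y => (χ y : ℂ) * h y) ⊆ tsupport χ := by
    refine closure_mono fun y hy => ?_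
    rw [Function.mem_support] at hy ⊢
    intro h0
    exact hy (by rw [h0, Complex.ofReal_zero, zero_mul])
  have hc : HasCompactSupport fun y => (χ y : ℂ) * h y :=
    hχc.of_isClosed_subset isClosed_closure hsub
  have hs : ContDiff ℝ ∞ fun y => (χ y : ℂ) * h y := by
    refine (contMDiff_of_tsupport (I := 𝓘(ℝ, Coord n)) (I' := 𝓘(ℝ, ℂ)) fun y hy => ?_).contDiff
    exact ContDiffAt.contMDiffAt ((Complex.ofRealCLM.contDiff.comp hχ).contDiffAt.mul
      (hh.contDiffAt (hM₂.mem_nhds (hχM (hsub hy)))))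
  exact ⟨hc.toSchwartzMap hs, fun y => rfl⟩

variable {v : ℕ → 𝓢(Coord n, ℂ)} (hv : ∀ k y, v k y = (χ y : ℂ) * (g y : ℂ) ^ k)

include hv

theorem tsupport_subset_of_eq_mul_pow (k : ℕ) : tsupport (v k) ⊆ tsupport χ := by
  refine closure_mono fun y hy => ?_
  rw [Function.mem_support] at hy ⊢
  intro h0
  exact hy (by rw [hv, h0, Complex.ofReal_zero, zero_mul])

/-- Geometric growth in k: by the Leibniz rule on the compact support of χ, one further factor g
costs at most 2ᴺA, where A bounds the derivatives of g up to order N there. -/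
theorem exists_seminorm_mul_pow_le (hM₂ : IsOpen M₂) (hg : ContDiffOn ℝ ∞ g M₂)
    (hχc : HasCompactSupport χ) (hχM : tsupport χ ⊆ M₂) {p : Seminorm ℂ 𝓢(Coord n, ℂ)}
    (hp : Continuous p) : ∃ C D : ℝ, 0 ≤ C ∧ 0 ≤ D ∧ ∀ k, p (v k) ≤ C * D ^ k := by
  obtain ⟨s, C, -, hC⟩ := Seminorm.bound_of_continuous
    (schwartz_withSeminorms ℂ (Coord n) ℂ) p hp
  set K := s.sup Prod.fst with hK
  set N := s.sup Prod.snd with hN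
  set G : Coord n → ℂ := fun y => (g y : ℂ) with hG
  have hGs : ContDiffOn ℝ ∞ G M₂ := Complex.ofRealCLM.contDiff.comp_contDiffOn hg
  have hA : ∀ i, ∃ A : ℝ, ∀ y ∈ tsupport χ, ‖iteratedFDerivWithin ℝ i G M₂ y‖ ≤ A := fun i =>
    hχc.exists_bound_of_continuousOn
      ((hGs.continuousOn_iteratedFDerivWithin (by exact_mod_cast le_top)
        hM₂.uniqueDiffOn).mono hχM)
  choose A' hA' using hA
  set A := ∑ i ∈ Finset.range (N + 1), |A' i| with hAdef
  have hA0 : 0 ≤ A := Finset.sum_nonneg fun _ _ => abs_nonneg _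
  have hA : ∀ i ≤ N, ∀ y ∈ tsupport χ, ‖iteratedFDerivWithin ℝ i G M₂ y‖ ≤ A := fun i hi y hy =>
    ((hA' i y hy).trans (le_abs_self _)).trans (Finset.single_le_sum (f := fun i => |A' i|)
      (fun _ _ => abs_nonneg _) (Finset.mem_range.2 (by omega)))
  -- All seminorms below (K, N) are taken together because the Leibniz rule lowers the order of
  -- differentiation; the estimate for P then closes on itself.
  set P : Seminorm ℂ 𝓢(Coord n, ℂ) :=
    (Finset.Iic (K, N)).sup (schwartzSeminormFamily ℂ (Coord n) ℂ) with hP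
  have hstep : ∀ k, P (v (k + 1)) ≤ 2 ^ N * A * P (v k) := by
    intro k
    have hP0 : 0 ≤ P (v k) := apply_nonneg _ _
    refine Seminorm.finset_sup_apply_le (by positivity) fun ⟨a, b⟩ hab => ?_
    obtain ⟨ha, hb⟩ := Prod.mk_le_mk.1 (Finset.mem_Iic.1 hab)
    refine SchwartzMap.seminorm_le_bound ℂ a b _ (by positivity) fun y => ?_
    by_cases hy : y ∈ tsupport χ
    · have hyM := hχM hy
      have e := iteratedFDerivWithin_of_isOpen (𝕜 := ℝ) (f := v (k + 1)) b hM₂ hyM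
      have hfun : (v (k + 1) : Coord n → ℂ) = fun y => G y * v k y := by
        funext y; rw [hv, hv, pow_succ]; ring
      rw [← e, hfun]
      have hle := norm_iteratedFDerivWithin_mul_le hGs ((v k).smooth ⊤).contDiffOn
        hM₂.uniqueDiffOn hyM (n := b) (by exact_mod_cast le_top)
      calc ‖y‖ ^ a * ‖iteratedFDerivWithin ℝ b (fun y => G y * v k y) M₂ y‖
          ≤ ‖y‖ ^ a * ∑ i ∈ Finset.range (b + 1), (b.choose i : ℝ) *
            ‖iteratedFDerivWithin ℝ i G M₂ y‖ * ‖iteratedFDerivWithin ℝ (b - i) (v k) M₂ y‖ := by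
            gcongr
        _ ≤ ∑ i ∈ Finset.range (b + 1), (b.choose i : ℝ) * (A * P (v k)) := by
            rw [Finset.mul_sum]
            refine Finset.sum_le_sum fun i hi => ?_
            rw [Finset.mem_range] at hi
            have h1 : ‖y‖ ^ a * ‖iteratedFDerivWithin ℝ (b - i) (v k) M₂ y‖ ≤ P (v k) := by
              rw [iteratedFDerivWithin_of_isOpen (𝕜 := ℝ) (b - i) hM₂ hyM]
              refine (SchwartzMap.le_seminorm ℂ a (b - i) (v k) y).trans ?_
              exact Seminorm.le_finset_sup_apply (p := schwartzSeminormFamily ℂ (Coord n) ℂ)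
                (i := (a, b - i)) (Finset.mem_Iic.2 (Prod.mk_le_mk.2 ⟨ha, by omega⟩))
            calc _ = (b.choose i : ℝ) * (‖iteratedFDerivWithin ℝ i G M₂ y‖ *
                  (‖y‖ ^ a * ‖iteratedFDerivWithin ℝ (b - i) (v k) M₂ y‖)) := by ring
              _ ≤ _ := by
                gcongr
                exact hA i (by omega) y hy
        _ = 2 ^ b * (A * P (v k)) := by
            rw [← Finset.sum_mul, ← Nat.cast_sum, Nat.sum_range_choose]; norm_num
        _ ≤ 2 ^ N * (A * P (v k)) := by
            gcongr
            norm_num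
        _ = _ := by ring
    · have h0 : iteratedFDeriv ℝ b (v (k + 1)) y = 0 :=
        image_eq_zero_of_notMem_tsupport fun h =>
          hy (tsupport_subset_of_eq_mul_pow hv (k + 1) (tsupport_iteratedFDeriv_subset b h))
      rw [h0, norm_zero, mul_zero]
      positivity
  have hpow : ∀ k, P (v k) ≤ P (v 0) * (2 ^ N * A) ^ k := by
    intro k
    induction k with
    | zero => simp
    | succ k ih =>
      calc P (v (k + 1)) ≤ 2 ^ N * A * P (v k) := hstep k
        _ ≤ 2 ^ N * A * (P (v 0) * (2 ^ N * A) ^ k) := by gcongr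
        _ = _ := by ring
  refine ⟨C * P (v 0), 2 ^ N * A, mul_nonneg C.2 (apply_nonneg _ _), by positivity, fun k => ?_⟩
  calc p (v k) ≤ C * (s.sup (schwartzSeminormFamily ℂ (Coord n) ℂ)) (v k) := hC (v k)
    _ ≤ C * P (v k) := by
      refine mul_le_mul_of_nonneg_left ?_ C.2
      refine Finset.sup_mono (f := schwartzSeminormFamily ℂ (Coord n) ℂ) (fun i hi => ?_) (v k)
      exact Finset.mem_Iic.2 (Prod.le_def.2 ⟨Finset.le_sup (f := Prod.fst) hi,
        Finset.le_sup (f := Prod.snd) hi⟩)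
    _ ≤ C * (P (v 0) * (2 ^ N * A) ^ k) := mul_le_mul_of_nonneg_left (hpow k) C.2
    _ = _ := by ring

theorem exists_integral_norm_mul_pow_le (hM₂ : IsOpen M₂) (hg : ContDiffOn ℝ ∞ g M₂)
    (hχc : HasCompactSupport χ) (hχM : tsupport χ ⊆ M₂)
    (L : 𝓢(Coord n, ℂ) →L[ℂ] 𝓢(Coord n, ℂ)) :
    ∃ C D : ℝ, 0 ≤ C ∧ 0 ≤ D ∧ ∀ k, ∫ y, ‖L (v k) y‖ ≤ C * D ^ k := by
  have hq : ∀ a b, ∃ C D : ℝ, 0 ≤ C ∧ 0 ≤ D ∧ ∀ k, SchwartzMap.seminorm ℂ a b (L (v k)) ≤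
      C * D ^ k := by
    intro a b
    set p : Seminorm ℂ 𝓢(Coord n, ℂ) := (SchwartzMap.seminorm ℂ a b).comp
      (L : 𝓢(Coord n, ℂ) →ₗ[ℂ] 𝓢(Coord n, ℂ)) with hp
    have hcont : Continuous p :=
      ((schwartz_withSeminorms ℂ (Coord n) ℂ).continuous_seminorm (a, b)).comp L.continuous
    exact exists_seminorm_mul_pow_le hv hM₂ hg hχc hχM hcont
  set m := (volume : Measure (Coord n)).integrablePower with hm
  obtain ⟨C₁, D₁, hC₁, hD₁, h₁⟩ := hq 0 0
  obtain ⟨C₂, D₂, hC₂, hD₂, h₂⟩ := hq (0 + m) 0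
  set c : ℝ := 2 ^ m * ∫ x : Coord n, (1 + ‖x‖) ^ (-(m : ℝ)) with hc
  have hc0 : 0 ≤ c := mul_nonneg (by positivity) (integral_nonneg fun x => by positivity)
  refine ⟨c * (C₁ + C₂), max D₁ D₂, by positivity, le_max_of_le_left hD₁, fun k => ?_⟩
  have h := SchwartzMap.integral_pow_mul_iteratedFDeriv_le ℂ volume (L (v k)) 0 0
  simp only [pow_zero, one_mul, norm_iteratedFDeriv_zero] at h
  calc _ ≤ _ := h
    _ ≤ c * (C₁ * D₁ ^ k + C₂ * D₂ ^ k) := by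
      gcongr
      · exact h₁ k
      · exact h₂ k
    _ ≤ c * (C₁ * max D₁ D₂ ^ k + C₂ * max D₁ D₂ ^ k) := by
      gcongr
      · exact le_max_left _ _
      · exact le_max_right _ _
    _ = _ := by ring

omit hv

theorem summable_pow_div_factorial_mul {C D : ℝ} (z : ℂ) {r : ℕ → ℝ} (h0 : ∀ k, 0 ≤ r k)
    (hr : ∀ k, r k ≤ C * D ^ k) : Summable fun k => ‖z ^ k / (k.factorial : ℂ)‖ * r k := by
  refine Summable.of_nonneg_of_le (fun k => by have := h0 k; positivity) (fun k => ?_)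
    ((Real.summable_pow_div_factorial (‖z‖ * D)).mul_left C)
  rw [norm_div, norm_pow, Complex.norm_natCast]
  calc _ ≤ ‖z‖ ^ k / k.factorial * (C * D ^ k) := by gcongr; exact hr k
    _ = _ := by rw [mul_pow]; ring

/-- The factorial beats the geometric growth of the L¹ norms, so sum and integral may be
interchanged for every complex z. -/
theorem hasSum_integral_mul_of_bounded {b : Coord n → ℂ} (hb : Continuous b) {B : ℝ}
    (hB : ∀ y, ‖b y‖ ≤ B) {u : ℕ → 𝓢(Coord n, ℂ)} {w : 𝓢(Coord n, ℂ)} {C D : ℝ} (z : ℂ)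
    (hu : ∀ k, ∫ y, ‖u k y‖ ≤ C * D ^ k)
    (hw : ∀ y, HasSum (fun k : ℕ => z ^ k / (k.factorial : ℂ) * u k y) (w y)) :
    HasSum (fun k : ℕ => z ^ k / (k.factorial : ℂ) * ∫ y, b y * u k y) (∫ y, b y * w y) := by
  have hint : ∀ k, Integrable fun y => b y * u k y := fun k =>
    (u k).integrable.bdd_mul hb.aestronglyMeasurable (ae_of_all _ hB)
  have hB0 : 0 ≤ B := (norm_nonneg _).trans (hB 0)
  have key := hasSum_integral_of_summable_integral_norm (μ := (volume : Measure (Coord n)))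
    (F := fun (k : ℕ) y => z ^ k / (k.factorial : ℂ) * (b y * u k y))
    (fun k => (hint k).const_mul _) (by
      simp only [norm_mul (z ^ _ / _), integral_const_mul]
      refine summable_pow_div_factorial_mul (C := B * C) (D := D) z
        (fun k => integral_nonneg fun _ => norm_nonneg _) fun k => ?_
      calc ∫ y, ‖b y * u k y‖ ≤ ∫ y, B * ‖u k y‖ := by
            refine integral_mono (hint k).norm ((u k).integrable.norm.const_mul B) fun y => ?_
            simp only [norm_mul]
            exact mul_le_mul_of_nonneg_right (hB y) (norm_nonneg _)
        _ ≤ B * (C * D ^ k) := by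
            rw [integral_const_mul]; exact mul_le_mul_of_nonneg_left (hu k) hB0
        _ = _ := by ring)
  have h1 : ∀ y, ∑' k : ℕ, z ^ k / (k.factorial : ℂ) * (b y * u k y) = b y * w y := fun y =>
    by
    rw [← ((hw y).mul_left (b y)).tsum_eq]
    exact tsum_congr fun k => by ring
  simp only [integral_const_mul, h1] at key
  exact key

end PhasePowers

/-! ### The quantum pullback as a convergent series in the phase parameter -/

section PullbackSeries

open scoped SchwartzMap FourierTransform

variable {n₁ n : ℕ} {M₁ : Type*} [TopologicalSpace M₁]
  [ChartedSpace (EuclideanSpace ℝ (Fin n₁)) M₁] {M₂ : Set (Coord n)}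
  (S : QuantumGeneratingFunction n₁ M₁ M₂)
  {F : ℝ → M₁ → Coord n → ℂ} {χ g : Coord n → ℝ} {v : ℕ → 𝓢(Coord n, ℂ)} {ħ B : ℝ} {x : M₁}

theorem reducedPullback_smul {u : 𝓢(Coord n, ℂ)} (hu : Function.support u ⊆ M₂) (hħ : 0 < ħ)
    (c : ℂ) : reducedPullback S F ħ ⇑(c • u) x = c * reducedPullback S F ħ u x := by
  have hcu : Function.support ⇑(c • u) ⊆ M₂ := fun y hy => hu fun h => hy (by
    rw [smul_apply, h, smul_zero])
  rw [reducedPullback_eq S hcu hħ, reducedPullback_eq S hu hħ,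
    ← integral_const_mul, FourierTransform.fourier_smul]
  refine integral_congr_ae (ae_of_all _ fun ζ => ?_)
  simp only [smul_apply, smul_eq_mul]
  ring

/-- The exponential series is passed through the two integrals in turn: through the Fourier
transform, with a kernel of modulus 1, then through the integral over momenta, with the bounded
factor exp(iF/ħ). -/
theorem hasSum_reducedPullback (hv : ∀ k y, v k y = (χ y : ℂ) * (g y : ℂ) ^ k) (hM₂ : IsOpen M₂)
    (hg : ContDiffOn ℝ ∞ g M₂) (hχc : HasCompactSupport χ) (hχM : tsupport χ ⊆ M₂)
    (hF : Continuous (F ħ x)) (hB : ∀ q, ‖Complex.exp (Complex.I / (ħ : ℂ) * F ħ x q)‖ ≤ B)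
    (hħ : 0 < ħ) :
    (∀ (z : ℂ) (w : 𝓢(Coord n, ℂ)), (∀ y, w y = (χ y : ℂ) * Complex.exp (z * (g y : ℂ))) →
      HasSum (fun k : ℕ => z ^ k / (k.factorial : ℂ) * reducedPullback S F ħ (v k) x)
        (reducedPullback S F ħ w x)) ∧
    ∃ C D : ℝ, ∀ k, ‖reducedPullback S F ħ (v k) x‖ ≤ C * D ^ k := by
  have hvM : ∀ k, Function.support (v k) ⊆ M₂ := fun k =>
    (subset_tsupport _).trans ((tsupport_subset_of_eq_mul_pow hv k).trans hχM)
  obtain ⟨C₀, D₀, -, -, h₀⟩ := exists_integral_norm_mul_pow_le hv hM₂ hg hχc hχM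
    (ContinuousLinearMap.id ℂ _)
  obtain ⟨C₁, D₁, -, -, h₁⟩ := exists_integral_norm_mul_pow_le hv hM₂ hg hχc hχM
    (SchwartzMap.fourierTransformCLM ℂ)
  simp only [ContinuousLinearMap.coe_id', id_eq] at h₀
  simp only [SchwartzMap.fourierTransformCLM_apply] at h₁
  set b : Coord n → ℂ := fun ζ => Complex.exp (Complex.I / (ħ : ℂ) *
    F ħ x (ħ • (2 * Real.pi) • ζ)) with hb
  have hbc : Continuous b := by rw [hb]; fun_prop
  refine ⟨fun z w hw => ?_, ‖Complex.exp (-(Complex.I / (ħ : ℂ) * S.coeff 0 0 x) -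
    Complex.I * S.coeff 1 0 x)‖ * (B * C₁), D₁, fun k => ?_⟩
  · have hwM : Function.support w ⊆ M₂ := by
      refine Set.Subset.trans (fun y hy => ?_) ((subset_tsupport χ).trans hχM)
      rw [Function.mem_support] at hy ⊢
      intro h0
      exact hy (by rw [hw, h0, Complex.ofReal_zero, zero_mul])
    have hsum : ∀ y, HasSum (fun k : ℕ => z ^ k / (k.factorial : ℂ) * v k y) (w y) := by
      intro y
      rw [hw]
      have h := NormedSpace.expSeries_div_hasSum_exp (𝔸 := ℂ) (z * (g y : ℂ))
      rw [← Complex.exp_eq_exp_ℂ] at h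
      have h' := h.mul_left (χ y : ℂ)
      have e : (fun k : ℕ => z ^ k / (k.factorial : ℂ) * v k y) =
          fun k => (χ y : ℂ) * ((z * (g y : ℂ)) ^ k / (k.factorial : ℂ)) := by
        funext k
        rw [hv, mul_pow]; ring
      rw [e]
      exact h'
    have hsumF : ∀ ζ, HasSum (fun k : ℕ => z ^ k / (k.factorial : ℂ) * 𝓕 (v k) ζ) (𝓕 w ζ) := by
      intro ζ
      simp only [fourier_apply_eq]
      refine hasSum_integral_mul_of_bounded (B := 1) ?_ (fun y => ?_) z h₀ hsum
      · unfold pairing; fun_prop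
      · rw [← mul_neg, ← Complex.ofReal_neg, norm_exp_I_mul_ofReal]
    have h := (hasSum_integral_mul_of_bounded hbc (fun ζ => hB _) z h₁ hsumF).mul_left
      (Complex.exp (-(Complex.I / (ħ : ℂ) * S.coeff 0 0 x) - Complex.I * S.coeff 1 0 x))
    rw [reducedPullback, quantumPullback_eq hwM hħ]
    have e : (fun k : ℕ => z ^ k / (k.factorial : ℂ) * reducedPullback S F ħ (v k) x) =
        fun k => Complex.exp (-(Complex.I / (ħ : ℂ) * S.coeff 0 0 x) - Complex.I * S.coeff 1 0 x) *
          (z ^ k / (k.factorial : ℂ) * ∫ ζ, b ζ * 𝓕 (v k) ζ) := by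
      funext k
      rw [reducedPullback, quantumPullback_eq (hvM k) hħ]
      ring
    rw [e]
    exact h
  · have hB0 : 0 ≤ B := (norm_nonneg _).trans (hB 0)
    rw [reducedPullback, quantumPullback_eq (hvM k) hħ, norm_mul, mul_assoc, mul_assoc]
    refine mul_le_mul_of_nonneg_left ?_ (norm_nonneg _)
    refine (norm_integral_le_of_norm_le ((𝓕 (v k)).integrable.norm.const_mul B)
      (ae_of_all _ fun ζ => ?_)).trans ?_
    · rw [norm_mul]
      exact mul_le_mul_of_nonneg_right (hB _) (norm_nonneg _)
    · rw [integral_const_mul]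
      exact mul_le_mul_of_nonneg_left (h₁ k) hB0

end PullbackSeries

/-! ### Taylor coefficients and logarithms -/

section TaylorCoeff

/-- The Taylor coefficients at `0`. -/
def taylorCoeff (f : ℝ → ℂ) (k : ℕ) : ℂ := iteratedDeriv k f 0 / (k.factorial : ℂ)

theorem analyticAt_of_hasSum {f : ℝ → ℂ} {a : ℕ → ℂ} {C : ℝ} (ha : ∀ k, ‖a k‖ ≤ C)
    (hf : ∀ t : ℝ, HasSum (fun k => (t : ℂ) ^ k * a k) (f t)) :
    AnalyticAt ℝ f 0 ∧ ∀ k, taylorCoeff f k = a k := by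
  set p : FormalMultilinearSeries ℝ ℝ ℂ := fun k =>
    ContinuousMultilinearMap.mkPiRing ℝ (Fin k) (a k) with hp
  have hps : HasFPowerSeriesOnBall f p 0 1 := by
    refine ⟨?_, one_pos, fun {t} _ => ?_⟩
    · have := p.le_radius_of_bound (r := 1) C fun k => by
        rw [hp, ContinuousMultilinearMap.norm_mkPiRing]
        simpa using ha k
      simpa using this
    · rw [zero_add]
      have e : (fun k => p k fun _ => t) = fun k => (t : ℂ) ^ k * a k := by
        funext k
        simp [hp]
      rw [e]
      exact hf t
  refine ⟨hps.analyticAt, fun k => ?_⟩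
  have h := hps.factorial_smul (1 : ℝ) k
  have hk : (k.factorial : ℂ) ≠ 0 := by exact_mod_cast k.factorial_ne_zero
  rw [taylorCoeff, iteratedDeriv, ← h, div_eq_iff hk]
  simp [hp, mul_comm]

/-- The Leibniz rule for f' = L'f. It has the shape of the formal relation between a wave series and
its logarithmic derivative. -/
theorem taylorCoeff_mul_deriv {f L : ℝ → ℂ} (hf : AnalyticAt ℝ f 0) (hL : AnalyticAt ℝ L 0)
    (h : deriv f =ᶠ[𝓝 0] fun t => deriv L t * f t) (k : ℕ) :
    ((k : ℂ) + 1) * taylorCoeff f (k + 1) = ∑ i ∈ Finset.range (k + 1),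
      (((i : ℂ) + 1) * taylorCoeff L (i + 1)) * taylorCoeff f (k - i) := by
  have hfac : ∀ m : ℕ, (m.factorial : ℂ) ≠ 0 := fun m => by exact_mod_cast m.factorial_ne_zero
  have hsucc : ∀ (f : ℝ → ℂ) (m : ℕ), ((m : ℂ) + 1) * taylorCoeff f (m + 1) =
      iteratedDeriv m (deriv f) 0 / (m.factorial : ℂ) := by
    intro f m
    have h1 : (m : ℂ) + 1 ≠ 0 := by exact_mod_cast m.succ_ne_zero
    have h2 := hfac m
    rw [taylorCoeff, iteratedDeriv_succ', Nat.factorial_succ]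
    push_cast
    field_simp
  simp only [hsucc]
  simp only [taylorCoeff]
  rw [h.iteratedDeriv_eq, iteratedDeriv_fun_mul hL.deriv.contDiffAt hf.contDiffAt, Finset.sum_div]
  refine Finset.sum_congr rfl fun i hi => ?_
  have hik : i ≤ k := Nat.lt_succ_iff.1 (Finset.mem_range.1 hi)
  have hc : (k.choose i : ℂ) * i.factorial * (k - i).factorial = k.factorial := by
    exact_mod_cast Nat.choose_mul_factorial_mul_factorial hik
  have h1 := hfac i
  have h2 := hfac (k - i)
  have h3 := hfac k
  field_simp
  rw [← hc]
  ring

theorem analyticAt_log_comp {f : ℝ → ℂ} (hf : AnalyticAt ℝ f 0) (h0 : f 0 ∈ Complex.slitPlane) :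
    AnalyticAt ℝ (fun t => Complex.log (f t)) 0 ∧
    (∀ᶠ t in 𝓝 0, Complex.exp (Complex.log (f t)) = f t) ∧
    deriv f =ᶠ[𝓝 0] fun t => deriv (fun t => Complex.log (f t)) t * f t := by
  have hL : AnalyticAt ℝ (fun t => Complex.log (f t)) 0 :=
    (analyticAt_clog h0).restrictScalars.comp hf
  have hexp : ∀ᶠ t in 𝓝 0, Complex.exp (Complex.log (f t)) = f t := by
    filter_upwards [hf.continuousAt.eventually (Complex.isOpen_slitPlane.mem_nhds h0)] with t ht
    exact Complex.exp_log (Complex.slitPlane_ne_zero ht)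
  refine ⟨hL, hexp, ?_⟩
  filter_upwards [hexp.eventually_nhds, hL.eventually_analyticAt] with t ht hLt
  have h1 : deriv f t = deriv (fun t => Complex.exp (Complex.log (f t))) t :=
    (Filter.EventuallyEq.deriv_eq ht).symm
  rw [h1, (hLt.differentiableAt.hasDerivAt.cexp).deriv, ht.self_of_nhds, mul_comm]

end TaylorCoeff

/-! ### Asymptotic expansions in `ħ`, locally uniform in a parameter -/

section Expansion

open Asymptotics

variable {M : Type*} [TopologicalSpace M] {R : ℕ} {x₀ : M}

/-- The sum of the terms of degree at most `R`. -/
def truncatedSum (R : ℕ) (P : PowerSeries C(M, ℂ)) (p : ℝ × M) : ℂ :=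
  ∑ l ∈ Finset.range (R + 1), PowerSeries.coeff l P p.2 * (p.1 : ℂ) ^ l

/-- `P` is the asymptotic expansion of `f` up to `O(ħ^{R+1})`, uniformly near `x₀`. -/
def HasExpansion (R : ℕ) (x₀ : M) (f : ℝ × M → ℂ) (P : PowerSeries C(M, ℂ)) : Prop :=
  (fun p => f p - truncatedSum R P p) =O[𝓝[>] 0 ×ˢ 𝓝 x₀] fun p => p.1 ^ (R + 1)

theorem isBigO_pow_of_le (x₀ : M) {k m : ℕ} (h : k ≤ m) :
    (fun p : ℝ × M => (p.1 : ℂ) ^ m) =O[𝓝[>] 0 ×ˢ 𝓝 x₀] fun p => p.1 ^ k := by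
  have hpos : ∀ᶠ ħ : ℝ in 𝓝[>] 0, 0 < ħ ∧ ħ < 1 := by
    filter_upwards [self_mem_nhdsWithin, nhdsWithin_le_nhds (Iio_mem_nhds (zero_lt_one (α := ℝ)))]
      with ħ h1 h2
    exact ⟨h1, h2⟩
  refine IsBigO.of_bound 1 ?_
  filter_upwards [hpos.prod_inl (𝓝 x₀)] with p hp
  rw [norm_pow, norm_pow, Complex.norm_real, Real.norm_of_nonneg hp.1.le, one_mul]
  exact pow_le_pow_of_le_one hp.1.le hp.2.le h

theorem isBigO_apply_one (x₀ : M) (c : C(M, ℂ)) :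
    (fun p : ℝ × M => c p.2) =O[𝓝[>] 0 ×ˢ 𝓝 x₀] fun _ => (1 : ℝ) :=
  ((c.continuous.tendsto x₀).comp tendsto_snd).isBigO_one ℝ

theorem isBigO_coeff_mul_pow (x₀ : M) (c : C(M, ℂ)) {k m : ℕ} (h : k ≤ m) :
    (fun p : ℝ × M => c p.2 * (p.1 : ℂ) ^ m) =O[𝓝[>] 0 ×ˢ 𝓝 x₀] fun p => p.1 ^ k := by
  simpa using (isBigO_apply_one x₀ c).mul (isBigO_pow_of_le x₀ h)

theorem truncatedSum_isBigO_one (R : ℕ) (x₀ : M) (P : PowerSeries C(M, ℂ)) :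
    truncatedSum R P =O[𝓝[>] 0 ×ˢ 𝓝 x₀] fun _ => (1 : ℝ) := by
  refine IsBigO.fun_sum fun l _ => ?_
  simpa using isBigO_coeff_mul_pow x₀ (PowerSeries.coeff l P) (Nat.zero_le l)

theorem hasExpansion_truncatedSum (R : ℕ) (x₀ : M) (P : PowerSeries C(M, ℂ)) :
    HasExpansion R x₀ (truncatedSum R P) P := by
  simp only [HasExpansion, sub_self]
  exact isBigO_zero _ _

theorem truncatedSum_mul_isBigO (R : ℕ) (x₀ : M) (P Q : PowerSeries C(M, ℂ)) :
    (fun p => truncatedSum R P p * truncatedSum R Q p - truncatedSum R (P * Q) p)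
      =O[𝓝[>] 0 ×ˢ 𝓝 x₀] fun p => p.1 ^ (R + 1) := by
  set t : ℝ × M → ℕ → ℕ → ℂ := fun p i j =>
    (PowerSeries.coeff i P * PowerSeries.coeff j Q) p.2 * (p.1 : ℂ) ^ (i + j) with ht
  have h1 : ∀ p, truncatedSum R P p * truncatedSum R Q p =
      ∑ i ∈ Finset.range (R + 1), ∑ j ∈ Finset.range (R + 1), t p i j := by
    intro p
    rw [truncatedSum, truncatedSum, Finset.sum_mul_sum]
    refine Finset.sum_congr rfl fun i _ => Finset.sum_congr rfl fun j _ => ?_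
    simp only [ht, ContinuousMap.mul_apply, pow_add]
    ring
  have h2 : ∀ p, truncatedSum R (P * Q) p =
      ∑ i ∈ Finset.range (R + 1), ∑ j ∈ Finset.range (R + 1 - i), t p i j := by
    intro p
    rw [← Finset.sum_range_diag_flip, truncatedSum]
    refine Finset.sum_congr rfl fun l _ => ?_
    rw [PowerSeries.coeff_mul, Finset.Nat.sum_antidiagonal_eq_sum_range_succ
      (fun i j => PowerSeries.coeff i P * PowerSeries.coeff j Q), ContinuousMap.sum_apply,
      Finset.sum_mul]
    refine Finset.sum_congr rfl fun i hi => ?_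
    simp only [ht]
    rw [Nat.add_sub_cancel' (Nat.lt_succ_iff.1 (Finset.mem_range.1 hi))]
  have h3 : ∀ p, truncatedSum R P p * truncatedSum R Q p - truncatedSum R (P * Q) p =
      ∑ i ∈ Finset.range (R + 1), ∑ j ∈ Finset.Ico (R + 1 - i) (R + 1), t p i j := by
    intro p
    rw [h1, h2, ← Finset.sum_sub_distrib]
    exact Finset.sum_congr rfl fun i _ => (Finset.sum_Ico_eq_sub _ (by omega)).symm
  simp only [h3]
  refine IsBigO.fun_sum fun i _ => IsBigO.fun_sum fun j hj => ?_
  rw [Finset.mem_Ico] at hj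
  exact isBigO_coeff_mul_pow x₀ _ (by omega)

namespace HasExpansion

variable {f h a : ℝ × M → ℂ} {P Q W : PowerSeries C(M, ℂ)}

theorem isBigO_one (hf : HasExpansion R x₀ f P) : f =O[𝓝[>] 0 ×ˢ 𝓝 x₀] fun _ => (1 : ℝ) := by
  have h1 : (fun p : ℝ × M => p.1 ^ (R + 1)) =O[𝓝[>] 0 ×ˢ 𝓝 x₀] fun _ => (1 : ℝ) := by
    have := (isBigO_pow_of_le x₀ (Nat.zero_le (R + 1))).norm_left
    simp only [norm_pow, Complex.norm_real, pow_zero] at this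
    exact IsBigO.of_norm_left (by simpa using this)
  simpa using (IsBigO.trans hf h1).add (truncatedSum_isBigO_one R x₀ P)

theorem congr' (hf : HasExpansion R x₀ f P) (e : f =ᶠ[𝓝[>] 0 ×ˢ 𝓝 x₀] h) :
    HasExpansion R x₀ h P :=
  IsBigO.congr' hf (e.sub (EventuallyEq.refl _ _)) (EventuallyEq.refl _ _)

theorem sub (hf : HasExpansion R x₀ f P) (hh : HasExpansion R x₀ h Q) :
    HasExpansion R x₀ (fun p => f p - h p) (P - Q) := by
  refine (IsBigO.sub hf hh).congr_left fun p => ?_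
  simp only [truncatedSum, map_sub, ContinuousMap.sub_apply, sub_mul, Finset.sum_sub_distrib]
  ring

theorem zero : HasExpansion R x₀ (fun _ => 0) 0 := by
  refine (isBigO_zero _ _).congr_left fun p => ?_
  simp [truncatedSum]

theorem add (hf : HasExpansion R x₀ f P) (hh : HasExpansion R x₀ h Q) :
    HasExpansion R x₀ (fun p => f p + h p) (P + Q) := by
  refine (IsBigO.add hf hh).congr_left fun p => ?_
  simp only [truncatedSum, map_add, ContinuousMap.add_apply, add_mul, Finset.sum_add_distrib]
  ring

theorem sum {ι : Type*} (s : Finset ι) {f : ι → ℝ × M → ℂ} {P : ι → PowerSeries C(M, ℂ)}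
    (hf : ∀ i ∈ s, HasExpansion R x₀ (f i) (P i)) :
    HasExpansion R x₀ (fun p => ∑ i ∈ s, f i p) (∑ i ∈ s, P i) := by
  classical
  induction s using Finset.induction_on with
  | empty => simpa using zero
  | insert i s hi ih =>
    simp only [Finset.sum_insert hi]
    exact (hf i (Finset.mem_insert_self _ _)).add
      (ih fun j hj => hf j (Finset.mem_insert_of_mem hj))

theorem mul (hf : HasExpansion R x₀ f P) (hh : HasExpansion R x₀ h Q) :
    HasExpansion R x₀ (fun p => f p * h p) (P * Q) := by
  have h1 := IsBigO.mul hf hh.isBigO_one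
  have h2 := (truncatedSum_isBigO_one R x₀ P).mul hh
  simp only [mul_one, one_mul] at h1 h2
  refine ((h1.add h2).add (truncatedSum_mul_isBigO R x₀ P Q)).congr_left fun p => ?_
  ring

theorem natCast_mul (k : ℕ) (hf : HasExpansion R x₀ f P) :
    HasExpansion R x₀ (fun p => (k : ℂ) * f p) ((k : PowerSeries C(M, ℂ)) * P) := by
  refine (IsBigO.const_mul_left hf (k : ℂ)).congr_left fun p => ?_
  have hc : ∀ l, PowerSeries.coeff l ((k : PowerSeries C(M, ℂ)) * P) p.2 =
      k * PowerSeries.coeff l P p.2 := fun l => by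
    rw [← nsmul_eq_mul, map_nsmul, ContinuousMap.smul_apply, nsmul_eq_mul]
  simp only [truncatedSum, hc, mul_sub, Finset.mul_sum, mul_assoc]

theorem tendsto (hf : HasExpansion R x₀ f P) (c : ℂ) (hP : ∀ x, PowerSeries.coeff 0 P x = c) :
    Tendsto f (𝓝[>] 0 ×ˢ 𝓝 x₀) (𝓝 c) := by
  have hħ : Tendsto (fun p : ℝ × M => p.1) (𝓝[>] 0 ×ˢ 𝓝 x₀) (𝓝 0) :=
    (tendsto_nhdsWithin_of_tendsto_nhds tendsto_id).comp tendsto_fst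
  have hO : (fun p : ℝ × M => f p - c) =O[𝓝[>] 0 ×ˢ 𝓝 x₀] fun p => p.1 := by
    have h1 : (fun p => f p - truncatedSum R P p) =O[𝓝[>] 0 ×ˢ 𝓝 x₀] fun p => p.1 := by
      refine IsBigO.trans hf ?_
      have := (isBigO_pow_of_le x₀ (k := 1) (m := R + 1) (by omega)).norm_left
      simp only [norm_pow, Complex.norm_real, pow_one] at this
      exact IsBigO.of_norm_left (by simpa using this)
    have h2 : (fun p : ℝ × M => ∑ l ∈ Finset.range R, PowerSeries.coeff (l + 1) P p.2 *
        (p.1 : ℂ) ^ (l + 1)) =O[𝓝[>] 0 ×ˢ 𝓝 x₀] fun p => p.1 := by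
      refine IsBigO.fun_sum fun l _ => ?_
      simpa using isBigO_coeff_mul_pow x₀ (PowerSeries.coeff (l + 1) P) (k := 1) (m := l + 1)
        (by omega)
    refine (h1.add h2).congr_left fun p => ?_
    rw [truncatedSum, Finset.sum_range_succ', hP]
    ring
  simpa using (hO.trans_tendsto hħ).add_const c

/-- Dividing by a function that tends to 1 does not enlarge the error, so no expansion of the
inverse is needed. -/
theorem of_mul_right (hfa : HasExpansion R x₀ (fun p => f p * a p) (P * W))
    (ha : HasExpansion R x₀ a W) (ha1 : Tendsto a (𝓝[>] 0 ×ˢ 𝓝 x₀) (𝓝 1)) :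
    HasExpansion R x₀ f P := by
  have hinv : (fun p => (a p)⁻¹) =O[𝓝[>] 0 ×ˢ 𝓝 x₀] fun _ => (1 : ℝ) :=
    (ha1.inv₀ one_ne_zero).isBigO_one ℝ
  have h1 := (IsBigO.sub hfa ((hasExpansion_truncatedSum R x₀ P).mul ha)).mul hinv
  simp only [mul_one] at h1
  refine IsBigO.congr' h1 ?_ (EventuallyEq.refl _ _)
  filter_upwards [ha1.eventually_ne one_ne_zero] with p hp
  field_simp
  ring

/-- The expansion of the coefficients of a logarithmic derivative. -/
theorem logDeriv {a b : ℕ → ℝ × M → ℂ} {W P : PowerSeries (PowerSeries C(M, ℂ))}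
    (ha : ∀ k, HasExpansion R x₀ (a k) (PowerSeries.coeff k W))
    (hW : PowerSeries.coeff 0 (PowerSeries.coeff 0 W) = 1)
    (hab : ∀ k : ℕ, ∀ᶠ p in 𝓝[>] 0 ×ˢ 𝓝 x₀, ((k : ℂ) + 1) * a (k + 1) p =
      ∑ i ∈ Finset.range (k + 1), b i p * a (k - i) p)
    (hPW : ∀ k : ℕ, ((k : PowerSeries C(M, ℂ)) + 1) * PowerSeries.coeff (k + 1) W =
      ∑ i ∈ Finset.range (k + 1), PowerSeries.coeff i P * PowerSeries.coeff (k - i) W) (k : ℕ) :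
    HasExpansion R x₀ (b k) (PowerSeries.coeff k P) := by
  have ha1 : Tendsto (a 0) (𝓝[>] 0 ×ˢ 𝓝 x₀) (𝓝 1) := (ha 0).tendsto 1 fun x => by rw [hW]; rfl
  induction k using Nat.strong_induction_on with
  | _ k ih =>
    -- The unknown `b k` occurs in the recursion only in the summand i = k, multiplied by `a 0`.
    refine of_mul_right ?_ (ha 0) ha1
    have h1 := ((ha (k + 1)).natCast_mul (k + 1)).sub
      (sum (Finset.range k) fun i hi => (ih i (Finset.mem_range.1 hi)).mul (ha (k - i)))
    have e : ((k + 1 : ℕ) : PowerSeries C(M, ℂ)) * PowerSeries.coeff (k + 1) W -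
        ∑ i ∈ Finset.range k, PowerSeries.coeff i P * PowerSeries.coeff (k - i) W =
        PowerSeries.coeff k P * PowerSeries.coeff 0 W := by
      rw [Nat.cast_succ, hPW, Finset.sum_range_succ, Nat.sub_self, add_sub_cancel_left]
    rw [e] at h1
    refine h1.congr' ?_
    filter_upwards [hab k] with p hp
    rw [Nat.cast_succ, hp, Finset.sum_range_succ, Nat.sub_self, add_sub_cancel_left]

end HasExpansion

end Expansion

/-! ### The phase of the quantum pullback of a wave function -/

section Phase

open scoped SchwartzMap

variable {n₁ n : ℕ} {M₁ : Type*} [TopologicalSpace M₁]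
  [ChartedSpace (EuclideanSpace ℝ (Fin n₁)) M₁] {M₂ : Set (Coord n)}
  (S : QuantumGeneratingFunction n₁ M₁ M₂) {F : ℝ → M₁ → Coord n → ℂ} {χ g : Coord n → ℝ}

/-- The value of a universal jet at the points of the graph of the underlying map. -/
def baseEval (hM₂ : IsOpen M₂) (hg : ContDiffOn ℝ ∞ g M₂) : JetRing n →+* C(M₁, ℂ) where
  toFun u := ⟨fun x => jetEval S g x (S.base x) u, (contMDiff_jetEval S hM₂ hg u).continuous⟩
  map_zero' := by ext x; exact map_zero (jetEval S g x (S.base x))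
  map_one' := by ext x; exact map_one (jetEval S g x (S.base x))
  map_add' u v := by ext x; exact map_add (jetEval S g x (S.base x)) u v
  map_mul' u v := by ext x; exact map_mul (jetEval S g x (S.base x)) u v

theorem baseEval_apply (hM₂ : IsOpen M₂) (hg : ContDiffOn ℝ ∞ g M₂) (u : JetRing n) (x : M₁) :
    baseEval S hM₂ hg u x = jetEval S g x (S.base x) u := rfl

theorem mixedDeriv_zero (g : Coord n → ℝ) : mixedDeriv 0 g = g := by
  unfold mixedDeriv
  induction List.finRange n with
  | nil => rfl
  | cons i l ih => rw [List.foldr_cons, ih]; rfl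

/-- The evaluation of a universal series in `ħ` and `τ`. -/
def seriesEval (hM₂ : IsOpen M₂) (hg : ContDiffOn ℝ ∞ g M₂) :
    BiSeries (JetRing n) →+* PowerSeries (PowerSeries C(M₁, ℂ)) :=
  PowerSeries.map (PowerSeries.map (baseEval S hM₂ hg))

theorem coeff_coeff_seriesEval (hM₂ : IsOpen M₂) (hg : ContDiffOn ℝ ∞ g M₂)
    (U : BiSeries (JetRing n)) (l k : ℕ) :
    PowerSeries.coeff l (PowerSeries.coeff k (seriesEval S hM₂ hg U)) =
      baseEval S hM₂ hg (bicoeff l k U) := by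
  rw [seriesEval, PowerSeries.coeff_map, PowerSeries.coeff_map, bicoeff]

theorem succ_mul_coeff_universalWave (hM₂ : IsOpen M₂) (hg : ContDiffOn ℝ ∞ g M₂) (R k : ℕ) :
    ((k : PowerSeries C(M₁, ℂ)) + 1) *
        PowerSeries.coeff (k + 1) (seriesEval S hM₂ hg (universalWave n R)) =
      ∑ i ∈ Finset.range (k + 1),
        PowerSeries.coeff i (seriesEval S hM₂ hg (universalLogDeriv n R)) *
          PowerSeries.coeff (k - i) (seriesEval S hM₂ hg (universalWave n R)) := by
  have h : universalLogDeriv n R * universalWave n R =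
      ddX (PowerSeries (JetRing n)) (universalWave n R) := by
    rw [universalLogDeriv, mul_right_comm, universalWaveInv_mul, one_mul]
  have h2 := congrArg (fun U => PowerSeries.coeff k (seriesEval S hM₂ hg U)) h
  simp only [map_mul, PowerSeries.coeff_mul] at h2
  rw [Finset.Nat.sum_antidiagonal_eq_sum_range_succ_mk] at h2
  rw [h2]
  simp only [seriesEval, PowerSeries.coeff_map, coeff_ddX, map_mul, map_add, map_natCast, map_one]
  rw [mul_comm]

variable {S}

/-- Near φ(x₀) the function χ(ig)ᵏ/k! is the evaluation of G^k/k!, so its pullback expands with the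
coefficient of τᵏ of the universal wave. -/
theorem hasExpansion_moment (hF : S.IsRepresentedBy F) (hM₂ : IsOpen M₂)
    (hg : ContDiffOn ℝ ∞ g M₂) (hχM : tsupport χ ⊆ M₂) {v : ℕ → 𝓢(Coord n, ℂ)}
    (hv : ∀ k y, v k y = (χ y : ℂ) * (g y : ℂ) ^ k) {x₀ : M₁} (hx₀ : χ =ᶠ[𝓝 (S.base x₀)] 1)
    (R k : ℕ) :
    HasExpansion R x₀ (fun p => Complex.I ^ k / (k.factorial : ℂ) *
        reducedPullback S F p.1 (v k) p.2)
      (PowerSeries.coeff k (seriesEval S hM₂ hg (universalWave n R))) := by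
  have hnhds : {y | χ y = 1} ∩ M₂ ∈ 𝓝 (S.base x₀) :=
    Filter.inter_mem hx₀ (hM₂.mem_nhds (base_mem S x₀))
  obtain ⟨O, hOs, hO, hxO⟩ := mem_nhds_iff.1 hnhds
  have hvM : Function.support (v k) ⊆ M₂ :=
    (subset_tsupport _).trans ((tsupport_subset_of_eq_mul_pow hv k).trans hχM)
  set c : ℂ := Complex.I ^ k / (k.factorial : ℂ) with hc
  have hcvM : Function.support ⇑(c • v k) ⊆ M₂ := fun y hy => hvM fun h => hy (by
    rw [smul_apply, h, smul_zero])
  obtain ⟨C, hC⟩ := exists_reducedPullback_expansion hF hM₂ hg x₀ R hcvM hO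
    (hOs.trans Set.inter_subset_right) hxO (w := c • v k)
    (u := (k.factorial : ℂ)⁻¹ • (jetVar (0 : Fin n →₀ ℕ)) ^ k) (fun x y hy => by
      have hχy : χ y = 1 := (hOs hy).1
      rw [smul_apply, hv, hχy, map_smul, map_pow, jetEval_jetVar, mixedDeriv_zero, hc, mul_pow,
        smul_eq_mul, smul_eq_mul, Complex.ofReal_one]
      ring)
  refine Asymptotics.IsBigO.of_bound C ?_
  have hpos : ∀ᶠ ħ : ℝ in 𝓝[>] 0, 0 < ħ := self_mem_nhdsWithin
  filter_upwards [hC, hpos.prod_inl (𝓝 x₀)] with p hp hħ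
  rw [← reducedPullback_smul S hvM hħ, norm_pow, Real.norm_of_nonneg hħ.le]
  simpa only [truncatedSum, coeff_coeff_seriesEval, baseEval_apply, universalWave,
    bicoeff_waveSeries] using hp

variable (S F χ g) in
/-- The reduced quantum pullback of the wave function `χ e^{(i/ħ) t g}`. -/
def reducedWave (ħ : ℝ) (x : M₁) (t : ℝ) : ℂ := reducedPullback S F ħ (waveFunction χ g ħ t) x

theorem exists_schwartz_eq_waveFunction (hM₂ : IsOpen M₂) (hg : ContDiffOn ℝ ∞ g M₂)
    (hχ : ContDiff ℝ ∞ χ) (hχc : HasCompactSupport χ) (hχM : tsupport χ ⊆ M₂) (ħ t : ℝ) :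
    ∃ w : 𝓢(Coord n, ℂ), ⇑w = waveFunction χ g ħ t ∧
      ∀ y, w y = (χ y : ℂ) * Complex.exp (Complex.I / (ħ : ℂ) * t * (g y : ℂ)) := by
  have hgc : ContDiffOn ℝ ∞ (fun y => (g y : ℂ)) M₂ :=
    Complex.ofRealCLM.contDiff.comp_contDiffOn hg
  obtain ⟨w, hw⟩ := exists_schwartz_cutoff hM₂ hχ hχc hχM
    (h := fun y => Complex.exp (Complex.I / (ħ : ℂ) * t * (g y : ℂ)))
    ((contDiffOn_const.mul hgc).cexp)
  refine ⟨w, funext fun y => ?_, hw⟩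
  rw [hw, waveFunction]
  push_cast
  rw [mul_assoc (_ / _)]

/-- The series converges for every real t. Its absolute convergence at t = 1 bounds the
coefficients, which yields analyticity. -/
theorem taylorCoeff_reducedWave (hM₂ : IsOpen M₂) (hg : ContDiffOn ℝ ∞ g M₂)
    (hχ : ContDiff ℝ ∞ χ) (hχc : HasCompactSupport χ) (hχM : tsupport χ ⊆ M₂)
    {v : ℕ → 𝓢(Coord n, ℂ)} (hv : ∀ k y, v k y = (χ y : ℂ) * (g y : ℂ) ^ k)
    {ħ B : ℝ} {x : M₁} (hħ : 0 < ħ) (hF : Continuous (F ħ x))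
    (hB : ∀ q, ‖Complex.exp (Complex.I / (ħ : ℂ) * F ħ x q)‖ ≤ B) :
    AnalyticAt ℝ (reducedWave S F χ g ħ x) 0 ∧ ∀ k, taylorCoeff (reducedWave S F χ g ħ x) k =
      (Complex.I / (ħ : ℂ)) ^ k / (k.factorial : ℂ) * reducedPullback S F ħ (v k) x := by
  obtain ⟨hsum, C, D, hCD⟩ := hasSum_reducedPullback S hv hM₂ hg hχc hχM hF hB hħ
  have hs := summable_pow_div_factorial_mul (Complex.I / (ħ : ℂ)) (fun k => norm_nonneg _) hCD
  refine analyticAt_of_hasSum (C := ∑' k : ℕ, ‖(Complex.I / (ħ : ℂ)) ^ k / (k.factorial : ℂ)‖ *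
    ‖reducedPullback S F ħ (v k) x‖) (fun k => ?_) fun t => ?_
  · rw [norm_mul]
    exact hs.le_tsum k fun j _ => by positivity
  · obtain ⟨w, hw, hwy⟩ := exists_schwartz_eq_waveFunction hM₂ hg hχ hχc hχM ħ t
    have h := hsum (Complex.I / (ħ : ℂ) * t) w hwy
    rw [hw] at h
    have e : (fun k : ℕ => (t : ℂ) ^ k * ((Complex.I / (ħ : ℂ)) ^ k / (k.factorial : ℂ) *
        reducedPullback S F ħ (v k) x)) = fun k => (Complex.I / (ħ : ℂ) * t) ^ k /
          (k.factorial : ℂ) * reducedPullback S F ħ (v k) x := by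
      funext k
      rw [mul_pow]
      ring
    rw [e]
    exact h

variable (S F χ g) in
/-- The phase of the quantum pullback of the wave function `χ e^{(i/ħ) t g}`. -/
def quantumPhase (ħ : ℝ) (x : M₁) (t : ℝ) : ℂ :=
  (S.coeff 0 0 x + ħ * S.coeff 1 0 x) +
    ħ / Complex.I * Complex.log (reducedWave S F χ g ħ x t)

theorem quantumPullback_eq_exp_quantumPhase {ħ t : ℝ} (hħ : ħ ≠ 0) {x : M₁}
    (h : Complex.exp (Complex.log (reducedWave S F χ g ħ x t)) = reducedWave S F χ g ħ x t) :
    quantumPullback M₂ F ħ (waveFunction χ g ħ t) x =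
      Complex.exp (Complex.I / (ħ : ℂ) * quantumPhase S F χ g ħ x t) := by
  have hħ' : (ħ : ℂ) ≠ 0 := Complex.ofReal_ne_zero.2 hħ
  have e : Complex.I / (ħ : ℂ) * quantumPhase S F χ g ħ x t =
      (Complex.I / (ħ : ℂ) * S.coeff 0 0 x + Complex.I * S.coeff 1 0 x) +
        Complex.log (reducedWave S F χ g ħ x t) := by
    rw [quantumPhase]
    have := Complex.I_ne_zero
    field_simp
  rw [e, Complex.exp_add, h, reducedWave, reducedPullback, ← mul_assoc, ← Complex.exp_add]
  rw [show (Complex.I / (ħ : ℂ) * S.coeff 0 0 x + Complex.I * S.coeff 1 0 x) +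
    (-(Complex.I / (ħ : ℂ) * S.coeff 0 0 x) - Complex.I * S.coeff 1 0 x) = 0 by ring,
    Complex.exp_zero, one_mul]

theorem taylorCoeff_quantumPhase_succ (ħ : ℝ) (x : M₁) (k : ℕ) :
    taylorCoeff (quantumPhase S F χ g ħ x) (k + 1) = ħ / Complex.I *
      taylorCoeff (fun t => Complex.log (reducedWave S F χ g ħ x t)) (k + 1) := by
  have e : quantumPhase S F χ g ħ x = fun t => (S.coeff 0 0 x + ħ * S.coeff 1 0 x) +
      ħ / Complex.I * Complex.log (reducedWave S F χ g ħ x t) := rfl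
  rw [taylorCoeff, taylorCoeff, e, iteratedDeriv_const_add k.succ_pos,
    iteratedDeriv_const_mul_field, mul_div_assoc]

variable (S) in
/-- The coefficients of the amplitude. -/
def amplitudeCoeff (hM₂ : IsOpen M₂) (hg : ContDiffOn ℝ ∞ g M₂) : ℕ → M₁ → ℂ
  | 0 => S.coeff 1 0
  | k + 1 => fun x => baseEval S hM₂ hg (bicoeff (k + 1) k (universalLogDeriv n (k + 1))) x /
      (Complex.I * ((k : ℂ) + 1))

theorem continuous_amplitudeCoeff (hM₂ : IsOpen M₂) (hg : ContDiffOn ℝ ∞ g M₂) (j : ℕ) :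
    Continuous (amplitudeCoeff S hM₂ hg j) := by
  cases j with
  | zero => exact (S.contMDiff_coeff 1 0).continuous
  | succ k => exact (ContinuousMap.continuous _).div_const _

end Phase

/-! ### Limits of the Taylor coefficients of the phase -/

section Main

open scoped SchwartzMap

variable {n₁ n : ℕ} {M₁ : Type*} [TopologicalSpace M₁]
  [ChartedSpace (EuclideanSpace ℝ (Fin n₁)) M₁] {M₂ : Set (Coord n)}
  {S : QuantumGeneratingFunction n₁ M₁ M₂} {F : ℝ → M₁ → Coord n → ℂ} {χ g : Coord n → ℝ}

theorem taylorCoeff_zero (f : ℝ → ℂ) : taylorCoeff f 0 = f 0 := by simp [taylorCoeff]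

/-- At t = 0 the reduced wave is the reduced pullback of χ, which tends to 1. It therefore
eventually lies in the slit plane, where the principal logarithm is analytic. -/
theorem eventually_quantumPhase (hF : S.IsRepresentedBy F) (hM₂ : IsOpen M₂)
    (hg : ContDiffOn ℝ ∞ g M₂) (hχ : ContDiff ℝ ∞ χ) (hχc : HasCompactSupport χ)
    (hχM : tsupport χ ⊆ M₂) {v : ℕ → 𝓢(Coord n, ℂ)}
    (hv : ∀ k y, v k y = (χ y : ℂ) * (g y : ℂ) ^ k) {x₀ : M₁} (hx₀ : χ =ᶠ[𝓝 (S.base x₀)] 1) :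
    ∀ᶠ p : ℝ × M₁ in 𝓝[>] 0 ×ˢ 𝓝 x₀, 0 < p.1 ∧
      (∀ t : ℝ, QuantumPullbackConverges M₂ F p.1 (waveFunction χ g p.1 t) p.2) ∧
      (AnalyticAt ℝ (reducedWave S F χ g p.1 p.2) 0 ∧
        ∀ k, taylorCoeff (reducedWave S F χ g p.1 p.2) k =
          (Complex.I / (p.1 : ℂ)) ^ k / (k.factorial : ℂ) * reducedPullback S F p.1 (v k) p.2) ∧
      reducedWave S F χ g p.1 p.2 0 ∈ Complex.slitPlane := by
  have hpos : ∀ᶠ ħ : ℝ in 𝓝[>] 0, 0 < ħ := self_mem_nhdsWithin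
  obtain ⟨B, hB⟩ := hF.bounded x₀
  have h1 : Tendsto (fun p : ℝ × M₁ => Complex.I ^ 0 / ((0 : ℕ).factorial : ℂ) *
      reducedPullback S F p.1 (v 0) p.2) (𝓝[>] 0 ×ˢ 𝓝 x₀) (𝓝 1) :=
    (hasExpansion_moment hF hM₂ hg hχM hv hx₀ 0 0).tendsto 1 fun x => by
      rw [coeff_coeff_seriesEval, universalWave, bicoeff_waveSeries, flow_zero, baseEval_apply]
      simp
  filter_upwards [hpos.prod_inl (𝓝 x₀), hB,
    h1.eventually (Complex.isOpen_slitPlane.mem_nhds Complex.one_mem_slitPlane)]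
    with p hħ hBp hslit
  have ht := taylorCoeff_reducedWave (S := S) hM₂ hg hχ hχc hχM hv hħ (hF.continuous _ hħ p.2) hBp
  refine ⟨hħ, fun t => ?_, ht, ?_⟩
  · obtain ⟨w, hw, hwy⟩ := exists_schwartz_eq_waveFunction hM₂ hg hχ hχc hχM p.1 t
    rw [← hw]
    refine quantumPullbackConverges (hF.continuous _ hħ p.2) hBp ?_ hħ.ne'
    refine Set.Subset.trans (fun y hy => ?_) ((subset_tsupport χ).trans hχM)
    rw [Function.mem_support] at hy ⊢
    intro h0
    exact hy (by rw [hwy, h0, Complex.ofReal_zero, zero_mul])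
  · rw [← taylorCoeff_zero (reducedWave S F χ g p.1 p.2), ht.2 0,
      show (Complex.I / (p.1 : ℂ)) ^ 0 = Complex.I ^ 0 by rw [pow_zero, pow_zero]]
    exact hslit

/-- The power of ħ converts Taylor coefficients in t to coefficients in τ = t/ħ. The actual and the
universal logarithmic derivatives solve the same recursion, so expansions of the moments pass to it.
-/
theorem hasExpansion_logDeriv (hF : S.IsRepresentedBy F) (hM₂ : IsOpen M₂)
    (hg : ContDiffOn ℝ ∞ g M₂) (hχ : ContDiff ℝ ∞ χ) (hχc : HasCompactSupport χ)
    (hχM : tsupport χ ⊆ M₂) {v : ℕ → 𝓢(Coord n, ℂ)}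
    (hv : ∀ k y, v k y = (χ y : ℂ) * (g y : ℂ) ^ k) {x₀ : M₁} (hx₀ : χ =ᶠ[𝓝 (S.base x₀)] 1)
    (R k : ℕ) :
    HasExpansion R x₀ (fun p => (p.1 : ℂ) ^ (k + 1) * (((k : ℂ) + 1) *
        taylorCoeff (fun t => Complex.log (reducedWave S F χ g p.1 p.2 t)) (k + 1)))
      (PowerSeries.coeff k (seriesEval S hM₂ hg (universalLogDeriv n R))) := by
  refine HasExpansion.logDeriv (b := fun k p => (p.1 : ℂ) ^ (k + 1) * (((k : ℂ) + 1) *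
      taylorCoeff (fun t => Complex.log (reducedWave S F χ g p.1 p.2 t)) (k + 1)))
    (fun k => hasExpansion_moment hF hM₂ hg hχM hv hx₀ R k) ?_ (fun k => ?_)
    (succ_mul_coeff_universalWave S hM₂ hg R) k
  · rw [coeff_coeff_seriesEval, universalWave, bicoeff_waveSeries, flow_zero]
    simp
  · filter_upwards [eventually_quantumPhase hF hM₂ hg hχ hχc hχM hv hx₀]
      with p ⟨hħ, _, ⟨han, htc⟩, hslit⟩
    obtain ⟨hL, -, hderiv⟩ := analyticAt_log_comp han hslit
    have hħ' : (p.1 : ℂ) ≠ 0 := Complex.ofReal_ne_zero.2 hħ.ne'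
    have hmom : ∀ m : ℕ, Complex.I ^ m / (m.factorial : ℂ) * reducedPullback S F p.1 (v m) p.2 =
        (p.1 : ℂ) ^ m * taylorCoeff (reducedWave S F χ g p.1 p.2) m := fun m => by
      rw [htc, div_pow]
      field_simp
    simp only [hmom]
    rw [mul_left_comm, taylorCoeff_mul_deriv han hL hderiv, Finset.mul_sum]
    refine Finset.sum_congr rfl fun i hi => ?_
    have hik : k + 1 = (i + 1) + (k - i) := by have := Finset.mem_range.1 hi; omega
    conv_lhs => rw [hik, pow_add]
    ring

/-- The phase contains S_{0,0} + ħS_{1,0} exactly, which gives the pullback and the amplitude in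
degree zero; the logarithm at t = 0 tends to 0. -/
theorem tendsto_quantumPhase_zero (hF : S.IsRepresentedBy F) (hM₂ : IsOpen M₂)
    (hg : ContDiffOn ℝ ∞ g M₂) (hχ : ContDiff ℝ ∞ χ) (hχc : HasCompactSupport χ)
    (hχM : tsupport χ ⊆ M₂) {v : ℕ → 𝓢(Coord n, ℂ)}
    (hv : ∀ k y, v k y = (χ y : ℂ) * (g y : ℂ) ^ k) {x₀ : M₁} (hx₀ : χ =ᶠ[𝓝 (S.base x₀)] 1) :
    Tendsto (fun p : ℝ × M₁ => (taylorCoeff (quantumPhase S F χ g p.1 p.2) 0 -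
      ((PowerSeries.coeff 0 (pullbackSeries S g p.2) : ℝ) : ℂ)) / (p.1 : ℂ) -
        amplitudeCoeff S hM₂ hg 0 p.2) (𝓝[>] 0 ×ˢ 𝓝 x₀) (𝓝 0) := by
  have h1 : Tendsto (fun p : ℝ × M₁ => Complex.I ^ 0 / ((0 : ℕ).factorial : ℂ) *
      reducedPullback S F p.1 (v 0) p.2) (𝓝[>] 0 ×ˢ 𝓝 x₀) (𝓝 1) :=
    (hasExpansion_moment hF hM₂ hg hχM hv hx₀ 0 0).tendsto 1 fun x => by
      rw [coeff_coeff_seriesEval, universalWave, bicoeff_waveSeries, flow_zero, baseEval_apply]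
      simp
  have h2 := ((continuousAt_clog Complex.one_mem_slitPlane).tendsto.comp h1).div_const Complex.I
  rw [Complex.log_one, zero_div] at h2
  refine h2.congr' ?_
  filter_upwards [eventually_quantumPhase hF hM₂ hg hχ hχc hχM hv hx₀]
    with p ⟨hħ, _, ⟨_, htc⟩, _⟩
  have hħ' : (p.1 : ℂ) ≠ 0 := Complex.ofReal_ne_zero.2 hħ.ne'
  have h0 := htc 0
  rw [taylorCoeff_zero] at h0
  have h00 : ((S.coeff 0 0 p.2).re : ℂ) = S.coeff 0 0 p.2 :=
    Complex.ext rfl (S.classical_real 0 p.2).symm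
  rw [taylorCoeff_zero, quantumPhase, h0, pullbackSeries, PowerSeries.coeff_mk, if_pos rfl, h00,
    amplitudeCoeff]
  have := Complex.I_ne_zero
  simp only [Function.comp_apply, pow_zero]
  field_simp
  ring

/-- The coefficient of τᵏ of the logarithmic derivative starts at ħᵏ with i(k+1) times the
coefficient of t^{k+1} in the pullback, and its next term defines the amplitude. Truncation at R = k
+ 1 keeps exactly these two terms; dividing the error O(ħ^{k+2}) by ħ^{k+1} leaves O(ħ). -/
theorem tendsto_quantumPhase_succ (hF : S.IsRepresentedBy F) (hM₂ : IsOpen M₂)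
    (hg : ContDiffOn ℝ ∞ g M₂) (hχ : ContDiff ℝ ∞ χ) (hχc : HasCompactSupport χ)
    (hχM : tsupport χ ⊆ M₂) {v : ℕ → 𝓢(Coord n, ℂ)}
    (hv : ∀ k y, v k y = (χ y : ℂ) * (g y : ℂ) ^ k) {x₀ : M₁} (hx₀ : χ =ᶠ[𝓝 (S.base x₀)] 1)
    (k : ℕ) :
    Tendsto (fun p : ℝ × M₁ => (taylorCoeff (quantumPhase S F χ g p.1 p.2) (k + 1) -
      ((PowerSeries.coeff (k + 1) (pullbackSeries S g p.2) : ℝ) : ℂ)) / (p.1 : ℂ) -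
        amplitudeCoeff S hM₂ hg (k + 1) p.2) (𝓝[>] 0 ×ˢ 𝓝 x₀) (𝓝 0) := by
  set L : ℝ × M₁ → ℂ := fun p =>
    taylorCoeff (fun t => Complex.log (reducedWave S F χ g p.1 p.2 t)) (k + 1) with hL
  obtain ⟨C, hC⟩ := (hasExpansion_logDeriv hF hM₂ hg hχ hχc hχM hv hx₀ (k + 1) k).bound
  obtain ⟨hlow, hdiag⟩ := universalLogDeriv_spec n (k + 1)
  set c : M₁ → ℂ := fun x => baseEval S hM₂ hg (bicoeff (k + 1) k (universalLogDeriv n (k + 1))) x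
    with hc
  have hk : (k : ℂ) + 1 ≠ 0 := by exact_mod_cast k.succ_ne_zero
  have hI := Complex.I_ne_zero
  -- All powers of ħ below k vanish by the filtration: in the variable t the phase has no negative
  -- powers of ħ.
  have htrunc : ∀ p : ℝ × M₁, truncatedSum (k + 1)
      (PowerSeries.coeff k (seriesEval S hM₂ hg (universalLogDeriv n (k + 1)))) p =
      ((k : ℂ) + 1) * (Complex.I * (PowerSeries.coeff (k + 1) (pullbackSeries S g p.2) : ℝ)) *
        (p.1 : ℂ) ^ k + c p.2 * (p.1 : ℂ) ^ (k + 1) := by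
    intro p
    rw [truncatedSum, Finset.sum_range_succ, Finset.sum_range_succ, Finset.sum_eq_zero, zero_add]
    · simp only [coeff_coeff_seriesEval]
      congr 2
      rw [baseEval_apply, hdiag k (by omega), map_mul, map_add, map_natCast, map_one,
        jetEval_coeff_universalPullback S p.2 k.succ_ne_zero]
    · intro l hl
      rw [coeff_coeff_seriesEval, hlow l k (Finset.mem_range.1 hl), map_zero,
        ContinuousMap.zero_apply, zero_mul]
  have hħ : Tendsto (fun p : ℝ × M₁ => C * p.1) (𝓝[>] 0 ×ˢ 𝓝 x₀) (𝓝 0) := by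
    simpa using ((tendsto_nhdsWithin_of_tendsto_nhds tendsto_id).comp
      (tendsto_fst (f := 𝓝[>] (0 : ℝ)) (g := 𝓝 x₀))).const_mul C
  have hpos : ∀ᶠ ħ : ℝ in 𝓝[>] 0, 0 < ħ := self_mem_nhdsWithin
  refine squeeze_zero_norm' ?_ hħ
  filter_upwards [hC, hpos.prod_inl (𝓝 x₀)] with p hp hħ
  have hħ' : (p.1 : ℂ) ≠ 0 := Complex.ofReal_ne_zero.2 hħ.ne'
  rw [htrunc, norm_pow, Real.norm_of_nonneg hħ.le] at hp
  have e : (taylorCoeff (quantumPhase S F χ g p.1 p.2) (k + 1) -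
      ((PowerSeries.coeff (k + 1) (pullbackSeries S g p.2) : ℝ) : ℂ)) / (p.1 : ℂ) -
        amplitudeCoeff S hM₂ hg (k + 1) p.2 =
      ((p.1 : ℂ) ^ (k + 1) * (((k : ℂ) + 1) * L p) -
        (((k : ℂ) + 1) * (Complex.I * (PowerSeries.coeff (k + 1) (pullbackSeries S g p.2) : ℝ)) *
        (p.1 : ℂ) ^ k + c p.2 * (p.1 : ℂ) ^ (k + 1))) /
        ((Complex.I * ((k : ℂ) + 1)) * (p.1 : ℂ) ^ (k + 1)) := by
    rw [taylorCoeff_quantumPhase_succ, amplitudeCoeff]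
    change (p.1 / Complex.I * L p - _) / _ - c p.2 / _ = _
    field_simp
    ring
  rw [e, norm_div, norm_mul, norm_pow, norm_mul, Complex.norm_I, one_mul, Complex.norm_real,
    Real.norm_of_nonneg hħ.le, div_le_iff₀ (by positivity)]
  have hk1 : (1 : ℝ) ≤ ‖(k : ℂ) + 1‖ := by
    rw [← Nat.cast_succ, Complex.norm_natCast]
    exact_mod_cast k.succ_pos
  have hC0 : 0 ≤ C * p.1 ^ (k + 1 + 1) := (norm_nonneg _).trans hp
  calc _ ≤ C * p.1 ^ (k + 1 + 1) := hp
    _ ≤ ‖(k : ℂ) + 1‖ * (C * p.1 ^ (k + 1 + 1)) := le_mul_of_one_le_left hC0 hk1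
    _ = _ := by ring

end Main

end Microformal

end

theorem theorem2 {n₁ n₂ : ℕ} {M₁ : Type*} [TopologicalSpace M₁]
    [ChartedSpace (EuclideanSpace ℝ (Fin n₁)) M₁] [IsManifold (𝓡 n₁) ∞ M₁]
    (M₂ : Set (Microformal.Coord n₂)) (hM₂ : IsOpen M₂)
    (S : Microformal.QuantumGeneratingFunction n₁ M₁ M₂)
    (g : Microformal.Coord n₂ → ℝ) (hg : ContDiffOn ℝ ∞ g M₂) :
    ∃ (f : M₁ → PowerSeries ℝ) (a : ℕ → M₁ → ℂ),
      -- `f = Φ^*[t g]`, a formal power series in `t` with smooth coefficients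
      (∀ x, ∀ h : PowerSeries ℝ,
        Microformal.IsNonlinearPullback (S.classical x) (S.base x) g h ↔ h = f x) ∧
      (∀ j, ContMDiff (𝓡 n₁) 𝓘(ℝ, ℝ) ∞ (fun x => PowerSeries.coeff j (f x))) ∧
      (∀ j, Continuous (a j)) ∧
      ∀ F : ℝ → M₁ → Microformal.Coord n₂ → ℂ, S.IsRepresentedBy F →
      ∀ χ : Microformal.Coord n₂ → ℝ, ContDiff ℝ ∞ χ → HasCompactSupport χ → tsupport χ ⊆ M₂ →
      ∃ ψ : ℝ → M₁ → ℝ → ℂ, ∀ x₀ : M₁, χ =ᶠ[𝓝 (S.base x₀)] 1 →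
        (∀ᶠ p : ℝ × M₁ in 𝓝[>] 0 ×ˢ 𝓝 x₀,
          (∀ t : ℝ, Microformal.QuantumPullbackConverges M₂ F p.1
            (Microformal.waveFunction χ g p.1 t) p.2) ∧
          AnalyticAt ℝ (ψ p.1 p.2) 0 ∧
          ∀ᶠ t : ℝ in 𝓝 0,
            Microformal.quantumPullback M₂ F p.1 (Microformal.waveFunction χ g p.1 t) p.2
              = Complex.exp (Complex.I / (p.1 : ℂ) * ψ p.1 p.2 t)) ∧
        ∀ j : ℕ, Tendsto
          (fun p : ℝ × M₁ =>
            (iteratedDeriv j (ψ p.1 p.2) 0 / (j.factorial : ℂ)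
              - ((PowerSeries.coeff j (f p.2) : ℝ) : ℂ)) / (p.1 : ℂ) - a j p.2)
          (𝓝[>] 0 ×ˢ 𝓝 x₀) (𝓝 0) := by
  open Microformal in
  refine ⟨pullbackSeries S g, amplitudeCoeff S hM₂ hg,
    fun x h => isNonlinearPullback_iff_eq_pullbackSeries S hM₂ hg x h,
    contMDiff_coeff_pullbackSeries S hM₂ hg, continuous_amplitudeCoeff hM₂ hg,
    fun F hF χ hχ hχc hχM => ⟨quantumPhase S F χ g, fun x₀ hx₀ => ?_⟩⟩
  have hgc : ContDiffOn ℝ ∞ (fun y => (g y : ℂ)) M₂ :=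
    Complex.ofRealCLM.contDiff.comp_contDiffOn hg
  -- The functions χgᵏ as Schwartz functions, whose pullbacks are the moments in the expansion in t.
  choose v hv using fun k : ℕ =>
    Microformal.exists_schwartz_cutoff hM₂ hχ hχc hχM (hgc.pow k)
  refine ⟨?_, fun j => ?_⟩
  · filter_upwards [Microformal.eventually_quantumPhase hF hM₂ hg hχ hχc hχM hv hx₀]
      with p ⟨hħ, hconv, ⟨han, _⟩, hslit⟩
    obtain ⟨hL, hexp, -⟩ := Microformal.analyticAt_log_comp han hslit
    refine ⟨hconv, analyticAt_const.add (analyticAt_const.mul hL), ?_⟩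
    filter_upwards [hexp] with t ht
    exact Microformal.quantumPullback_eq_exp_quantumPhase hħ.ne' ht
  · cases j with
    | zero => exact Microformal.tendsto_quantumPhase_zero hF hM₂ hg hχ hχc hχM hv hx₀
    | succ k => exact Microformal.tendsto_quantumPhase_succ hF hM₂ hg hχ hχc hχM hv hx₀ k
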